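/- Let $n\ge 1$, let $\mathbb R^{n+1}_+=\{x\in\mathbb R^{n+1}: x_{n+1}>0\}$, let $E_{n+1}$ be the $(n+1)$-st coordinate unit vector and $\bar N=-E_{n+1}$. Let $\Omega\subset\mathbb R^{n+1}_+$ be a bounded domain (non-empty, open, connected) with piecewise smooth boundary $\partial\Omega=\Sigma\cup T$, where $T=\partial\Omega\cap\partial\mathbb R^{n+1}_+$ and $\Sigma=\overline{\partial\Omega\cap\mathbb R^{n+1}_+}$ is a compact smooth hypersurface in $\overline{\mathbb R^{n+1}_+}$ whose boundary is the non-empty $(n-1)$-dimensional smooth submanifold $\Gamma=\Sigma\cap T$, and $\Omega$ lies locally on one side of $\Sigma$ in $\mathbb R^{n+1}_+$. Let $\nu$ be the outward unit normal of $\Omega$ along $\Sigma$, extended continuously up to $\Gamma$. Let $c,c_0\in\mathbb R$, and suppose that there is a function $f\in W^{1,\infty}(\Omega)\cap W^{2,2}(\Omega)$ with $f\le 0$ in $\Omega$ such that $$\Delta f=1\ \text{ in }\Omega,\qquad f=0\ \text{ on }\Sigma,\qquad \partial_{\bar N}f=c\ \text{ on }T,\qquad \partial_\nu f=c_0\ \text{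 on }\Sigma,$$ where the equation and the inequality hold almost everywhere and the boundary values of $f$ and $\nabla f$ are taken in the sense of traces. Then $c_0>0$, and there is a point $z\in\mathbb R^{n+1}$ with $z_{n+1}=(n+1)c$ such that $$\Omega=B_{(n+1)c_0}(z)\cap\mathbb R^{n+1}_+,\qquad f(x)=\frac{|x-z|^2-(n+1)^2c_0^2}{2(n+1)}\quad\text{for (almost every) }x\in\Omega .$$ In particular, $\Sigma=\partial B_{(n+1)c_0}(z)\cap\overline{\mathbb R^{n+1}_+}$ is a spherical cap which meets $\partial\mathbb R^{n+1}_+$ at a constant contact angle $\theta\in(0,\pi)$ with $\cos\theta=-\dfrac{c}{c_0}$; that is, at every point of $\Gamma$ one has $\nu=-\cos\theta\,\bar N+\sin\theta\,\bar\nu$, where $\bar\nu$ is the outward unit conormal of $\Gamma$ in $T$. -/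

import Mathlib

open MeasureTheory Filter Topology
open scoped ContDiff ENNReal RealInnerProductSpace

noncomputable section

namespace HalfSpace

/-- The Euclidean space `ℝ^{n+1}`; the coordinate `x_{n+1}` is the one with index `Fin.last n`. -/
abbrev E (n : ℕ) : Type := EuclideanSpace ℝ (Fin (n + 1))

/-- The open upper half-space. -/
def upper (n : ℕ) : Set (E n) := {x | 0 < x (Fin.last n)}

/-- The boundary hyperplane of the upper half-space. -/
def hyperplane (n : ℕ) : Set (E n) := {x | x (Fin.last n) = 0}

/-- The unit vector `E_{n+1}`. -/
def e (n : ℕ) : E n := EuclideanSpace.single (Fin.last n) (1 : ℝ)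

/-- The downward unit normal `N̄ = -E_{n+1}` of the hyperplane. -/
def Nbar (n : ℕ) : E n := -e n

variable {n : ℕ}

/-! ### The domains -/

/-- `Σ`, the closure of the part of `∂Ω` in the open half-space. -/
def capPart (Ω : Set (E n)) : Set (E n) := closure (frontier Ω ∩ upper n)

/-- `T`, the part of `∂Ω` in the hyperplane. -/
def flatPart (Ω : Set (E n)) : Set (E n) := frontier Ω ∩ hyperplane n

/-- `Γ = Σ ∩ T`. -/
def corner (Ω : Set (E n)) : Set (E n) := capPart Ω ∩ flatPart Ω

/-- `v` is the outward unit normal of `Ω` at `x`, a point near which `Ω` is the sublevel set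
`{ρ < 0}` of a smooth function `ρ` with non-vanishing gradient at `x`. -/
def IsOuterUnitNormal (Ω : Set (E n)) (x v : E n) : Prop :=
  ‖v‖ = 1 ∧ ∃ ρ : E n → ℝ, ContDiff ℝ ∞ ρ ∧ (∃ a : ℝ, 0 < a ∧ gradient ρ x = a • v) ∧
    ∀ᶠ y in 𝓝 x, (y ∈ Ω ↔ ρ y < 0)

/-- The standing assumption on `Ω`: a bounded domain in the open half-space such that `Σ` is a
compact smooth hypersurface with boundary `Γ ≠ ∅`. No assumption is made on the angle between
`Σ` and the hyperplane (it may vary along `Γ`). -/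
structure IsAdmissible (Ω : Set (E n)) : Prop where
  isOpen : IsOpen Ω
  isConnected : IsConnected Ω
  isBounded : Bornology.IsBounded Ω
  subset_upper : Ω ⊆ upper n
  /-- Inside the open half-space, `∂Ω` is a smooth hypersurface with `Ω` on one side of it. -/
  smooth_interior : ∀ x ∈ frontier Ω ∩ upper n, ∃ v, IsOuterUnitNormal Ω x v
  /-- Near each point of `Γ`, `Σ` is a smooth hypersurface with boundary `Γ`, and `Γ` is a smooth
  submanifold of codimension two in `ℝ^{n+1}`. -/
  smooth_boundary : ∀ x ∈ corner Ω, ∃ ρ η : E n → ℝ, ContDiff ℝ ∞ ρ ∧ ContDiff ℝ ∞ η ∧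
    LinearIndependent ℝ ![gradient ρ x, gradient η x] ∧
    ∀ᶠ y in 𝓝 x, (y ∈ capPart Ω ↔ ρ y = 0 ∧ 0 ≤ η y) ∧ (y ∈ corner Ω ↔ ρ y = 0 ∧ η y = 0)
  corner_nonempty : (corner Ω).Nonempty

/-- `ν` is the outward unit normal field of `Ω` along `Σ`, extended continuously up to `Γ`. -/
structure IsOuterNormalField (Ω : Set (E n)) (ν : E n → E n) : Prop where
  isNormal : ∀ x ∈ frontier Ω ∩ upper n, IsOuterUnitNormal Ω x (ν x)
  continuousOn : ContinuousOn ν (capPart Ω)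

/-- `τ` is the outward unit conormal of `Γ` in `T` at `x`: it is the outward unit normal at `x`
of `T`, viewed as a domain in the hyperplane. -/
def IsOuterConormal (Ω : Set (E n)) (x τ : E n) : Prop :=
  ‖τ‖ = 1 ∧ τ (Fin.last n) = 0 ∧ ∃ η : E n → ℝ, ContDiff ℝ ∞ η ∧
    (∃ a : ℝ, 0 < a ∧ gradient η x = a • τ) ∧
    ∀ᶠ y in 𝓝 x, y ∈ hyperplane n → (y ∈ flatPart Ω ↔ η y ≤ 0)

/-- `Σ` meets the hyperplane at the constant contact angle `θ`. -/
def MeetsAtAngle (Ω : Set (E n)) (ν : E n → E n) (θ : ℝ) : Prop :=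
  ∀ x ∈ corner Ω, ∃ τ, IsOuterConormal Ω x τ ∧
    ν x = -(Real.cos θ • Nbar n) + Real.sin θ • τ

/-! ### Sobolev functions and traces -/

/-- The classical partial derivative `∂_i φ`. -/
def pderiv (i : Fin (n + 1)) (φ : E n → ℝ) (x : E n) : ℝ :=
  fderiv ℝ φ x (EuclideanSpace.single i (1 : ℝ))

/-- `w` is the weak partial derivative `∂_i u` in `Ω`. -/
def HasWeakPartial (Ω : Set (E n)) (i : Fin (n + 1)) (u w : E n → ℝ) : Prop :=
  LocallyIntegrableOn u Ω ∧ LocallyIntegrableOn w Ω ∧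
    ∀ φ : E n → ℝ, ContDiff ℝ ∞ φ → HasCompactSupport φ → tsupport φ ⊆ Ω →
      ∫ x in Ω, u x * pderiv i φ x = -∫ x in Ω, w x * φ x

/-- `u ∈ W^{1,p}(Ω)`. -/
def MemW1 (Ω : Set (E n)) (p : ℝ≥0∞) (u : E n → ℝ) : Prop :=
  MemLp u p (volume.restrict Ω) ∧
    ∀ i, ∃ w, HasWeakPartial Ω i u w ∧ MemLp w p (volume.restrict Ω)

/-- `u ∈ W^{2,p}(Ω)`. -/
def MemW2 (Ω : Set (E n)) (p : ℝ≥0∞) (u : E n → ℝ) : Prop :=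
  MemLp u p (volume.restrict Ω) ∧ ∀ i, ∃ w, HasWeakPartial Ω i u w ∧ MemW1 Ω p w

/-- The functions `φ k` converge to `u` in `W^{1,2}(Ω)`. -/
def TendstoW12 (Ω : Set (E n)) (φ : ℕ → E n → ℝ) (u : E n → ℝ) : Prop :=
  Tendsto (fun k => eLpNorm (φ k - u) 2 (volume.restrict Ω)) atTop (𝓝 0) ∧
    ∀ i, ∃ w, HasWeakPartial Ω i u w ∧ MemLp w 2 (volume.restrict Ω) ∧
      Tendsto (fun k => eLpNorm (pderiv i (φ k) - w) 2 (volume.restrict Ω)) atTop (𝓝 0)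

/-- `g ∈ L²(S)` is the trace of `u ∈ W^{1,2}(Ω)` on the piece `S` of the boundary, with respect
to the surface measure (`n`-dimensional Hausdorff measure): the trace is the continuous extension
of the restriction `φ ↦ φ|_S` from smooth functions on the closure of `Ω` to `W^{1,2}(Ω)`. -/
def HasTrace (Ω S : Set (E n)) (u g : E n → ℝ) : Prop :=
  MemLp u 2 (volume.restrict Ω) ∧ MemLp g 2 (μHE[n].restrict S) ∧
    ∃ φ : ℕ → E n → ℝ, (∀ k, ContDiff ℝ ∞ (φ k)) ∧ TendstoW12 Ω φ u ∧
      Tendsto (fun k => eLpNorm (φ k - g) 2 (μHE[n].restrict S)) atTop (𝓝 0)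

/-- The derivative of `f` in the direction of the field `N` is equal to the constant `κ` on `S`:
`⟨∇f, N⟩ = κ` almost everywhere on `S`, where `∇f` on `S` consists of the traces of the weak
partial derivatives of `f`. -/
def NormalDerivEq (Ω S : Set (E n)) (N : E n → E n) (f : E n → ℝ) (κ : ℝ) : Prop :=
  ∃ w γ : Fin (n + 1) → E n → ℝ,
    (∀ i, HasWeakPartial Ω i f (w i)) ∧ (∀ i, HasTrace Ω S (w i) (γ i)) ∧
      ∀ᵐ x ∂(μHE[n].restrict S), ∑ i, γ i x * N x i = κ

/-- `Δ f = h` almost everywhere in `Ω`, in terms of the weak second derivatives of `f`. -/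
def LaplacianEq (Ω : Set (E n)) (f h : E n → ℝ) : Prop :=
  ∃ w d : Fin (n + 1) → E n → ℝ,
    (∀ i, HasWeakPartial Ω i f (w i)) ∧ (∀ i, HasWeakPartial Ω i (w i) (d i)) ∧
      ∀ᵐ x ∂(volume.restrict Ω), ∑ i, d i x = h x

/-- `f ∈ W^{1,∞}(Ω) ∩ W^{2,2}(Ω)` solves the mixed boundary value problem `Δ f = 1` in `Ω`,
`f = 0` on `Σ`, `∂_{N̄} f = c` on `T`. -/
structure IsMixedSolution (Ω : Set (E n)) (c : ℝ) (f : E n → ℝ) : Prop where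
  memW1 : MemW1 Ω ∞ f
  memW2 : MemW2 Ω 2 f
  laplacian : LaplacianEq Ω f (fun _ => 1)
  dirichlet : HasTrace Ω (capPart Ω) f (fun _ => 0)
  neumann : NormalDerivEq Ω (flatPart Ω) (fun _ => Nbar n) f c

end HalfSpace

end

open MeasureTheory Filter Topology
open scoped ContDiff ENNReal RealInnerProductSpace
noncomputable section
namespace HalfSpace
variable {n : ℕ}

/-! ### Partial derivatives of smooth functions -/

/-! Write K = n + 1, w = ∇f, D = ∇²f, and let g = w + c e_{n+1} be the gradient of f + c x_{n+1}, so
that g_{n+1} = 0 on T. Since f = 0 on Σ, the gradient is normal there, and the overdetermined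
condition says w = c₀ν on Σ; in particular Q = |w|² - c₀² vanishes on Σ. Therefore none of the
fields f g, f x, Q g, Q x and ⟨w,x⟩ g - ⟨w,g⟩ x has a flux through ∂Ω: on Σ a factor vanishes or the
field is tangential, and on T the last components of g and x vanish. The same holds for the fields f
g_j (D_ij E_i - D_ii E_j), where on T one also uses that w_{n+1} is constant there. A linear
combination of the resulting integrals reads ∫ f |D - I/K|² = 0 (`IsSolution.isNull_traceless`).

As f ≤ 0, the integrand vanishes a.e. On {f = 0} one has w = 0 a.e., hence D = 0 a.e., which
contradicts tr D = 1; so f ≠ 0 a.e. and D = I/K (`IsSolution.hessian_eq`). By connectedness f = |x -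
z|²/(2K) + b. The relation w = c₀ν puts Σ on the sphere of radius K c₀ about z, the Neumann
condition gives z_{n+1} = K c, and Ω, which has no frontier in the connected set B ∩ {x_{n+1} > 0},
fills it. Smoothness of Σ up to Γ excludes that the sphere touches the hyperplane, so the contact
angle lies in (0, π).

The analytic difficulty is a divergence theorem for fields that are merely L², on a domain whose
corner angles are arbitrary. No surface integrals of Sobolev functions are formed. That u has no
flux in direction i through ∂Ω ∩ U means that the extension of u by zero has a weak derivative in U
(`ExtPartial`), and two functions have equal traces if their difference has this property in every
direction (`IsFluxEq`). Both notions are stable under multiplication by bounded Sobolev functions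
(`IsMultiplier`). They meet the geometry in two places only: the flux is bounded by the L² norm on
the boundary (`exists_flux_bound`), so that functions of zero trace extend by zero, and the flux is
parallel to the normal (`integral_tangential_eq_zero`). Local statements are glued by a partition of
unity. The corner Γ has codimension two, hence zero 2-capacity, and is invisible to L² fields
(`HasDivOn.exists_of_compl`). Testing with a function equal to 1 on Ω then gives
`IsAdmissible.isNull_div`. -/

theorem contDiff_pderiv {φ : E n → ℝ} (hφ : ContDiff ℝ ∞ φ) (i : Fin (n + 1)) :
    ContDiff ℝ ∞ (pderiv i φ) := by
  unfold pderiv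
  exact (hφ.fderiv_right (m := ∞) (by simp)).clm_apply contDiff_const

theorem contDiff_coord (i : Fin (n + 1)) : ContDiff ℝ ∞ (fun x : E n => x i) :=
  contDiff_piLp_apply 2

theorem _root_.ContDiff.diffAt {φ : E n → ℝ} (hφ : ContDiff ℝ ∞ φ) (x : E n) :
    DifferentiableAt ℝ φ x :=
  (hφ.differentiable (by simp)) x

theorem pderiv_add {φ ψ : E n → ℝ} (hφ : ContDiff ℝ ∞ φ) (hψ : ContDiff ℝ ∞ ψ)
    (i : Fin (n + 1)) (x : E n) :
    pderiv i (fun y => φ y + ψ y) x = pderiv i φ x + pderiv i ψ x := by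
  simp [pderiv, fderiv_fun_add (hφ.diffAt x) (hψ.diffAt x)]

theorem pderiv_sub {φ ψ : E n → ℝ} (hφ : ContDiff ℝ ∞ φ) (hψ : ContDiff ℝ ∞ ψ)
    (i : Fin (n + 1)) (x : E n) :
    pderiv i (fun y => φ y - ψ y) x = pderiv i φ x - pderiv i ψ x := by
  simp [pderiv, fderiv_fun_sub (hφ.diffAt x) (hψ.diffAt x)]

theorem pderiv_mul {φ ψ : E n → ℝ} (hφ : ContDiff ℝ ∞ φ) (hψ : ContDiff ℝ ∞ ψ)
    (i : Fin (n + 1)) (x : E n) :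
    pderiv i (fun y => φ y * ψ y) x = pderiv i φ x * ψ x + φ x * pderiv i ψ x := by
  simp [pderiv, fderiv_fun_mul (hφ.diffAt x) (hψ.diffAt x)]
  ring

theorem pderiv_const (a : ℝ) (i : Fin (n + 1)) (x : E n) :
    pderiv i (fun _ : E n => a) x = 0 := by
  simp [pderiv]

theorem pderiv_sum {ι : Type*} (s : Finset ι) {φ : ι → E n → ℝ}
    (hφ : ∀ l ∈ s, ContDiff ℝ ∞ (φ l)) (i : Fin (n + 1)) (x : E n) :
    pderiv i (fun y => ∑ l ∈ s, φ l y) x = ∑ l ∈ s, pderiv i (φ l) x := by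
  simp only [pderiv]
  rw [fderiv_fun_sum (fun l hl => (hφ l hl).diffAt x)]
  simp

theorem pderiv_coord (i j : Fin (n + 1)) (x : E n) :
    pderiv i (fun y => y j) x = if i = j then 1 else 0 := by
  have h : (fun y : E n => y j) = EuclideanSpace.proj (𝕜 := ℝ) j := rfl
  rw [pderiv, h, ContinuousLinearMap.fderiv]
  simp [eq_comm]

theorem pderiv_comm {φ : E n → ℝ} (hφ : ContDiff ℝ ∞ φ) (i j : Fin (n + 1)) (x : E n) :
    pderiv i (pderiv j φ) x = pderiv j (pderiv i φ) x := by
  have hd : DifferentiableAt ℝ (fderiv ℝ φ) x :=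
    ((hφ.fderiv_right (m := ∞) (by simp)).differentiable (by simp)) x
  have key : ∀ i j : Fin (n + 1), pderiv i (pderiv j φ) x =
      fderiv ℝ (fderiv ℝ φ) x (EuclideanSpace.single i 1) (EuclideanSpace.single j 1) := by
    intro i j
    have : pderiv j φ = fun y => fderiv ℝ φ y (EuclideanSpace.single j 1) := rfl
    rw [pderiv, this, fderiv_clm_apply hd (differentiableAt_const _)]
    simp
  rw [key, key]
  exact (hφ.contDiffAt.isSymmSndFDerivAt (by simpa using ENat.LEInfty.out)).eq _ _

theorem pderiv_comp {φ : E n → ℝ} {θ : ℝ → ℝ} (hφ : ContDiff ℝ ∞ φ) (hθ : ContDiff ℝ ∞ θ)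
    (i : Fin (n + 1)) (x : E n) :
    pderiv i (fun y => θ (φ y)) x = deriv θ (φ x) * pderiv i φ x := by
  have h := ((hθ.differentiable (by simp)) (φ x)).hasDerivAt.comp_hasFDerivAt x
    (hφ.diffAt x).hasFDerivAt
  rw [pderiv, show (fun y => θ (φ y)) = θ ∘ φ from rfl, h.fderiv]
  simp [pderiv]

theorem pderiv_eq_of_eventuallyEq {φ ψ : E n → ℝ} {x : E n} (h : φ =ᶠ[𝓝 x] ψ)
    (i : Fin (n + 1)) : pderiv i φ x = pderiv i ψ x := by
  simp [pderiv, h.fderiv_eq]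

theorem gradient_apply {φ : E n → ℝ} (x : E n) (i : Fin (n + 1)) :
    (gradient φ x) i = pderiv i φ x := by
  have h : inner ℝ (gradient φ x) (EuclideanSpace.single i (1 : ℝ)) = pderiv i φ x := by
    simp [gradient, pderiv, InnerProductSpace.toDual_symm_apply]
  rw [← h, EuclideanSpace.inner_single_right]
  simp only [one_mul, conj_trivial]

theorem inner_gradient {φ : E n → ℝ} (x v : E n) :
    inner ℝ (gradient φ x) v = fderiv ℝ φ x v := by
  simp [gradient, InnerProductSpace.toDual_symm_apply]

theorem fderiv_eq_sum (φ : E n → ℝ) (x v : E n) :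
    fderiv ℝ φ x v = ∑ i, v i * pderiv i φ x := by
  rw [← inner_gradient, PiLp.inner_apply]
  simp [gradient_apply]

/-! ### Test functions -/

/-- Smooth functions whose support is a compact subset of `U`. -/
structure IsTest (U : Set (E n)) (ψ : E n → ℝ) : Prop where
  smooth : ContDiff ℝ ∞ ψ
  compact : HasCompactSupport ψ
  supp : tsupport ψ ⊆ U

namespace IsTest

variable {U V : Set (E n)} {ψ χ : E n → ℝ}

theorem mono (h : IsTest U ψ) (hUV : U ⊆ V) : IsTest V ψ :=
  ⟨h.smooth, h.compact, h.supp.trans hUV⟩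

theorem mul (h : IsTest U ψ) (hv : ContDiff ℝ ∞ χ) : IsTest U (fun x => ψ x * χ x) :=
  ⟨h.smooth.mul hv, h.compact.mul_right, (tsupport_mul_subset_left (f := ψ) (g := χ)).trans h.supp⟩

theorem mul_supp (h : IsTest U ψ) (hv : ContDiff ℝ ∞ χ) (hs : tsupport χ ⊆ V) :
    IsTest V (fun x => ψ x * χ x) :=
  ⟨h.smooth.mul hv, h.compact.mul_right, (tsupport_mul_subset_right (f := ψ) (g := χ)).trans hs⟩

theorem mul_left (h : IsTest U ψ) (hv : ContDiff ℝ ∞ χ) : IsTest U (fun x => χ x * ψ x) := by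
  simpa [mul_comm] using h.mul hv

theorem add (h : IsTest U ψ) (h' : IsTest U χ) : IsTest U (fun x => ψ x + χ x) :=
  ⟨h.smooth.add h'.smooth, h.compact.add h'.compact,
    (tsupport_add ψ χ).trans (Set.union_subset h.supp h'.supp)⟩

theorem neg (h : IsTest U ψ) : IsTest U (fun x => -ψ x) := by
  simpa using h.mul_left (contDiff_const (c := (-1 : ℝ)))

theorem sub (h : IsTest U ψ) (h' : IsTest U χ) : IsTest U (fun x => ψ x - χ x) := by
  simpa [sub_eq_add_neg] using h.add h'.neg

theorem tsupport_pderiv (ψ : E n → ℝ) (i : Fin (n + 1)) : tsupport (pderiv i ψ) ⊆ tsupport ψ :=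
  tsupport_fderiv_apply_subset ℝ _

theorem pderiv (h : IsTest U ψ) (i : Fin (n + 1)) : IsTest U (pderiv i ψ) :=
  ⟨contDiff_pderiv h.smooth i, h.compact.mono' ((subset_tsupport _).trans (tsupport_pderiv ψ i)),
    (tsupport_pderiv ψ i).trans h.supp⟩

theorem continuous (h : IsTest U ψ) : Continuous ψ := h.smooth.continuous

theorem integrable (h : IsTest U ψ) (μ : Measure (E n)) [IsFiniteMeasureOnCompacts μ] :
    Integrable ψ μ := h.continuous.integrable_of_hasCompactSupport h.compact

theorem bounded (h : IsTest U ψ) : ∃ C, 0 ≤ C ∧ ∀ x, |ψ x| ≤ C := by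
  obtain ⟨C, hC⟩ := h.compact.exists_bound_of_continuous h.continuous
  exact ⟨C, (norm_nonneg _).trans (hC 0), hC⟩

theorem memLp (h : IsTest U ψ) (p : ℝ≥0∞) (μ : Measure (E n)) [IsFiniteMeasureOnCompacts μ] :
    MemLp ψ p μ := h.continuous.memLp_of_hasCompactSupport h.compact

theorem integral_pderiv (h : IsTest U ψ) (i : Fin (n + 1)) : ∫ x, HalfSpace.pderiv i ψ x = 0 := by
  have := integral_mul_fderiv_eq_neg_fderiv_mul_of_integrable (μ := (volume : Measure (E n)))
    (f := fun _ : E n => (1 : ℝ)) (g := ψ) (v := EuclideanSpace.single i 1) (by simp)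
    (by simp only [one_mul]; exact (h.pderiv i).integrable volume)
    (by simpa only [one_mul] using h.integrable volume)
    (fun _ _ => differentiableAt_const _) (fun x _ => h.smooth.diffAt x)
  simpa [HalfSpace.pderiv] using this

theorem eq_zero_of_notMem (h : IsTest U ψ) {x : E n} (hx : x ∉ U) : ψ x = 0 :=
  image_eq_zero_of_notMem_tsupport fun h' => hx (h.supp h')

end IsTest

/-- A smooth function on an open set agrees near a given point with a globally smooth one. -/
theorem exists_contDiff_extension {V : Set (E n)} (hV : IsOpen V) {x₀ : E n} (hx : x₀ ∈ V)
    {h : E n → ℝ} (hh : ContDiffOn ℝ ∞ h V) :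
    ∃ k : E n → ℝ, ContDiff ℝ ∞ k ∧ k =ᶠ[𝓝 x₀] h := by
  obtain ⟨r, hr, hb⟩ := Metric.isOpen_iff.1 hV x₀ hx
  let β : ContDiffBump x₀ := ⟨r / 3, r / 2, by positivity, by linarith⟩
  have hsub : tsupport β ⊆ V := by
    rw [β.tsupport_eq]
    exact (Metric.closedBall_subset_ball (by change r / 2 < r; linarith)).trans hb
  refine ⟨fun x => β x * h x, ?_, ?_⟩
  · refine contDiff_iff_contDiffAt.2 fun x => ?_
    by_cases hx : x ∈ tsupport β
    swap
    · have h0 : (fun x => β x * h x) =ᶠ[𝓝 x] fun _ => 0 := by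
        filter_upwards [(isClosed_tsupport β).isOpen_compl.mem_nhds hx] with y hy
        simp [image_eq_zero_of_notMem_tsupport hy]
      exact contDiffAt_const.congr_of_eventuallyEq h0
    have hx' : x ∈ V := hsub hx
    exact β.contDiff.contDiffAt.mul ((hh x hx').contDiffAt (hV.mem_nhds hx'))
  · filter_upwards [β.eventuallyEq_one] with x hx
    simp [hx]

/-! ### Tangential derivatives integrate to zero -/

/-- The tangential derivatives of a test function have mean value zero on the sublevel set of a
smooth function. -/
theorem integral_tangential_eq_zero {Ω U : Set (E n)} (hΩ : MeasurableSet Ω) {ρ : E n → ℝ}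
    (hρ : ContDiff ℝ ∞ ρ) (hU : ∀ y ∈ U, (y ∈ Ω ↔ ρ y < 0)) {φ : E n → ℝ} (hφ : IsTest U φ)
    (j k : Fin (n + 1)) :
    ∫ x in Ω, (pderiv k φ x * pderiv j ρ x - pderiv j φ x * pderiv k ρ x) = 0 := by
  set A : E n → ℝ := fun x => pderiv k φ x * pderiv j ρ x - pderiv j φ x * pderiv k ρ x with hA
  have hAt : IsTest U A :=
    ((hφ.pderiv k).mul (contDiff_pderiv hρ j)).sub ((hφ.pderiv j).mul (contDiff_pderiv hρ k))
  -- The cutoffs θ_m(ρ) vanish for ρ ≥ 0 and tend to 1 for ρ < 0. The antisymmetric operator ∂_kφ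
  -- ∂_jρ - ∂_jφ ∂_kρ does not see factors that depend on ρ only, so θ_m(ρ) A is still a difference
  -- of derivatives of test functions.
  let θ : ℕ → ℝ → ℝ := fun m t => Real.smoothTransition (-(m * t))
  have hθ : ∀ m, ContDiff ℝ ∞ (θ m) := fun m =>
    Real.smoothTransition.contDiff.comp (contDiff_const.mul contDiff_id).neg
  have hθρ : ∀ m, ContDiff ℝ ∞ (fun x => θ m (ρ x)) := fun m => (hθ m).comp hρ
  have hzero : ∀ m : ℕ, ∫ x, θ m (ρ x) * A x = 0 := by
    intro m
    have hk : IsTest U (fun x => φ x * (θ m (ρ x) * pderiv j ρ x)) :=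
      hφ.mul ((hθρ m).mul (contDiff_pderiv hρ j))
    have hj : IsTest U (fun x => φ x * (θ m (ρ x) * pderiv k ρ x)) :=
      hφ.mul ((hθρ m).mul (contDiff_pderiv hρ k))
    have heq : (fun x => θ m (ρ x) * A x) = fun x =>
        pderiv k (fun x => φ x * (θ m (ρ x) * pderiv j ρ x)) x -
          pderiv j (fun x => φ x * (θ m (ρ x) * pderiv k ρ x)) x := by
      funext x
      rw [pderiv_mul hφ.smooth ((hθρ m).mul (contDiff_pderiv hρ j)),
        pderiv_mul hφ.smooth ((hθρ m).mul (contDiff_pderiv hρ k)),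
        pderiv_mul (hθρ m) (contDiff_pderiv hρ j), pderiv_mul (hθρ m) (contDiff_pderiv hρ k),
        pderiv_comp hρ (hθ m), pderiv_comp hρ (hθ m), pderiv_comm hρ k j]
      simp only [hA]
      ring
    rw [heq, integral_sub ((hk.pderiv k).integrable _) ((hj.pderiv j).integrable _),
      hk.integral_pderiv, hj.integral_pderiv, sub_zero]
  have hlim : Tendsto (fun m : ℕ => ∫ x, θ m (ρ x) * A x) atTop (𝓝 (∫ x, Ω.indicator A x)) := by
    refine tendsto_integral_of_dominated_convergence (fun x => |A x|) (fun m => ?_)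
      (hAt.integrable _).abs (fun m => ?_) ?_
    · exact ((hθρ m).continuous.mul hAt.continuous).aestronglyMeasurable
    · refine Eventually.of_forall fun x => ?_
      rw [Real.norm_eq_abs, abs_mul, abs_of_nonneg (Real.smoothTransition.nonneg _)]
      exact mul_le_of_le_one_left (abs_nonneg _) (Real.smoothTransition.le_one _)
    · refine Eventually.of_forall fun x => ?_
      by_cases hx : x ∈ U
      · by_cases hxΩ : x ∈ Ω
        · rw [Set.indicator_of_mem hxΩ]
          have hneg : 0 < -ρ x := neg_pos.2 ((hU x hx).1 hxΩ)
          obtain ⟨M, hM⟩ := exists_nat_gt (1 / -ρ x)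
          refine tendsto_const_nhds.congr' ?_
          filter_upwards [eventually_ge_atTop M] with m hm
          have : (1 : ℝ) ≤ -(m * ρ x) := by
            have h1 : 1 / -ρ x ≤ m := hM.le.trans (by exact_mod_cast hm)
            rw [div_le_iff₀ hneg] at h1
            linarith
          simp [θ, Real.smoothTransition.one_of_one_le this]
        · rw [Set.indicator_of_notMem hxΩ]
          have hge : 0 ≤ ρ x := not_lt.1 fun h => hxΩ ((hU x hx).2 h)
          refine tendsto_const_nhds.congr fun m => ?_
          have : -((m : ℝ) * ρ x) ≤ 0 := by
            have := mul_nonneg (Nat.cast_nonneg (α := ℝ) m) hge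
            linarith
          simp [θ, Real.smoothTransition.zero_of_nonpos this]
      · have : A x = 0 := hAt.eq_zero_of_notMem hx
        have h0 : Ω.indicator A x = 0 := by
          by_cases hxΩ : x ∈ Ω <;> simp [hxΩ, this]
        simp [this, h0]
  rw [← integral_indicator hΩ]
  refine tendsto_nhds_unique hlim ?_
  simp [hzero]

/-! ### Fubini in one coordinate direction -/

/-- The point with `i`-th coordinate `t` and other coordinates `y`. -/
def ins (i : Fin (n + 1)) (t : ℝ) (y : Fin n → ℝ) : E n := WithLp.toLp 2 (i.insertNth t y)

/-- The coordinates other than the `i`-th. -/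
def del (i : Fin (n + 1)) (x : E n) : Fin n → ℝ := fun k => x (i.succAbove k)

@[simp] theorem ins_same (i : Fin (n + 1)) (t : ℝ) (y : Fin n → ℝ) : ins i t y i = t := by
  simp [ins]

@[simp] theorem ins_succAbove (i : Fin (n + 1)) (t : ℝ) (y : Fin n → ℝ) (k : Fin n) :
    ins i t y (i.succAbove k) = y k := by
  simp [ins]

@[simp] theorem del_ins (i : Fin (n + 1)) (t : ℝ) (y : Fin n → ℝ) : del i (ins i t y) = y := by
  funext k; simp [del]

theorem measurePreserving_ins (i : Fin (n + 1)) :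
    MeasurePreserving (fun p : ℝ × (Fin n → ℝ) => ins i p.1 p.2) :=
  (PiLp.volume_preserving_toLp (Fin (n + 1))).comp
    ((volume_preserving_piFinSuccAbove (fun _ => ℝ) i).symm _)

theorem measurableEmbedding_ins (i : Fin (n + 1)) :
    MeasurableEmbedding (fun p : ℝ × (Fin n → ℝ) => ins i p.1 p.2) :=
  ((MeasurableEquiv.piFinSuccAbove (fun _ : Fin (n + 1) => ℝ) i).symm.trans
    (MeasurableEquiv.toLp 2 (Fin (n + 1) → ℝ))).measurableEmbedding

theorem integral_eq_integral_ins (i : Fin (n + 1)) {F : E n → ℝ} (hF : Integrable F) :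
    ∫ x, F x = ∫ y : Fin n → ℝ, ∫ t : ℝ, F (ins i t y) := by
  rw [← (measurePreserving_ins i).integral_comp (measurableEmbedding_ins i)]
  have hI : Integrable (fun p : ℝ × (Fin n → ℝ) => F (ins i p.1 p.2)) (volume.prod volume) :=
    (measurePreserving_ins i).integrable_comp_of_integrable hF
  exact integral_prod_symm _ hI

theorem lintegral_eq_lintegral_ins (i : Fin (n + 1)) {F : E n → ℝ≥0∞} (hF : Measurable F) :
    ∫⁻ x, F x = ∫⁻ y : Fin n → ℝ, ∫⁻ t : ℝ, F (ins i t y) := by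
  rw [← (measurePreserving_ins i).lintegral_comp hF]
  exact lintegral_prod_symm' _ (hF.comp (measurePreserving_ins i).measurable)

theorem ins_eq_add (i : Fin (n + 1)) (t : ℝ) (y : Fin n → ℝ) :
    ins i t y = ins i 0 y + t • EuclideanSpace.single i (1 : ℝ) := by
  ext k
  rcases Fin.eq_self_or_eq_succAbove i k with rfl | ⟨k, rfl⟩
  · simp
  · simp

theorem contDiff_ins (i : Fin (n + 1)) (y : Fin n → ℝ) : ContDiff ℝ ∞ (fun t => ins i t y) := by
  rw [funext fun t => ins_eq_add i t y]
  exact contDiff_const.add (contDiff_id.smul contDiff_const)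

theorem hasDerivAt_comp_ins {φ : E n → ℝ} (hφ : ContDiff ℝ ∞ φ) (i : Fin (n + 1)) (t : ℝ)
    (y : Fin n → ℝ) : HasDerivAt (fun s => φ (ins i s y)) (pderiv i φ (ins i t y)) t := by
  have h1 : HasDerivAt (fun s => ins i s y) (EuclideanSpace.single i (1 : ℝ)) t := by
    rw [funext fun t => ins_eq_add i t y]
    simpa using ((hasDerivAt_id t).smul_const (EuclideanSpace.single i (1 : ℝ))).const_add
      (ins i 0 y)
  exact (hφ.diffAt _).hasFDerivAt.comp_hasDerivAt t h1

/-- The open cube of centre `x₀` and half side `r`. -/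
def cube (x₀ : E n) (r : ℝ) : Set (E n) := {x | ∀ k, x k ∈ Set.Ioo (x₀ k - r) (x₀ k + r)}

theorem cube_eq (x₀ : E n) {r : ℝ} (hr : 0 < r) :
    cube x₀ r = (WithLp.ofLp : E n → Fin (n + 1) → ℝ) ⁻¹' Metric.ball (WithLp.ofLp x₀) r := by
  ext x
  simp only [cube, Set.mem_ofPred_eq, Set.mem_preimage, Metric.mem_ball, dist_pi_lt_iff hr,
    Real.dist_eq, abs_lt, Set.mem_Ioo]
  refine forall_congr' fun k => ?_
  constructor <;> rintro ⟨h1, h2⟩ <;> constructor <;> linarith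

theorem isOpen_cube (x₀ : E n) {r : ℝ} (hr : 0 < r) : IsOpen (cube x₀ r) := by
  rw [cube_eq x₀ hr]
  exact Metric.isOpen_ball.preimage (PiLp.continuous_ofLp 2 _)

theorem mem_cube_self (x₀ : E n) {r : ℝ} (hr : 0 < r) : x₀ ∈ cube x₀ r := fun k => by
  constructor <;> linarith

theorem exists_cube_subset {x₀ : E n} {s : Set (E n)} (hs : s ∈ 𝓝 x₀) :
    ∃ r > 0, cube x₀ r ⊆ s := by
  have h : 𝓝 x₀ = comap (WithLp.ofLp : E n → Fin (n + 1) → ℝ) (𝓝 (WithLp.ofLp x₀)) :=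
    (PiLp.homeomorph 2 (fun _ : Fin (n + 1) => ℝ)).isInducing.nhds_eq_comap x₀
  rw [h, (Metric.nhds_basis_ball.comap _).mem_iff] at hs
  obtain ⟨r, hr, hs⟩ := hs
  exact ⟨r, hr, by rwa [cube_eq x₀ hr]⟩

theorem ins_mem_cube {x₀ : E n} {r : ℝ} {i : Fin (n + 1)} {t : ℝ} {y : Fin n → ℝ} :
    ins i t y ∈ cube x₀ r ↔ t ∈ Set.Ioo (x₀ i - r) (x₀ i + r) ∧
      ∀ k, y k ∈ Set.Ioo (x₀ (i.succAbove k) - r) (x₀ (i.succAbove k) + r) := by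
  constructor
  · intro h
    exact ⟨by simpa using h i, fun k => by simpa using h (i.succAbove k)⟩
  · rintro ⟨h1, h2⟩ k
    rcases Fin.eq_self_or_eq_succAbove i k with rfl | ⟨k, rfl⟩
    · simpa using h1
    · simpa using h2 k

/-! ### The flux through a graph is controlled by the Hausdorff measure -/

/-- If the strictly monotone r has a zero t₀, then S is cut off there and the integral of g' over
one side is ±g(t₀). Without a zero, S contains all or nothing of the interval and the integral
vanishes. This is the one-dimensional slice of the flux bound. -/
theorem integral_section_bound {a b : ℝ} {g r : ℝ → ℝ} (hg : ContDiff ℝ 1 g)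
    (hgs : HasCompactSupport g) (hg0 : ∀ t, t ∉ Set.Ioo a b → deriv g t = 0)
    (hr : ContinuousOn r (Set.Ioo a b))
    (hm : StrictMonoOn r (Set.Ioo a b) ∨ StrictAntiOn r (Set.Ioo a b)) {S : Set ℝ}
    (hS : ∀ t ∈ Set.Ioo a b, (t ∈ S ↔ r t < 0)) (hne : ∫ t, S.indicator (deriv g) t ≠ 0) :
    ∃ t₀ ∈ Set.Ioo a b, r t₀ = 0 ∧ |∫ t, S.indicator (deriv g) t| ≤ |g t₀| := by
  by_cases hz : ∃ t₀ ∈ Set.Ioo a b, r t₀ = 0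
  · obtain ⟨t₀, ht₀, h0⟩ := hz
    refine ⟨t₀, ht₀, h0, ?_⟩
    rcases hm with hm | hm
    · have : S.indicator (deriv g) =ᵐ[volume] (Set.Iic t₀).indicator (deriv g) := by
        filter_upwards [compl_mem_ae_iff.2 (measure_singleton (μ := volume) t₀)] with t ht
        have ht : t ≠ t₀ := ht
        by_cases htI : t ∈ Set.Ioo a b
        · have h1 : t ∈ S ↔ t ∈ Set.Iic t₀ := by
            rw [hS t htI, ← h0, hm.lt_iff_lt htI ht₀, Set.mem_Iic]
            exact ⟨le_of_lt, fun h => lt_of_le_of_ne h ht⟩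
          by_cases h2 : t ∈ S
          · rw [Set.indicator_of_mem h2, Set.indicator_of_mem (h1.1 h2)]
          · rw [Set.indicator_of_notMem h2, Set.indicator_of_notMem (fun h => h2 (h1.2 h))]
        · simp [Set.indicator, hg0 t htI]
      rw [integral_congr_ae this, integral_indicator measurableSet_Iic,
        hgs.integral_Iic_deriv_eq hg]
    · have : S.indicator (deriv g) =ᵐ[volume] (Set.Ioi t₀).indicator (deriv g) := by
        refine Eventually.of_forall fun t => ?_
        by_cases htI : t ∈ Set.Ioo a b
        · have h1 : t ∈ S ↔ t ∈ Set.Ioi t₀ := by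
            rw [hS t htI, ← h0, hm.lt_iff_gt htI ht₀, Set.mem_Ioi]
          by_cases h2 : t ∈ S
          · rw [Set.indicator_of_mem h2, Set.indicator_of_mem (h1.1 h2)]
          · rw [Set.indicator_of_notMem h2, Set.indicator_of_notMem (fun h => h2 (h1.2 h))]
        · simp [Set.indicator, hg0 t htI]
      rw [integral_congr_ae this, integral_indicator measurableSet_Ioi,
        hgs.integral_Ioi_deriv_eq hg, abs_neg]
  · exfalso
    push Not at hz
    apply hne
    have hint : ∫ t, deriv g t = 0 := by
      refine integral_eq_zero_of_hasDerivAt_of_integrable (f := g)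
        (fun t => ((hg.differentiable one_ne_zero) t).hasDerivAt) ?_
        (hg.continuous.integrable_of_hasCompactSupport hgs)
      exact (hg.continuous_deriv le_rfl).integrable_of_hasCompactSupport hgs.deriv
    by_cases hex : ∃ t ∈ Set.Ioo a b, r t < 0
    · obtain ⟨s, hs, hrs⟩ := hex
      have hall : ∀ t ∈ Set.Ioo a b, r t < 0 := by
        intro t ht
        by_contra hcon
        obtain ⟨u, hu, hu0⟩ := isPreconnected_Ioo.intermediate_value hs ht hr
          ⟨hrs.le, not_lt.1 hcon⟩
        exact hz u hu hu0
      have : S.indicator (deriv g) = deriv g := by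
        funext t
        by_cases htI : t ∈ Set.Ioo a b
        · rw [Set.indicator_of_mem ((hS t htI).2 (hall t htI))]
        · simp [Set.indicator, hg0 t htI]
      rw [this, hint]
    · push Not at hex
      have : S.indicator (deriv g) = fun _ => 0 := by
        funext t
        by_cases htI : t ∈ Set.Ioo a b
        · rw [Set.indicator_of_notMem fun h => not_lt.2 (hex t htI) ((hS t htI).1 h)]
        · simp [Set.indicator, hg0 t htI]
      rw [this, integral_zero]

theorem lipschitzWith_del (i : Fin (n + 1)) : LipschitzWith 1 (del i : E n → Fin n → ℝ) := by
  refine LipschitzWith.of_dist_le_mul fun x y => ?_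
  rw [NNReal.coe_one, one_mul, dist_pi_le_iff dist_nonneg]
  intro k
  have h := (PiLp.lipschitzWith_ofLp 2 (fun _ : Fin (n + 1) => ℝ)).dist_le_mul x y
  rw [NNReal.coe_one, one_mul] at h
  exact (dist_le_pi_dist (WithLp.ofLp x) (WithLp.ofLp y) (i.succAbove k)).trans h

/-- Forgetting a coordinate is 1-Lipschitz into the sup-norm space, whose n-dimensional Hausdorff
measure is Lebesgue measure. The constant K only undoes the normalisation of `μHE`. -/
theorem exists_volume_del_image_le (n : ℕ) :
    ∃ K : ℝ≥0∞, K ≠ ⊤ ∧ ∀ (i : Fin (n + 1)) (s : Set (E n)),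
      volume (del i '' s) ≤ K * μHE[n] s := by
  set a : NNReal := (volume : Measure (EuclideanSpace ℝ (Fin n))).addHaarScalarFactor μH[(n : ℝ)]
    with ha
  have ha0 : a ≠ 0 := Measure.addHaarScalarFactor_volume_hausdorffMeasure_ne_zero n
  refine ⟨(a : ℝ≥0∞)⁻¹, by simpa using ha0, fun i s => ?_⟩
  have h1 : volume (del i '' s) ≤ μH[(n : ℝ)] s := by
    have h := (lipschitzWith_del i).hausdorffMeasure_image_le (d := n) (Nat.cast_nonneg n) s
    rw [← hausdorffMeasure_pi_real, Fintype.card_fin]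
    simpa using h
  refine h1.trans (le_of_eq ?_)
  rw [Measure.euclideanHausdorffMeasure_def, ← ha, Measure.smul_apply, ENNReal.smul_def,
    smul_eq_mul, ← mul_assoc, ENNReal.inv_mul_cancel (by simpa using ha0) (by simp), one_mul]

theorem measurableSet_cube (x₀ : E n) (r : ℝ) : MeasurableSet (cube x₀ r) := by
  have : cube x₀ r = ⋂ k, (fun x : E n => x k) ⁻¹' Set.Ioo (x₀ k - r) (x₀ k + r) := by
    ext x; simp [cube]
  rw [this]
  exact MeasurableSet.iInter fun k =>
    (contDiff_coord k).continuous.measurable measurableSet_Ioo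

/-- Along each line in direction i the defining function is strictly monotone, so the integral over
the slice is, up to sign, the value of φ at the single boundary point on that line, or zero. The
projected surface measure dominates Lebesgue measure on the relevant lines, and Cauchy–Schwarz turns
the L¹ bound into an L² bound. -/
theorem exists_flux_bound {Ω : Set (E n)} (hΩ : MeasurableSet Ω) {x₀ : E n} {r : ℝ}
    {ρ : E n → ℝ} (hρ : ContDiff ℝ ∞ ρ) (hU : ∀ y ∈ cube x₀ r, (y ∈ Ω ↔ ρ y < 0))
    (i : Fin (n + 1))
    (hd : (∀ y ∈ cube x₀ r, 0 < pderiv i ρ y) ∨ (∀ y ∈ cube x₀ r, pderiv i ρ y < 0)) :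
    ∃ C : ℝ≥0∞, C ≠ ⊤ ∧ ∀ φ, IsTest (cube x₀ r) φ →
      ‖∫ x in Ω, pderiv i φ x‖ₑ ≤
        C * eLpNorm φ 2 (μHE[n].restrict {y | y ∈ cube x₀ r ∧ ρ y = 0}) := by
  obtain ⟨K, hK, hvol⟩ := exists_volume_del_image_le n
  set Z : Set (E n) := {y | y ∈ cube x₀ r ∧ ρ y = 0} with hZ
  set B : Set (Fin n → ℝ) :=
    Set.pi Set.univ fun k => Set.Ioo (x₀ (i.succAbove k) - r) (x₀ (i.succAbove k) + r) with hB
  have hBfin : volume B ≠ ⊤ := by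
    rw [hB, Real.volume_pi_Ioo]
    exact ENNReal.prod_ne_top fun _ _ => ENNReal.ofReal_ne_top
  refine ⟨K ^ ((1 : ℝ) / 2) * volume B ^ ((1 : ℝ) / 2), ENNReal.mul_ne_top
    (ENNReal.rpow_ne_top_of_nonneg one_half_pos.le hK)
    (ENNReal.rpow_ne_top_of_nonneg one_half_pos.le hBfin), fun φ hφ => ?_⟩
  set F : E n → ℝ := Ω.indicator (pderiv i φ) with hF
  have hFint : Integrable F := ((hφ.pderiv i).integrable volume).indicator hΩ
  set Φ : (Fin n → ℝ) → ℝ := fun y => ∫ t, F (ins i t y) with hΦ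
  have hFmeas : Measurable F := (hφ.pderiv i).continuous.measurable.indicator hΩ
  have hΦmeas : StronglyMeasurable Φ := by
    have : StronglyMeasurable fun p : ℝ × (Fin n → ℝ) => F (ins i p.1 p.2) :=
      (hFmeas.comp (measurePreserving_ins i).measurable).stronglyMeasurable
    exact this.integral_prod_left'
  have hmono : ∀ y : Fin n → ℝ,
      (∀ k, y k ∈ Set.Ioo (x₀ (i.succAbove k) - r) (x₀ (i.succAbove k) + r)) →
      StrictMonoOn (fun t => ρ (ins i t y)) (Set.Ioo (x₀ i - r) (x₀ i + r)) ∨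
      StrictAntiOn (fun t => ρ (ins i t y)) (Set.Ioo (x₀ i - r) (x₀ i + r)) := by
    intro y hy
    have hc : ContinuousOn (fun t => ρ (ins i t y)) (Set.Ioo (x₀ i - r) (x₀ i + r)) :=
      (hρ.comp (contDiff_ins i y)).continuous.continuousOn
    rcases hd with hd | hd
    · refine Or.inl (strictMonoOn_of_deriv_pos (convex_Ioo _ _) hc fun t ht => ?_)
      rw [interior_Ioo] at ht
      rw [(hasDerivAt_comp_ins hρ i t y).deriv]
      exact hd _ (ins_mem_cube.2 ⟨ht, hy⟩)
    · refine Or.inr (strictAntiOn_of_deriv_neg (convex_Ioo _ _) hc fun t ht => ?_)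
      rw [interior_Ioo] at ht
      rw [(hasDerivAt_comp_ins hρ i t y).deriv]
      exact hd _ (ins_mem_cube.2 ⟨ht, hy⟩)
  have hkey : ∀ y, Φ y ≠ 0 → ∃ t, ins i t y ∈ Z ∧ |Φ y| ≤ |φ (ins i t y)| := by
    intro y hy
    have hyB : ∀ k, y k ∈ Set.Ioo (x₀ (i.succAbove k) - r) (x₀ (i.succAbove k) + r) := by
      by_contra hcon
      apply hy
      have : ∀ t, F (ins i t y) = 0 := fun t => by
        have h0 : pderiv i φ (ins i t y) = 0 :=
          (hφ.pderiv i).eq_zero_of_notMem fun h => hcon (ins_mem_cube.1 h).2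
        simp [hF, Set.indicator, h0]
      simp [hΦ, this]
    have hder : deriv (fun t => φ (ins i t y)) = fun t => pderiv i φ (ins i t y) :=
      funext fun t => (hasDerivAt_comp_ins hφ.smooth i t y).deriv
    have hΦy : Φ y = ∫ t, {t | ins i t y ∈ Ω}.indicator (deriv fun t => φ (ins i t y)) t := by
      rw [hder]
      rfl
    have hsupp : HasCompactSupport fun t => φ (ins i t y) := by
      refine HasCompactSupport.of_support_subset_isCompact
        (isCompact_Icc (a := x₀ i - r) (b := x₀ i + r)) fun t ht => ?_
      by_contra hcon
      exact ht (hφ.eq_zero_of_notMem fun h => hcon (Set.Ioo_subset_Icc_self (ins_mem_cube.1 h).1))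
    rw [hΦy] at hy ⊢
    obtain ⟨t, htI, ht0, hle⟩ := integral_section_bound (a := x₀ i - r) (b := x₀ i + r)
      (g := fun t => φ (ins i t y)) (r := fun t => ρ (ins i t y))
      ((hφ.smooth.comp (contDiff_ins i y)).of_le ENat.LEInfty.out) hsupp
      (fun t ht => by
        rw [hder]
        exact (hφ.pderiv i).eq_zero_of_notMem fun h => ht (ins_mem_cube.1 h).1)
      (hρ.comp (contDiff_ins i y)).continuous.continuousOn (hmono y hyB)
      (fun t ht => hU _ (ins_mem_cube.2 ⟨ht, hyB⟩)) hy
    exact ⟨t, ⟨ins_mem_cube.2 ⟨htI, hyB⟩, ht0⟩, hle⟩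
  -- The boundary point above a given y is unique by strict monotonicity, so the point supplied by
  -- `hkey` is z itself.
  have hbd : ∀ z ∈ Z, ‖Φ (del i z)‖ ≤ ‖φ z‖ := by
    intro z hz
    by_cases h0 : Φ (del i z) = 0
    · simp [h0]
    obtain ⟨t, ht, hle⟩ := hkey _ h0
    have hzi : ins i (z i) (del i z) = z := by
      ext k
      rcases Fin.eq_self_or_eq_succAbove i k with rfl | ⟨k, rfl⟩
      · simp
      · simp [del]
    have hz' : ins i (z i) (del i z) ∈ Z := by rwa [hzi]
    have htz : t = z i := by
      have hI := ins_mem_cube.1 ht.1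
      have hI' := ins_mem_cube.1 hz'.1
      have heq : (fun t => ρ (ins i t (del i z))) t = (fun t => ρ (ins i t (del i z))) (z i) :=
        ht.2.trans hz'.2.symm
      rcases hmono _ hI.2 with hm | hm
      · exact hm.injOn hI.1 hI'.1 heq
      · exact hm.injOn hI.1 hI'.1 heq
    rw [htz, hzi] at hle
    exact hle
  set G : Set (Fin n → ℝ) := {y | Φ y ≠ 0} with hG
  have hGmeas : MeasurableSet G := (hΦmeas.measurable (measurableSet_singleton 0)).compl
  have hGB : G ⊆ B := fun y hy k _ => by
    obtain ⟨t, ht, -⟩ := hkey y hy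
    exact (ins_mem_cube.1 ht.1).2 k
  have hmdel : Measurable (del i : E n → Fin n → ℝ) := (lipschitzWith_del i).continuous.measurable
  -- Every y in G is the projection of a point of Z, hence Lebesgue measure on G is bounded by the
  -- projection of surface measure.
  have hmeasure : volume.restrict G ≤ K • (μHE[n].restrict Z).map (del i) := by
    refine Measure.le_iff.2 fun A hA => ?_
    rw [Measure.restrict_apply hA, Measure.smul_apply, Measure.map_apply hmdel hA,
      Measure.restrict_apply (hmdel hA), smul_eq_mul]
    refine (measure_mono ?_).trans (hvol i _)
    rintro y ⟨hyA, hyG⟩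
    obtain ⟨t, ht, -⟩ := hkey y hyG
    exact ⟨ins i t y, ⟨by simpa using hyA, ht⟩, by simp⟩
  have hZmeas : MeasurableSet Z :=
    (measurableSet_cube x₀ r).inter (hρ.continuous.measurable (measurableSet_singleton 0))
  have hrestr : ∀ p, eLpNorm Φ p volume = eLpNorm Φ p (volume.restrict G) := fun p => by
    rw [← eLpNorm_indicator_eq_eLpNorm_restrict hGmeas]
    congr 1
    funext y
    by_cases hy : Φ y = 0 <;> simp [hG, hy]
  calc ‖∫ x in Ω, pderiv i φ x‖ₑ = ‖∫ y, Φ y‖ₑ := by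
        rw [← integral_indicator hΩ, integral_eq_integral_ins i hFint]
    _ ≤ ∫⁻ y, ‖Φ y‖ₑ := enorm_integral_le_lintegral_enorm _
    _ = eLpNorm Φ 1 (volume.restrict G) := by rw [← eLpNorm_one_eq_lintegral_enorm, hrestr]
    _ ≤ eLpNorm Φ 2 (volume.restrict G) * volume B ^ ((1 : ℝ) / 2) := by
        have h := eLpNorm_le_eLpNorm_mul_rpow_measure_univ (μ := volume.restrict G)
          (one_le_two : (1 : ℝ≥0∞) ≤ 2) hΦmeas.aestronglyMeasurable
        rw [Measure.restrict_apply_univ, ENNReal.toReal_one, ENNReal.toReal_ofNat,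
          show (1 : ℝ) / 1 - 1 / 2 = 1 / 2 by norm_num] at h
        exact h.trans (by gcongr)
    _ ≤ eLpNorm Φ 2 (K • (μHE[n].restrict Z).map (del i)) * volume B ^ ((1 : ℝ) / 2) := by
        gcongr
    _ = K ^ ((1 : ℝ) / 2) * eLpNorm (Φ ∘ del i) 2 (μHE[n].restrict Z) *
          volume B ^ ((1 : ℝ) / 2) := by
        rw [eLpNorm_smul_measure_of_ne_top (by norm_num),
          eLpNorm_map_measure hΦmeas.aestronglyMeasurable hmdel.aemeasurable, smul_eq_mul,
          ENNReal.toReal_div, ENNReal.toReal_one, ENNReal.toReal_ofNat]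
    _ ≤ K ^ ((1 : ℝ) / 2) * eLpNorm φ 2 (μHE[n].restrict Z) * volume B ^ ((1 : ℝ) / 2) := by
        gcongr
        refine eLpNorm_mono_ae ?_
        filter_upwards [ae_restrict_mem hZmeas] with z hz using hbd z hz
    _ = _ := by ring

/-! ### Boundary charts -/

theorem eventually_neg_of_hasDerivAt {h : ℝ → ℝ} {h' : ℝ} (hd : HasDerivAt h h' 0) (h0 : h 0 = 0)
    (hneg : h' < 0) : ∀ᶠ t in 𝓝[>] (0 : ℝ), h t < 0 := by
  have hs := hasDerivAt_iff_tendsto_slope.1 hd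
  have hs' : Tendsto (slope h 0) (𝓝[>] 0) (𝓝 h') :=
    hs.mono_left (nhdsWithin_mono _ fun x (hx : 0 < x) => hx.ne')
  filter_upwards [hs'.eventually_lt_const hneg, self_mem_nhdsWithin] with t ht (ht0 : 0 < t)
  rw [slope_def_field, h0, sub_zero, sub_zero, div_neg_iff] at ht
  rcases ht with ht | ht
  · exact absurd ht.2 (not_lt.2 ht0.le)
  · exact ht.1

theorem hasDerivAt_comp_line {ρ : E n → ℝ} (hρ : ContDiff ℝ ∞ ρ) (y v : E n) (t : ℝ) :
    HasDerivAt (fun s : ℝ => ρ (y + s • v)) (inner ℝ (gradient ρ (y + t • v)) v) t := by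
  have h1 : HasDerivAt (fun s : ℝ => y + s • v) v t := by
    simpa using ((hasDerivAt_id t).smul_const v).const_add y
  rw [inner_gradient]
  exact (hρ.diffAt _).hasFDerivAt.comp_hasDerivAt t h1

theorem eventually_neg_of_inner_gradient_neg {ρ : E n → ℝ} (hρ : ContDiff ℝ ∞ ρ) {y v : E n}
    (h0 : ρ y = 0) (hneg : inner ℝ (gradient ρ y) v < 0) :
    ∀ᶠ t in 𝓝[>] (0 : ℝ), ρ (y + t • v) < 0 := by
  refine eventually_neg_of_hasDerivAt (hasDerivAt_comp_line hρ y v 0) ?_ ?_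
  · simpa using h0
  · simpa using hneg

theorem eventually_pos_of_inner_gradient_pos {ρ : E n → ℝ} (hρ : ContDiff ℝ ∞ ρ) {y v : E n}
    (h0 : ρ y = 0) (hpos : 0 < inner ℝ (gradient ρ y) v) :
    ∀ᶠ t in 𝓝[>] (0 : ℝ), 0 < ρ (y + t • v) := by
  have h := (hasDerivAt_comp_line hρ y v 0).neg
  have := eventually_neg_of_hasDerivAt h (by simp [h0]) (by simpa using hpos)
  simpa using this

theorem tendsto_add_smul (y v : E n) : Tendsto (fun t : ℝ => y + t • v) (𝓝[>] 0) (𝓝 y) := by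
  have : Continuous fun t : ℝ => y + t • v := by fun_prop
  simpa using (this.tendsto 0).mono_left nhdsWithin_le_nhds

/-- With d the difference ŵ - û of the normalisations, strict Cauchy–Schwarz gives ⟨u,d⟩ < 0 < ⟨w,d⟩
unless they agree. -/
theorem normalize_eq_of_inner_neg {u w : E n} (hu : u ≠ 0) (hw : w ≠ 0)
    (h : ∀ d : E n, inner ℝ u d < 0 → inner ℝ w d ≤ 0) : ‖u‖⁻¹ • u = ‖w‖⁻¹ • w := by
  have hu' : ‖‖u‖⁻¹ • u‖ = 1 := by
    rw [norm_smul, norm_inv, norm_norm, inv_mul_cancel₀ (norm_ne_zero_iff.2 hu)]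
  have hw' : ‖‖w‖⁻¹ • w‖ = 1 := by
    rw [norm_smul, norm_inv, norm_norm, inv_mul_cancel₀ (norm_ne_zero_iff.2 hw)]
  by_contra hne
  have hlt : inner ℝ (‖u‖⁻¹ • u) (‖w‖⁻¹ • w) < 1 :=
    (inner_lt_one_iff_real_of_norm_eq_one hu' hw').2 hne
  set û := ‖u‖⁻¹ • u
  set ŵ := ‖w‖⁻¹ • w
  have hupos : 0 < ‖u‖ := norm_pos_iff.2 hu
  have hwpos : 0 < ‖w‖ := norm_pos_iff.2 hw
  have hû : u = ‖u‖ • û := by simp [û, smul_smul, hupos.ne']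
  have hŵ : w = ‖w‖ • ŵ := by simp [ŵ, smul_smul, hwpos.ne']
  have h1 : inner ℝ u (ŵ - û) < 0 := by
    rw [hû, inner_smul_left, inner_sub_right, real_inner_self_eq_norm_sq, hu']
    simp only [conj_trivial]
    exact mul_neg_of_pos_of_neg hupos (by linarith)
  have h2 := h _ h1
  rw [hŵ, inner_smul_left, inner_sub_right, real_inner_self_eq_norm_sq, hw', real_inner_comm]
    at h2
  simp only [conj_trivial] at h2
  have := mul_pos hwpos (show 0 < 1 ^ 2 - inner ℝ û ŵ by linarith)
  linarith

/-- Near `U`, the set `Ω` is the sublevel set of `ρ`. -/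
theorem eq_zero_of_mem_frontier {Ω U : Set (E n)} (hΩ : IsOpen Ω) (hU : IsOpen U) {ρ : E n → ℝ}
    (hρ : Continuous ρ) (h : ∀ y ∈ U, (y ∈ Ω ↔ ρ y < 0)) {y : E n} (hy : y ∈ U)
    (hf : y ∈ frontier Ω) : ρ y = 0 := by
  have h1 : 0 ≤ ρ y := not_lt.1 fun hlt => by
    rw [hΩ.frontier_eq] at hf
    exact hf.2 ((h y hy).2 hlt)
  have h2 : ρ y ≤ 0 := by
    by_contra hcon
    have hpos : {z | 0 < ρ z} ∩ U ∈ 𝓝 y :=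
      ((isOpen_lt continuous_const hρ).inter hU).mem_nhds ⟨not_le.1 hcon, hy⟩
    obtain ⟨z, hz, hzΩ⟩ := mem_closure_iff_nhds.1 (frontier_subset_closure hf) _ hpos
    exact lt_asymm hz.1 ((h z hz.2).1 hzΩ)
  exact le_antisymm h2 h1

theorem mem_frontier_of_eq_zero {Ω U : Set (E n)} (hU : IsOpen U) {ρ : E n → ℝ}
    (hρ : ContDiff ℝ ∞ ρ) (h : ∀ y ∈ U, (y ∈ Ω ↔ ρ y < 0)) {y : E n} (hy : y ∈ U)
    (hg : gradient ρ y ≠ 0) (h0 : ρ y = 0) : y ∈ frontier Ω := by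
  have hneg : inner ℝ (gradient ρ y) (-gradient ρ y) < 0 := by
    rw [inner_neg_right, real_inner_self_eq_norm_sq]
    have := norm_pos_iff.2 hg
    have : 0 < ‖gradient ρ y‖ ^ 2 := by positivity
    linarith
  refine ⟨?_, fun hint => ?_⟩
  · refine mem_closure_of_tendsto (tendsto_add_smul y (-gradient ρ y)) ?_
    filter_upwards [eventually_neg_of_inner_gradient_neg hρ h0 hneg,
      (tendsto_add_smul y (-gradient ρ y)).eventually (hU.mem_nhds hy)] with t ht htU
    exact (h _ htU).2 ht
  · have := (h y hy).1 (interior_subset hint)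
    linarith

/-- A direction which enters {ρ' < 0} to first order cannot enter {ρ > 0}, because both functions
describe Ω near y. So the two gradients point the same way, and the normal does not depend on the
defining function. -/
theorem IsOuterUnitNormal.eq_normalize {Ω U : Set (E n)} (hΩ : IsOpen Ω) (hU : IsOpen U)
    {ρ : E n → ℝ} (hρ : ContDiff ℝ ∞ ρ) (h : ∀ y ∈ U, (y ∈ Ω ↔ ρ y < 0)) {y v : E n} (hy : y ∈ U)
    (hf : y ∈ frontier Ω) (hg : gradient ρ y ≠ 0) (hv : IsOuterUnitNormal Ω y v) :
    v = ‖gradient ρ y‖⁻¹ • gradient ρ y := by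
  obtain ⟨hv1, ρ', hρ', ⟨a, ha, hga⟩, hnear⟩ := hv
  obtain ⟨V, hVsub, hV, hyV⟩ := mem_nhds_iff.1 hnear
  have h0' : ρ' y = 0 := eq_zero_of_mem_frontier hΩ hV hρ'.continuous hVsub hyV hf
  have h0 : ρ y = 0 := eq_zero_of_mem_frontier hΩ hU hρ.continuous h hy hf
  have hv0 : v ≠ 0 := by
    rintro rfl
    simp at hv1
  have key := normalize_eq_of_inner_neg hv0 hg fun d hd => by
    by_contra hcon
    have hneg : inner ℝ (gradient ρ' y) d < 0 := by
      rw [hga, inner_smul_left]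
      exact mul_neg_of_pos_of_neg (by simpa using ha) hd
    have hev := (eventually_neg_of_inner_gradient_neg hρ' h0' hneg).and
      ((eventually_pos_of_inner_gradient_pos hρ h0 (not_le.1 hcon)).and
      ((tendsto_add_smul y d).eventually
        ((hU.eventually_mem hy).and (hV.eventually_mem hyV))))
    obtain ⟨t, ht1, ht2, ht3, ht4⟩ := hev.exists
    have hm := (hVsub ht4).2 ht1
    exact lt_asymm ht2 ((h _ ht3).1 hm)
  rw [← key, hv1]
  simp

/-- A boundary chart: an open set `U` in which the frontier of `Ω` is a smooth hypersurface, with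
a smooth extension `N` of the outer unit normal. -/
structure IsBoundaryChart (Ω U : Set (E n)) (N : Fin (n + 1) → E n → ℝ) : Prop where
  isOpen : IsOpen U
  smooth : ∀ i, ContDiff ℝ ∞ (N i)
  unit : ∀ y ∈ U, ∑ i, N i y * N i y = 1
  -- As surface integrals, both sides are ∫ φ N_j N_k over ∂Ω: the flux is parallel to N.
  tangential : ∀ φ, IsTest U φ → ∀ j k,
    ∫ x in Ω, pderiv k (fun y => φ y * N j y) x = ∫ x in Ω, pderiv j (fun y => φ y * N k y) x
  flux : ∃ C : ℝ≥0∞, C ≠ ⊤ ∧ ∀ φ, IsTest U φ → ∀ k,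
    ‖∫ x in Ω, pderiv k φ x‖ₑ ≤ C * eLpNorm φ 2 (μHE[n].restrict (frontier Ω ∩ U))
  normal : ∀ y ∈ U, y ∈ frontier Ω → ∀ v, IsOuterUnitNormal Ω y v → ∀ i, v i = N i y
  -- Excludes slits, so that the indicator function of Ω is not a.e. constant near a frontier point.
  exterior : ∀ y ∈ U, y ∈ frontier Ω → y ∈ closure (interior Ωᶜ)

theorem norm_gradient_sq (ρ : E n → ℝ) (y : E n) :
    ‖gradient ρ y‖ ^ 2 = ∑ i, pderiv i ρ y * pderiv i ρ y := by
  rw [EuclideanSpace.real_norm_sq_eq]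
  simp [gradient_apply, sq]

/-- The chart is a cube on which one partial derivative of ρ keeps its sign, as slicing requires.
The normal field is κ∇ρ with κ a global smooth extension of |∇ρ|⁻¹ from a neighbourhood of x₀. -/
theorem exists_isBoundaryChart {Ω : Set (E n)} (hΩ : IsOpen Ω) {x₀ : E n} {ρ : E n → ℝ}
    (hρ : ContDiff ℝ ∞ ρ) (hg : gradient ρ x₀ ≠ 0) (hnear : ∀ᶠ y in 𝓝 x₀, (y ∈ Ω ↔ ρ y < 0))
    {V : Set (E n)} (hV : V ∈ 𝓝 x₀) :
    ∃ U N, x₀ ∈ U ∧ U ⊆ V ∧ IsBoundaryChart Ω U N ∧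
      ∀ y ∈ U, (y ∈ Ω ↔ ρ y < 0) ∧ ∀ i, N i y = ‖gradient ρ y‖⁻¹ * pderiv i ρ y := by
  have hgc : Continuous (gradient ρ) := by
    have : gradient ρ = fun x => WithLp.toLp 2 fun i => pderiv i ρ x := by
      funext x; ext i; simp [gradient_apply]
    rw [this]
    exact (PiLp.continuous_toLp 2 _).comp
      (continuous_pi fun i => (contDiff_pderiv hρ i).continuous)
  set V₁ : Set (E n) := {y | gradient ρ y ≠ 0} with hV₁
  have hV₁o : IsOpen V₁ := isOpen_ne_fun hgc continuous_const
  have hnorm : ∀ y, ‖gradient ρ y‖ = √(∑ i, pderiv i ρ y * pderiv i ρ y) := fun y => by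
    rw [← norm_gradient_sq, Real.sqrt_sq (norm_nonneg _)]
  have hsm : ContDiffOn ℝ ∞ (fun y => ‖gradient ρ y‖⁻¹) V₁ := by
    simp_rw [hnorm]
    have hsum : ContDiff ℝ ∞ fun y => ∑ i, pderiv i ρ y * pderiv i ρ y :=
      ContDiff.sum fun i _ => (contDiff_pderiv hρ i).mul (contDiff_pderiv hρ i)
    intro y hy
    have hpos : 0 < ‖gradient ρ y‖ := norm_pos_iff.2 hy
    refine ((hsum.contDiffAt.sqrt ?_).inv ?_).contDiffWithinAt
    · rw [← norm_gradient_sq]; positivity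
    · rw [← hnorm]; exact hpos.ne'
  obtain ⟨κ, hκ, hκeq⟩ := exists_contDiff_extension hV₁o hg hsm
  obtain ⟨i, hi⟩ : ∃ i, pderiv i ρ x₀ ≠ 0 := by
    by_contra! hcon
    exact hg (by ext i; simp [gradient_apply, hcon])
  set N : Fin (n + 1) → E n → ℝ := fun k y => κ y * pderiv k ρ y with hN
  have hNs : ∀ k, ContDiff ℝ ∞ (N k) := fun k => hκ.mul (contDiff_pderiv hρ k)
  -- See below for the role of this component: with m = 1/N_i near x₀ one has φ = (φ m) N_i, and the
  -- tangential identity turns the flux of φ in any direction k into the flux of φ m N_k in the one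
  -- direction i where slicing is possible.
  have hNi : N i x₀ ≠ 0 := by
    simp only [hN, hκeq.eq_of_nhds]
    exact mul_ne_zero (inv_ne_zero (norm_ne_zero_iff.2 hg)) hi
  obtain ⟨m, hm, hmeq⟩ := exists_contDiff_extension
    (isOpen_ne_fun (hNs i).continuous continuous_const) hNi
    (h := fun y => (N i y)⁻¹) fun y hy => ((hNs i).contDiffAt.inv hy).contDiffWithinAt
  have hsign : (∀ᶠ y in 𝓝 x₀, 0 < pderiv i ρ y) ∨ (∀ᶠ y in 𝓝 x₀, pderiv i ρ y < 0) := by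
    have hc := (contDiff_pderiv hρ i).continuous
    rcases lt_or_gt_of_ne hi with h | h
    · exact Or.inr (hc.continuousAt.eventually_lt_const h)
    · exact Or.inl (hc.continuousAt.eventually_const_lt h)
  have hmb : ∀ᶠ y in 𝓝 x₀, |m y| < |m x₀| + 1 :=
    (hm.continuous.abs.continuousAt).eventually_lt_const (by linarith)
  have hev : ∀ᶠ y in 𝓝 x₀, (y ∈ Ω ↔ ρ y < 0) ∧ y ∈ V ∧ y ∈ V₁ ∧ κ y = ‖gradient ρ y‖⁻¹ ∧
      m y = (N i y)⁻¹ ∧ N i y ≠ 0 ∧ |m y| < |m x₀| + 1 := by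
    filter_upwards [hnear, hV, hV₁o.mem_nhds hg, hκeq, hmeq,
      (isOpen_ne_fun (hNs i).continuous continuous_const).mem_nhds hNi, hmb] with
      y h1 h2 h3 h4 h5 h6 h7 using ⟨h1, h2, h3, h4, h5, h6, h7⟩
  obtain ⟨r, hr, hcube, hd⟩ : ∃ r > 0, (∀ y ∈ cube x₀ r, (y ∈ Ω ↔ ρ y < 0) ∧ y ∈ V ∧ y ∈ V₁ ∧
      κ y = ‖gradient ρ y‖⁻¹ ∧ m y = (N i y)⁻¹ ∧ N i y ≠ 0 ∧ |m y| < |m x₀| + 1) ∧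
      ((∀ y ∈ cube x₀ r, 0 < pderiv i ρ y) ∨ (∀ y ∈ cube x₀ r, pderiv i ρ y < 0)) := by
    rcases hsign with h | h
    · obtain ⟨r, hr, hs⟩ := exists_cube_subset (hev.and h)
      exact ⟨r, hr, fun y hy => (hs hy).1, Or.inl fun y hy => (hs hy).2⟩
    · obtain ⟨r, hr, hs⟩ := exists_cube_subset (hev.and h)
      exact ⟨r, hr, fun y hy => (hs hy).1, Or.inr fun y hy => (hs hy).2⟩
  have hUo := isOpen_cube x₀ hr
  have hUρ : ∀ y ∈ cube x₀ r, (y ∈ Ω ↔ ρ y < 0) := fun y hy => (hcube y hy).1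
  have hunit : ∀ y ∈ cube x₀ r, ∑ k, N k y * N k y = 1 := by
    intro y hy
    obtain ⟨-, -, h3, h4, -⟩ := hcube y hy
    have hpos : ‖gradient ρ y‖ ≠ 0 := norm_ne_zero_iff.2 h3
    have : ∑ k, N k y * N k y = κ y ^ 2 * ∑ k, pderiv k ρ y * pderiv k ρ y := by
      rw [Finset.mul_sum]
      exact Finset.sum_congr rfl fun k _ => by simp only [hN]; ring
    rw [this, ← norm_gradient_sq, h4]
    field_simp
  have htan : ∀ φ, IsTest (cube x₀ r) φ → ∀ j k,
      ∫ x in Ω, pderiv k (fun y => φ y * N j y) x =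
        ∫ x in Ω, pderiv j (fun y => φ y * N k y) x := by
    intro φ hφ j k
    have hφκ := hφ.mul hκ
    rw [← sub_eq_zero, ← integral_sub (((hφ.mul (hNs j)).pderiv k).integrable _)
      (((hφ.mul (hNs k)).pderiv j).integrable _),
      ← integral_tangential_eq_zero hΩ.measurableSet hρ hUρ hφκ j k]
    refine integral_congr_ae (Eventually.of_forall fun x => ?_)
    have e1 : ∀ l, (fun y => φ y * N l y) = fun y => (φ y * κ y) * pderiv l ρ y := fun l => by
      funext y; simp only [hN]; ring
    simp only [e1, pderiv_mul hφκ.smooth (contDiff_pderiv hρ j),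
      pderiv_mul hφκ.smooth (contDiff_pderiv hρ k), pderiv_comm hρ j k]
    ring
  refine ⟨cube x₀ r, N, mem_cube_self x₀ hr, fun y hy => (hcube y hy).2.1, ⟨hUo, hNs, hunit, htan,
    ?_, ?_, ?_⟩, fun y hy => ⟨hUρ y hy, fun k => by simp only [hN, (hcube y hy).2.2.2.1]⟩⟩
  · obtain ⟨C, hC, hflux⟩ := exists_flux_bound hΩ.measurableSet hρ hUρ i hd
    refine ⟨C * ENNReal.ofReal (|m x₀| + 1), ENNReal.mul_ne_top hC ENNReal.ofReal_ne_top,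
      fun φ hφ k => ?_⟩
    have hφm := hφ.mul hm
    have hφeq : φ = fun y => (φ y * m y) * N i y := by
      funext y
      by_cases hy : y ∈ cube x₀ r
      · obtain ⟨-, -, -, -, h5, h6, -⟩ := hcube y hy
        rw [h5, mul_assoc, inv_mul_cancel₀ h6, mul_one]
      · simp [hφ.eq_zero_of_notMem hy]
    have h1 : ∫ x in Ω, pderiv k φ x = ∫ x in Ω, pderiv i (fun y => (φ y * m y) * N k y) x := by
      rw [← htan _ hφm i k, ← hφeq]
    rw [h1]
    refine (hflux _ (hφm.mul (hNs k))).trans ?_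
    rw [mul_assoc]
    gcongr
    have hsub : {y | y ∈ cube x₀ r ∧ ρ y = 0} ⊆ frontier Ω ∩ cube x₀ r := fun y hy =>
      ⟨mem_frontier_of_eq_zero hUo hρ hUρ hy.1 (hcube y hy.1).2.2.1 hy.2, hy.1⟩
    refine (eLpNorm_mono_measure _ (Measure.restrict_mono_set _ hsub)).trans ?_
    refine eLpNorm_le_mul_eLpNorm_of_ae_le_mul ?_ 2
    refine Eventually.of_forall fun y => ?_
    by_cases hy : y ∈ cube x₀ r
    · have h7 := (hcube y hy).2.2.2.2.2.2
      have hNk : |N k y| ≤ 1 := by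
        rw [← sq_le_one_iff_abs_le_one, ← hunit y hy, sq]
        exact Finset.single_le_sum (f := fun k => N k y * N k y)
          (fun k _ => mul_self_nonneg _) (Finset.mem_univ k)
      rw [Real.norm_eq_abs, Real.norm_eq_abs, abs_mul, abs_mul, mul_comm]
      calc |N k y| * (|φ y| * |m y|) ≤ 1 * (|φ y| * (|m x₀| + 1)) := by gcongr
        _ = _ := by ring
    · simp [hφ.eq_zero_of_notMem hy]
  · intro y hy hyf v hv k
    rw [hv.eq_normalize hΩ hUo hρ hUρ hy hyf (hcube y hy).2.2.1]
    simp [hN, gradient_apply, (hcube y hy).2.2.2.1]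
  · intro y hy hyf
    have hgy : gradient ρ y ≠ 0 := (hcube y hy).2.2.1
    have h0 := eq_zero_of_mem_frontier hΩ hUo hρ.continuous hUρ hy hyf
    have hpos : 0 < inner ℝ (gradient ρ y) (gradient ρ y) := real_inner_self_pos.2 hgy
    refine mem_closure_of_tendsto (tendsto_add_smul y (gradient ρ y)) ?_
    filter_upwards [eventually_pos_of_inner_gradient_pos hρ h0 hpos,
      (tendsto_add_smul y (gradient ρ y)).eventually (hUo.mem_nhds hy)] with t ht htU
    refine mem_interior.2 ⟨{z | 0 < ρ z} ∩ cube x₀ r, fun z hz hzΩ => ?_,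
      (isOpen_lt continuous_const hρ.continuous).inter hUo, ht, htU⟩
    exact lt_asymm hz.1 ((hUρ z hz.2).1 hzΩ)

/-! ### Integrability of products -/

theorem memLp_of_continuous {Ω : Set (E n)} (hb : Bornology.IsBounded Ω) {φ : E n → ℝ}
    (hφ : Continuous φ) (p : ℝ≥0∞) : MemLp φ p (volume.restrict Ω) := by
  have hK : IsCompact (closure Ω) := hb.isCompact_closure
  have : IsFiniteMeasure (volume.restrict Ω) :=
    ⟨by rw [Measure.restrict_apply_univ]; exact hb.measure_lt_top⟩
  obtain ⟨C, hC⟩ := hK.exists_bound_of_continuousOn hφ.continuousOn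
  have h : MemLp φ p (volume.restrict (closure Ω)) := by
    have : IsFiniteMeasure (volume.restrict (closure Ω)) :=
      ⟨by rw [Measure.restrict_apply_univ]; exact hK.measure_lt_top⟩
    refine MemLp.of_bound hφ.aestronglyMeasurable C ?_
    filter_upwards [ae_restrict_mem isClosed_closure.measurableSet] with x hx using hC x hx
  exact h.mono_measure (Measure.restrict_mono_set _ subset_closure)

theorem _root_.MeasureTheory.MemLp.integrable_mul_fun {α : Type*} [MeasurableSpace α]
    {μ : Measure α} {f g : α → ℝ} (hf : MemLp f 2 μ) (hg : MemLp g 2 μ) :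
    Integrable (fun x => f x * g x) μ := hf.integrable_mul hg

theorem tendsto_integral_mul_of_tendsto_eLpNorm {α : Type*} [MeasurableSpace α] {μ : Measure α}
    {G F : α → ℝ} {Fk : ℕ → α → ℝ} (hG : MemLp G 2 μ) (hF : MemLp F 2 μ)
    (hFk : ∀ k, MemLp (Fk k) 2 μ)
    (h : Tendsto (fun k => eLpNorm (Fk k - F) 2 μ) atTop (𝓝 0)) :
    Tendsto (fun k => ∫ x, G x * Fk k x ∂μ) atTop (𝓝 (∫ x, G x * F x ∂μ)) := by
  rw [tendsto_iff_edist_tendsto_0]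
  have hbound : ∀ k, edist (∫ x, G x * Fk k x ∂μ) (∫ x, G x * F x ∂μ) ≤
      eLpNorm G 2 μ * eLpNorm (Fk k - F) 2 μ := by
    intro k
    rw [edist_eq_enorm_sub, ← integral_sub (hG.integrable_mul_fun (hFk k)) (hG.integrable_mul_fun hF)]
    calc ‖∫ x, (G x * Fk k x - G x * F x) ∂μ‖ₑ
        ≤ ∫⁻ x, ‖G x * Fk k x - G x * F x‖ₑ ∂μ := enorm_integral_le_lintegral_enorm _
      _ = eLpNorm (G • (Fk k - F)) 1 μ := by
          rw [eLpNorm_one_eq_lintegral_enorm]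
          refine lintegral_congr fun x => ?_
          simp [mul_sub]
      _ ≤ _ := eLpNorm_smul_le_mul_eLpNorm ((hFk k).sub hF).1 hG.1
  refine tendsto_of_tendsto_of_tendsto_of_le_of_le tendsto_const_nhds ?_ (fun _ => zero_le)
    hbound
  simpa using ENNReal.Tendsto.const_mul h (Or.inr hG.eLpNorm_ne_top)

theorem memLp_two_of_top {Ω : Set (E n)} (hb : Bornology.IsBounded Ω) {u : E n → ℝ}
    (hu : MemLp u ⊤ (volume.restrict Ω)) : MemLp u 2 (volume.restrict Ω) := by
  have : IsFiniteMeasure (volume.restrict Ω) :=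
    ⟨by rw [Measure.restrict_apply_univ]; exact hb.measure_lt_top⟩
  exact hu.mono_exponent le_top

theorem IsTest.memLp_top {U : Set (E n)} {ψ : E n → ℝ} (h : IsTest U ψ) (Ω : Set (E n)) :
    MemLp ψ ⊤ (volume.restrict Ω) := h.memLp ⊤ _

/-! ### Weak derivatives of extensions by zero -/

/-- The extension of `u` by zero from `Ω` has the weak partial derivative `∂_i u = u'` in `U`:
the `i`-th component of the boundary flux of `u` vanishes on `∂Ω ∩ U`. -/
structure ExtPartial (Ω U : Set (E n)) (i : Fin (n + 1)) (u u' : E n → ℝ) : Prop where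
  bdd : MemLp u ⊤ (volume.restrict Ω)
  memLp : MemLp u' 2 (volume.restrict Ω)
  ibp : ∀ ψ, IsTest U ψ → ∫ x in Ω, u x * pderiv i ψ x = -∫ x in Ω, u' x * ψ x

/-- `u ∈ W^{1,2}(Ω)` with gradient `u'` is the limit of the smooth functions `φ k`. -/
structure IsApprox (Ω : Set (E n)) (u : E n → ℝ) (u' : Fin (n + 1) → E n → ℝ)
    (φ : ℕ → E n → ℝ) : Prop where
  memLp : MemLp u 2 (volume.restrict Ω)
  memLp' : ∀ i, MemLp (u' i) 2 (volume.restrict Ω)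
  smooth : ∀ k, ContDiff ℝ ∞ (φ k)
  tendsto : Tendsto (fun k => eLpNorm (φ k - u) 2 (volume.restrict Ω)) atTop (𝓝 0)
  tendsto' : ∀ i, Tendsto (fun k => eLpNorm (pderiv i (φ k) - u' i) 2 (volume.restrict Ω))
    atTop (𝓝 0)

theorem IsApprox.tendsto_integral {Ω : Set (E n)} (hb : Bornology.IsBounded Ω) {u : E n → ℝ}
    {u' : Fin (n + 1) → E n → ℝ} {φ : ℕ → E n → ℝ} (h : IsApprox Ω u u' φ) {G : E n → ℝ}
    (hG : MemLp G 2 (volume.restrict Ω)) :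
    Tendsto (fun k => ∫ x in Ω, G x * φ k x) atTop (𝓝 (∫ x in Ω, G x * u x)) :=
  tendsto_integral_mul_of_tendsto_eLpNorm hG h.memLp
    (fun k => memLp_of_continuous hb (h.smooth k).continuous 2) h.tendsto

theorem IsApprox.tendsto_integral' {Ω : Set (E n)} (hb : Bornology.IsBounded Ω) {u : E n → ℝ}
    {u' : Fin (n + 1) → E n → ℝ} {φ : ℕ → E n → ℝ} (h : IsApprox Ω u u' φ) {G : E n → ℝ}
    (hG : MemLp G 2 (volume.restrict Ω)) (i : Fin (n + 1)) :
    Tendsto (fun k => ∫ x in Ω, G x * pderiv i (φ k) x) atTop (𝓝 (∫ x in Ω, G x * u' i x)) :=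
  tendsto_integral_mul_of_tendsto_eLpNorm hG (h.memLp' i)
    (fun k => memLp_of_continuous hb (contDiff_pderiv (h.smooth k) i).continuous 2) (h.tendsto' i)

/-- Multiplication by `v`, with gradient `v'`, preserves the relation `ExtPartial`. -/
structure IsMultiplier (Ω : Set (E n)) (v : E n → ℝ) (v' : Fin (n + 1) → E n → ℝ) : Prop where
  bdd : MemLp v ⊤ (volume.restrict Ω)
  memLp : ∀ i, MemLp (v' i) 2 (volume.restrict Ω)
  mul : ∀ U i u u', ExtPartial Ω U i u u' →
    ExtPartial Ω U i (fun x => u x * v x) (fun x => u' x * v x + u x * v' i x)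

section

variable {Ω U : Set (E n)} {i : Fin (n + 1)}

theorem ExtPartial.congr_ae {u u' v v' : E n → ℝ} (h : ExtPartial Ω U i u u')
    (hu : u =ᵐ[volume.restrict Ω] v) (hu' : u' =ᵐ[volume.restrict Ω] v') :
    ExtPartial Ω U i v v' := by
  refine ⟨h.bdd.ae_eq hu, h.memLp.ae_eq hu', fun ψ hψ => ?_⟩
  rw [integral_congr_ae (g := fun x => u x * pderiv i ψ x),
    integral_congr_ae (f := fun x => v' x * ψ x) (g := fun x => u' x * ψ x), h.ibp ψ hψ]
  · filter_upwards [hu'] with x hx; rw [hx]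
  · filter_upwards [hu] with x hx; rw [hx]

theorem ExtPartial.congr {u u' v v' : E n → ℝ} (h : ExtPartial Ω U i u u')
    (hu : ∀ x, u x = v x) (hu' : ∀ x, u' x = v' x) : ExtPartial Ω U i v v' := by
  rwa [← funext hu, ← funext hu']

theorem ExtPartial.mono {u u' : E n → ℝ} {V : Set (E n)} (h : ExtPartial Ω U i u u')
    (hV : V ⊆ U) : ExtPartial Ω V i u u' :=
  ⟨h.bdd, h.memLp, fun ψ hψ => h.ibp ψ (hψ.mono hV)⟩

theorem ExtPartial.add {u u' v v' : E n → ℝ} (hb : Bornology.IsBounded Ω)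
    (h : ExtPartial Ω U i u u') (h' : ExtPartial Ω U i v v') :
    ExtPartial Ω U i (fun x => u x + v x) (fun x => u' x + v' x) := by
  refine ⟨h.bdd.add h'.bdd, h.memLp.add h'.memLp, fun ψ hψ => ?_⟩
  have hψ2 := hψ.memLp 2 (volume.restrict Ω)
  have hψi := (hψ.pderiv i).memLp 2 (volume.restrict Ω)
  simp only [add_mul]
  rw [integral_add ((memLp_two_of_top hb h.bdd).integrable_mul_fun hψi)
    ((memLp_two_of_top hb h'.bdd).integrable_mul_fun hψi),
    integral_add (h.memLp.integrable_mul_fun hψ2) (h'.memLp.integrable_mul_fun hψ2), h.ibp ψ hψ,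
    h'.ibp ψ hψ]
  ring

theorem ExtPartial.const_mul {u u' : E n → ℝ} (a : ℝ) (h : ExtPartial Ω U i u u') :
    ExtPartial Ω U i (fun x => a * u x) (fun x => a * u' x) := by
  refine ⟨h.bdd.const_mul a, h.memLp.const_mul a, fun ψ hψ => ?_⟩
  simp only [mul_assoc, integral_const_mul]
  rw [h.ibp ψ hψ]
  ring

theorem ExtPartial.zero : ExtPartial Ω U i (fun _ => 0) (fun _ => 0) :=
  ⟨MemLp.zero', MemLp.zero', fun ψ _ => by simp⟩

theorem ExtPartial.sum {ι : Type*} (hb : Bornology.IsBounded Ω) (s : Finset ι)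
    {u u' : ι → E n → ℝ} (h : ∀ l ∈ s, ExtPartial Ω U i (u l) (u' l)) :
    ExtPartial Ω U i (fun x => ∑ l ∈ s, u l x) (fun x => ∑ l ∈ s, u' l x) := by
  classical
  induction s using Finset.induction_on with
  | empty => simpa using ExtPartial.zero
  | insert a s ha ih =>
    simp only [Finset.sum_insert ha]
    exact (h a (by simp)).add hb (ih fun l hl => h l (by simp [hl]))

/-! ### The algebra of multipliers -/

/-- The approximants are smooth on the whole space, so ψ φ_k is again a test function in U, whether
or not U meets the boundary. Test the relation for u with it and let k → ∞. -/
theorem IsApprox.isMultiplier (hb : Bornology.IsBounded Ω) {v : E n → ℝ}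
    {v' : Fin (n + 1) → E n → ℝ} {φ : ℕ → E n → ℝ} (h : IsApprox Ω v v' φ)
    (hv : MemLp v ⊤ (volume.restrict Ω)) : IsMultiplier Ω v v' := by
  refine ⟨hv, h.memLp', fun U i u u' hu => ⟨hv.mul' hu.bdd, ?_, fun ψ hψ => ?_⟩⟩
  · exact (hv.mul' hu.memLp).add ((h.memLp' i).mul' hu.bdd)
  have hu2 := memLp_two_of_top hb hu.bdd
  have g1 : MemLp (fun x => u x * pderiv i ψ x) 2 (volume.restrict Ω) :=
    ((hψ.pderiv i).memLp_top Ω).mul' hu2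
  have g2 : MemLp (fun x => u x * ψ x) 2 (volume.restrict Ω) := (hψ.memLp_top Ω).mul' hu2
  have g3 : MemLp (fun x => u' x * ψ x) 2 (volume.restrict Ω) := (hψ.memLp_top Ω).mul' hu.memLp
  have hk : ∀ k, (∫ x in Ω, (u x * pderiv i ψ x) * φ k x) +
      ∫ x in Ω, (u x * ψ x) * pderiv i (φ k) x = -∫ x in Ω, (u' x * ψ x) * φ k x := by
    intro k
    have hφ2 := memLp_of_continuous hb (h.smooth k).continuous 2
    have hφi := memLp_of_continuous hb (contDiff_pderiv (h.smooth k) i).continuous 2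
    have := hu.ibp _ (hψ.mul (h.smooth k))
    rw [← integral_add (g1.integrable_mul_fun hφ2) (g2.integrable_mul_fun hφi)]
    simp only [pderiv_mul hψ.smooth (h.smooth k)] at this
    refine (integral_congr_ae (.of_forall fun x => ?_)).trans
      (this.trans (congrArg Neg.neg (integral_congr_ae (.of_forall fun x => ?_)))) <;>
    · ring
  have l1 := (h.tendsto_integral hb g1).add (h.tendsto_integral' hb g2 i)
  have l2 := (h.tendsto_integral hb g3).neg
  simp only [hk] at l1
  have heq := tendsto_nhds_unique l1 l2
  have i1 := g1.integrable_mul_fun h.memLp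
  have i2 := g2.integrable_mul_fun (h.memLp' i)
  have i3 := g3.integrable_mul_fun h.memLp
  have e1 : ∫ x in Ω, u x * v x * pderiv i ψ x = ∫ x in Ω, (u x * pderiv i ψ x) * v x :=
    integral_congr_ae (Eventually.of_forall fun x => by ring)
  have e2 : ∫ x in Ω, (u' x * v x + u x * v' i x) * ψ x =
      (∫ x in Ω, (u' x * ψ x) * v x) + ∫ x in Ω, (u x * ψ x) * v' i x := by
    rw [← integral_add i3 i2]
    exact integral_congr_ae (Eventually.of_forall fun x => by ring)
  rw [e1, e2]
  linarith

theorem isApprox_of_contDiff (hb : Bornology.IsBounded Ω) {v : E n → ℝ} (hv : ContDiff ℝ ∞ v) :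
    IsApprox Ω v (fun i => pderiv i v) (fun _ => v) :=
  ⟨memLp_of_continuous hb hv.continuous 2,
    fun i => memLp_of_continuous hb (contDiff_pderiv hv i).continuous 2, fun _ => hv, by simp,
    fun i => by simp⟩

theorem isMultiplier_of_contDiff (hb : Bornology.IsBounded Ω) {v : E n → ℝ}
    (hv : ContDiff ℝ ∞ v) : IsMultiplier Ω v (fun i => pderiv i v) :=
  (isApprox_of_contDiff hb hv).isMultiplier hb (memLp_of_continuous hb hv.continuous _)

theorem IsMultiplier.congr {v w : E n → ℝ} {v' w' : Fin (n + 1) → E n → ℝ}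
    (h : IsMultiplier Ω v v') (hv : ∀ x, v x = w x) (hv' : ∀ i x, v' i x = w' i x) :
    IsMultiplier Ω w w' := by
  rwa [← funext hv, ← (funext fun i => funext (hv' i) : v' = w')]

theorem isMultiplier_const (hb : Bornology.IsBounded Ω) (a : ℝ) :
    IsMultiplier Ω (fun _ => a) (fun _ _ => 0) :=
  (isMultiplier_of_contDiff hb contDiff_const).congr (fun _ => rfl) fun i x => pderiv_const a i x

theorem isMultiplier_coord (hb : Bornology.IsBounded Ω) (j : Fin (n + 1)) :
    IsMultiplier Ω (fun x => x j) (fun i _ => if i = j then 1 else 0) :=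
  (isMultiplier_of_contDiff hb (contDiff_coord j)).congr (fun _ => rfl)
    fun i x => pderiv_coord i j x

theorem IsMultiplier.add (hb : Bornology.IsBounded Ω) {v w : E n → ℝ}
    {v' w' : Fin (n + 1) → E n → ℝ} (h : IsMultiplier Ω v v') (h' : IsMultiplier Ω w w') :
    IsMultiplier Ω (fun x => v x + w x) (fun i x => v' i x + w' i x) :=
  ⟨h.bdd.add h'.bdd, fun i => (h.memLp i).add (h'.memLp i), fun U i u u' hu =>
    ((h.mul U i u u' hu).add hb (h'.mul U i u u' hu)).congr (fun x => by ring) fun x => by ring⟩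

/-- Multiply twice. Defining multipliers by their action makes products available without
constructing approximations of them by smooth functions. -/
theorem IsMultiplier.mul_mul {v w : E n → ℝ}
    {v' w' : Fin (n + 1) → E n → ℝ} (h : IsMultiplier Ω v v') (h' : IsMultiplier Ω w w') :
    IsMultiplier Ω (fun x => v x * w x) (fun i x => v' i x * w x + v x * w' i x) :=
  ⟨h'.bdd.mul' h.bdd, fun i => (h'.bdd.mul' (h.memLp i)).add ((h'.memLp i).mul' h.bdd),
    fun U i u u' hu => (h'.mul U i _ _ (h.mul U i u u' hu)).congr (fun x => by ring)
      fun x => by ring⟩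

theorem IsMultiplier.sum (hb : Bornology.IsBounded Ω) {ι : Type*} (s : Finset ι)
    {v : ι → E n → ℝ} {v' : ι → Fin (n + 1) → E n → ℝ}
    (h : ∀ l ∈ s, IsMultiplier Ω (v l) (v' l)) :
    IsMultiplier Ω (fun x => ∑ l ∈ s, v l x) (fun i x => ∑ l ∈ s, v' l i x) := by
  classical
  induction s using Finset.induction_on with
  | empty => simpa using isMultiplier_const hb 0
  | insert a s ha ih =>
    simp only [Finset.sum_insert ha]
    exact (h a (by simp)).add hb (ih fun l hl => h l (by simp [hl]))

/-- If the constant `1` has no flux in direction `i`, then no multiplier has. -/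
theorem IsMultiplier.extPartial {v : E n → ℝ} {v' : Fin (n + 1) → E n → ℝ}
    (h : IsMultiplier Ω v v') (h1 : ExtPartial Ω U i (fun _ => 1) (fun _ => 0)) :
    ExtPartial Ω U i v (v' i) :=
  (h.mul U i _ _ h1).congr (fun x => by ring) fun x => by ring

end

/-! ### Weak divergences -/

/-- `V ∈ L²(Ω)` and `d ∈ L¹(Ω)`. -/
structure IsDivPair (Ω : Set (E n)) (V : Fin (n + 1) → E n → ℝ) (d : E n → ℝ) : Prop where
  memLp : ∀ i, MemLp (V i) 2 (volume.restrict Ω)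
  integrable : Integrable d (volume.restrict Ω)

/-- The extension by zero of the vector field `V` from `Ω` has the weak divergence `d` in `U`. -/
def HasDivOn (Ω U : Set (E n)) (V : Fin (n + 1) → E n → ℝ) (d : E n → ℝ) : Prop :=
  ∀ ψ, IsTest U ψ → ∫ x in Ω, (∑ i, V i x * pderiv i ψ x + d x * ψ x) = 0

section

variable {Ω U : Set (E n)} {V W : Fin (n + 1) → E n → ℝ} {d e : E n → ℝ}

theorem IsDivPair.integrable_term (h : IsDivPair Ω V d) {ψ : E n → ℝ} (hψ : IsTest U ψ) :
    Integrable (fun x => ∑ i, V i x * pderiv i ψ x + d x * ψ x) (volume.restrict Ω) := by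
  refine (integrable_finsetSum _ fun i _ =>
    (h.memLp i).integrable_mul_fun ((hψ.pderiv i).memLp 2 _)).add ?_
  exact (memLp_one_iff_integrable.1 ((hψ.memLp_top Ω).mul' (memLp_one_iff_integrable.2
    h.integrable)))

theorem HasDivOn.add (hV : IsDivPair Ω V d) (hW : IsDivPair Ω W e) (h : HasDivOn Ω U V d)
    (h' : HasDivOn Ω U W e) :
    HasDivOn Ω U (fun i x => V i x + W i x) (fun x => d x + e x) := by
  intro ψ hψ
  have : ∀ x, ∑ i, (V i x + W i x) * pderiv i ψ x + (d x + e x) * ψ x =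
      (∑ i, V i x * pderiv i ψ x + d x * ψ x) + (∑ i, W i x * pderiv i ψ x + e x * ψ x) := by
    intro x
    simp only [add_mul, Finset.sum_add_distrib]
    ring
  simp only [this]
  rw [integral_add (hV.integrable_term hψ) (hW.integrable_term hψ), h ψ hψ, h' ψ hψ, add_zero]

theorem HasDivOn.congr_ae (h : HasDivOn Ω U V d)
    (hVW : ∀ᵐ x ∂(volume.restrict Ω), (∀ i, V i x = W i x) ∧ d x = e x) : HasDivOn Ω U W e := by
  intro ψ hψ
  rw [← h ψ hψ]
  refine integral_congr_ae ?_
  filter_upwards [hVW] with x hx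
  simp only [hx.1, hx.2]

theorem IsDivPair.of_extPartial (hb : Bornology.IsBounded Ω) {V' : Fin (n + 1) → E n → ℝ}
    (h : ∀ i, ExtPartial Ω U i (V i) (V' i)) : IsDivPair Ω V (fun x => ∑ i, V' i x) := by
  have : IsFiniteMeasure (volume.restrict Ω) :=
    ⟨by rw [Measure.restrict_apply_univ]; exact hb.measure_lt_top⟩
  exact ⟨fun i => memLp_two_of_top hb (h i).bdd,
    integrable_finsetSum _ fun i _ => (h i).memLp.integrable one_le_two⟩

theorem HasDivOn.of_extPartial (hb : Bornology.IsBounded Ω) {V' : Fin (n + 1) → E n → ℝ}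
    (h : ∀ i, ExtPartial Ω U i (V i) (V' i)) : HasDivOn Ω U V (fun x => ∑ i, V' i x) := by
  intro ψ hψ
  have i1 : ∀ i, Integrable (fun x => V i x * HalfSpace.pderiv i ψ x) (volume.restrict Ω) :=
    fun i => (memLp_two_of_top hb (h i).bdd).integrable_mul_fun ((hψ.pderiv i).memLp 2 _)
  have i2 : ∀ i, Integrable (fun x => V' i x * ψ x) (volume.restrict Ω) :=
    fun i => (h i).memLp.integrable_mul_fun (hψ.memLp 2 _)
  simp only [Finset.sum_mul]
  rw [integral_add (integrable_finsetSum _ fun i _ => i1 i)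
    (integrable_finsetSum _ fun i _ => i2 i), integral_finsetSum _ fun i _ => i1 i,
    integral_finsetSum _ fun i _ => i2 i, ← Finset.sum_add_distrib]
  exact Finset.sum_eq_zero fun i _ => by rw [(h i).ibp ψ hψ, neg_add_cancel]

/-- The support of ψ is compact, so a partition of unity splits ψ into finitely many test functions,
each supported in one of the good neighbourhoods. -/
theorem HasDivOn.of_local (hV : IsDivPair Ω V d) {O : Set (E n)}
    (h : ∀ x ∈ O, ∃ U, IsOpen U ∧ x ∈ U ∧ HasDivOn Ω U V d) : HasDivOn Ω O V d := by
  intro ψ hψ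
  have hloc : ∀ x : tsupport ψ, ∃ U, IsOpen U ∧ (x : E n) ∈ U ∧ HasDivOn Ω U V d :=
    fun x => h x (hψ.supp x.2)
  choose U hUo hxU hU using hloc
  obtain ⟨t, ht⟩ := hψ.compact.isCompact.elim_finite_subcover U hUo
    fun x hx => Set.mem_iUnion.2 ⟨⟨x, hx⟩, hxU ⟨x, hx⟩⟩
  obtain ⟨p, hp⟩ := SmoothPartitionOfUnity.exists_isSubordinate (ι := t)
    (modelWithCornersSelf ℝ (E n)) (isClosed_tsupport ψ) (fun l => U l.1) (fun l => hUo l.1)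
    (fun x hx => by
      obtain ⟨l, hl, hxl⟩ := Set.mem_iUnion₂.1 (ht hx)
      exact Set.mem_iUnion.2 ⟨⟨l, hl⟩, hxl⟩)
  have hps : ∀ l, ContDiff ℝ ∞ (p l) := fun l => (p l).contMDiff.contDiff
  have hsum : ψ = fun x => ∑ l, ψ x * p l x := by
    funext x
    by_cases hx : x ∈ tsupport ψ
    · have := p.sum_eq_one hx
      rw [finsum_eq_sum_of_fintype] at this
      rw [← Finset.mul_sum, this, mul_one]
    · simp [image_eq_zero_of_notMem_tsupport hx]
  have htest : ∀ l, IsTest (U l.1) (fun x => ψ x * p l x) := fun l => hψ.mul_supp (hps l) (hp l)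
  have hpt : ∀ x, ∑ i, V i x * pderiv i ψ x + d x * ψ x =
      ∑ l, (∑ i, V i x * pderiv i (fun y => ψ y * p l y) x + d x * (ψ x * p l x)) := by
    intro x
    rw [Finset.sum_add_distrib, Finset.sum_comm, ← Finset.mul_sum, ← congrFun hsum x]
    congr 1
    refine Finset.sum_congr rfl fun i _ => ?_
    rw [← Finset.mul_sum, ← pderiv_sum _ fun l _ => (htest l).smooth, ← hsum]
  simp only [hpt]
  rw [integral_finsetSum _ fun l _ => hV.integrable_term (htest l)]
  exact Finset.sum_eq_zero fun l _ => hU l.1 _ (htest l)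

/-- Test with a bump function that equals 1 on a ball containing Ω; its gradient vanishes there. -/
theorem HasDivOn.integral_eq_zero (hb : Bornology.IsBounded Ω) (hΩ : MeasurableSet Ω)
    (h : HasDivOn Ω Set.univ V d) : ∫ x in Ω, d x = 0 := by
  obtain ⟨R, hR, hsub⟩ := hb.subset_ball_lt 0 0
  let β : ContDiffBump (0 : E n) := ⟨R, R + 1, hR, by linarith⟩
  have hβ : IsTest Set.univ β := ⟨β.contDiff, β.hasCompactSupport, Set.subset_univ _⟩
  have hkey := h β hβ
  rw [← hkey]
  refine integral_congr_ae ?_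
  filter_upwards [ae_restrict_mem hΩ] with x hx
  have hball : x ∈ Metric.ball (0 : E n) R := hsub hx
  have h1 : (β : E n → ℝ) =ᶠ[𝓝 x] fun _ => 1 := by
    filter_upwards [Metric.isOpen_ball.mem_nhds hball] with y hy
    exact β.one_of_mem_closedBall (Metric.ball_subset_closedBall hy)
  have h2 : ∀ i, pderiv i β x = 0 := fun i => by
    rw [pderiv_eq_of_eventuallyEq h1, pderiv_const]
  simp [h2, h1.eq_of_nhds]

/-- The rotated gradient `u ∇v` in the `(i, j)`-plane. -/
def rotField (i j : Fin (n + 1)) (u : E n → ℝ) (v' : Fin (n + 1) → E n → ℝ)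
    (k : Fin (n + 1)) (x : E n) : ℝ :=
  u x * ((if k = i then v' j x else 0) - if k = j then v' i x else 0)

theorem sum_rotField (i j : Fin (n + 1)) (u : E n → ℝ) (v' : Fin (n + 1) → E n → ℝ) (x : E n)
    (a : Fin (n + 1) → ℝ) :
    ∑ k, rotField i j u v' k x * a k = u x * v' j x * a i - u x * v' i x * a j := by
  simp only [rotField, mul_sub, sub_mul, Finset.sum_sub_distrib, mul_ite, ite_mul, mul_zero,
    zero_mul, Finset.sum_ite_eq', Finset.mem_univ, if_true]

theorem isDivPair_rotField (i j : Fin (n + 1)) {u : E n → ℝ} {u' v' : Fin (n + 1) → E n → ℝ}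
    (hu : MemLp u ⊤ (volume.restrict Ω)) (hu' : ∀ k, MemLp (u' k) 2 (volume.restrict Ω))
    (hv' : ∀ k, MemLp (v' k) 2 (volume.restrict Ω)) :
    IsDivPair Ω (rotField i j u v') (fun x => u' i x * v' j x - u' j x * v' i x) := by
  refine ⟨fun k => ?_, ((hu' i).integrable_mul_fun (hv' j)).sub
    ((hu' j).integrable_mul_fun (hv' i))⟩
  refine MemLp.mul' (p := ⊤) (q := 2) (f := fun x => (if k = i then v' j x else 0) - if k = j then v' i x else 0)
    ?_ hu
  refine MemLp.sub (f := fun x => if k = i then v' j x else 0)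
    (g := fun x => if k = j then v' i x else 0) ?_ ?_ <;> split_ifs
  exacts [hv' j, MemLp.zero', hv' i, MemLp.zero']

/-- Here u carries the boundary condition. For smooth v, testing the relations for u with ψ ∂_j v
and ψ ∂_i v produces the mixed derivative ∂_i∂_j v twice with opposite signs; the result contains
only first derivatives of v and passes to the limit. -/
theorem hasDivOn_rotField_of_extPartial_left (hb : Bornology.IsBounded Ω) (i j : Fin (n + 1))
    {u v : E n → ℝ} {u' v' : Fin (n + 1) → E n → ℝ} {φ : ℕ → E n → ℝ}
    (hi : ExtPartial Ω U i u (u' i)) (hj : ExtPartial Ω U j u (u' j)) (hv : IsApprox Ω v v' φ) :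
    HasDivOn Ω U (rotField i j u v') (fun x => u' i x * v' j x - u' j x * v' i x) := by
  intro ψ hψ
  have hu2 := memLp_two_of_top hb hi.bdd
  have gi : MemLp (fun x => u x * pderiv i ψ x) 2 (volume.restrict Ω) :=
    ((hψ.pderiv i).memLp_top Ω).mul' hu2
  have gj : MemLp (fun x => u x * pderiv j ψ x) 2 (volume.restrict Ω) :=
    ((hψ.pderiv j).memLp_top Ω).mul' hu2
  have g'i : MemLp (fun x => u' i x * ψ x) 2 (volume.restrict Ω) :=
    (hψ.memLp_top Ω).mul' hi.memLp
  have g'j : MemLp (fun x => u' j x * ψ x) 2 (volume.restrict Ω) :=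
    (hψ.memLp_top Ω).mul' hj.memLp
  set A : E n → ℝ := fun x => u x * pderiv i ψ x + u' i x * ψ x with hA
  set B : E n → ℝ := fun x => u x * pderiv j ψ x + u' j x * ψ x with hB
  have hA2 : MemLp A 2 (volume.restrict Ω) := gi.add g'i
  have hB2 : MemLp B 2 (volume.restrict Ω) := gj.add g'j
  have hk : ∀ k, (∫ x in Ω, A x * pderiv j (φ k) x) - ∫ x in Ω, B x * pderiv i (φ k) x = 0 := by
    intro k
    have hj' := contDiff_pderiv (hv.smooth k) j
    have hi' := contDiff_pderiv (hv.smooth k) i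
    have hjj := memLp_of_continuous hb hj'.continuous 2
    have hii := memLp_of_continuous hb hi'.continuous 2
    have e1 := hi.ibp _ (hψ.mul hj')
    have e2 := hj.ibp _ (hψ.mul hi')
    simp only [pderiv_mul hψ.smooth hj', pderiv_mul hψ.smooth hi',
      pderiv_comm (hv.smooth k) j i] at e1 e2
    have g : MemLp (fun x => u x * ψ x) 2 (volume.restrict Ω) := (hψ.memLp_top Ω).mul' hu2
    have hij := memLp_of_continuous hb (contDiff_pderiv hj' i).continuous 2
    have s1 : ∫ x in Ω, A x * pderiv j (φ k) x =
        -∫ x in Ω, (u x * ψ x) * pderiv i (pderiv j (φ k)) x := by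
      have : ∫ x in Ω, A x * pderiv j (φ k) x =
          (∫ x in Ω, u x * (pderiv i ψ x * pderiv j (φ k) x + ψ x * pderiv i (pderiv j (φ k)) x)) +
          (∫ x in Ω, u' i x * (ψ x * pderiv j (φ k) x)) -
          ∫ x in Ω, (u x * ψ x) * pderiv i (pderiv j (φ k)) x := by
        rw [← integral_add, ← integral_sub]
        · exact integral_congr_ae (.of_forall fun x => by simp only [hA]; ring)
        · refine (((gi.integrable_mul_fun hjj).add (g.integrable_mul_fun hij)).add
            (g'i.integrable_mul_fun hjj)).congr (.of_forall fun x => ?_)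
          simp only [Pi.add_apply]; ring
        · exact g.integrable_mul_fun hij
        · refine ((gi.integrable_mul_fun hjj).add (g.integrable_mul_fun hij)).congr
            (.of_forall fun x => ?_)
          simp only [Pi.add_apply]; ring
        · refine (g'i.integrable_mul_fun hjj).congr (.of_forall fun x => ?_)
          ring
      rw [this, e1]
      ring
    have s2 : ∫ x in Ω, B x * pderiv i (φ k) x =
        -∫ x in Ω, (u x * ψ x) * pderiv i (pderiv j (φ k)) x := by
      have : ∫ x in Ω, B x * pderiv i (φ k) x =
          (∫ x in Ω, u x * (pderiv j ψ x * pderiv i (φ k) x + ψ x * pderiv i (pderiv j (φ k)) x)) +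
          (∫ x in Ω, u' j x * (ψ x * pderiv i (φ k) x)) -
          ∫ x in Ω, (u x * ψ x) * pderiv i (pderiv j (φ k)) x := by
        rw [← integral_add, ← integral_sub]
        · exact integral_congr_ae (.of_forall fun x => by simp only [hB]; ring)
        · refine (((gj.integrable_mul_fun hii).add (g.integrable_mul_fun hij)).add
            (g'j.integrable_mul_fun hii)).congr (.of_forall fun x => ?_)
          simp only [Pi.add_apply]; ring
        · exact g.integrable_mul_fun hij
        · refine ((gj.integrable_mul_fun hii).add (g.integrable_mul_fun hij)).congr
            (.of_forall fun x => ?_)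
          simp only [Pi.add_apply]; ring
        · refine (g'j.integrable_mul_fun hii).congr (.of_forall fun x => ?_)
          ring
      rw [this, e2]
      ring
    rw [s1, s2, sub_self]
  have hlim := (hv.tendsto_integral' hb hA2 j).sub (hv.tendsto_integral' hb hB2 i)
  simp only [hk] at hlim
  have h0 := tendsto_nhds_unique hlim tendsto_const_nhds
  rw [← h0, ← integral_sub (hA2.integrable_mul_fun (hv.memLp' j))
    (hB2.integrable_mul_fun (hv.memLp' i))]
  refine integral_congr_ae (.of_forall fun x => ?_)
  simp only [sum_rotField, hA, hB]
  ring

/-- Here v carries the boundary condition: the extension of ∇v by zero is the weak gradient of the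
extension of v, hence curl-free up to the boundary. The smooth approximants of u only serve to
multiply the test function. -/
theorem hasDivOn_rotField_of_extPartial_right (hb : Bornology.IsBounded Ω) (i j : Fin (n + 1))
    {u v : E n → ℝ} {u' v' : Fin (n + 1) → E n → ℝ} {φ : ℕ → E n → ℝ}
    (hi : ExtPartial Ω U i v (v' i)) (hj : ExtPartial Ω U j v (v' j)) (hu : IsApprox Ω u u' φ) :
    HasDivOn Ω U (rotField i j u v') (fun x => u' i x * v' j x - u' j x * v' i x) := by
  intro ψ hψ
  have g1 : MemLp (fun x => v' j x * pderiv i ψ x - v' i x * pderiv j ψ x) 2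
      (volume.restrict Ω) :=
    (((hψ.pderiv i).memLp_top Ω).mul' hj.memLp).sub (((hψ.pderiv j).memLp_top Ω).mul' hi.memLp)
  have g2 : MemLp (fun x => v' j x * ψ x) 2 (volume.restrict Ω) :=
    (hψ.memLp_top Ω).mul' hj.memLp
  have g3 : MemLp (fun x => v' i x * ψ x) 2 (volume.restrict Ω) :=
    (hψ.memLp_top Ω).mul' hi.memLp
  have hk : ∀ k, (∫ x in Ω, (v' j x * pderiv i ψ x - v' i x * pderiv j ψ x) * φ k x) +
      (∫ x in Ω, (v' j x * ψ x) * pderiv i (φ k) x) -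
      ∫ x in Ω, (v' i x * ψ x) * pderiv j (φ k) x = 0 := by
    intro k
    have ht := hψ.mul (hu.smooth k)
    have e1 := hi.ibp _ (ht.pderiv j)
    have e2 := hj.ibp _ (ht.pderiv i)
    have hφ2 := memLp_of_continuous hb (hu.smooth k).continuous 2
    have hφi := memLp_of_continuous hb (contDiff_pderiv (hu.smooth k) i).continuous 2
    have hφj := memLp_of_continuous hb (contDiff_pderiv (hu.smooth k) j).continuous 2
    rw [← integral_add (g1.integrable_mul_fun hφ2) (g2.integrable_mul_fun hφi),
      ← integral_sub ((g1.integrable_mul_fun hφ2).fun_add (g2.integrable_mul_fun hφi))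
        (g3.integrable_mul_fun hφj)]
    have e3 : (∫ x in Ω, v' j x * pderiv i (fun y => ψ y * φ k y) x) -
        ∫ x in Ω, v' i x * pderiv j (fun y => ψ y * φ k y) x = 0 := by
      rw [sub_eq_zero, ← neg_inj, ← e1, ← e2]
      simp only [pderiv_comm ht.smooth i j]
    rw [← integral_sub (hj.memLp.integrable_mul_fun ((ht.pderiv i).memLp 2 _))
      (hi.memLp.integrable_mul_fun ((ht.pderiv j).memLp 2 _))] at e3
    rw [← e3]
    refine integral_congr_ae (.of_forall fun x => ?_)
    simp only [pderiv_mul hψ.smooth (hu.smooth k)]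
    ring
  have hlim := ((hu.tendsto_integral hb g1).add (hu.tendsto_integral' hb g2 i)).sub
    (hu.tendsto_integral' hb g3 j)
  simp only [hk] at hlim
  have h0 := tendsto_nhds_unique hlim tendsto_const_nhds
  rw [← h0, ← integral_add (g1.integrable_mul_fun hu.memLp) (g2.integrable_mul_fun (hu.memLp' i)),
    ← integral_sub ((g1.integrable_mul_fun hu.memLp).fun_add (g2.integrable_mul_fun (hu.memLp' i)))
      (g3.integrable_mul_fun (hu.memLp' j))]
  refine integral_congr_ae (.of_forall fun x => ?_)
  simp only [sum_rotField]
  ring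

end

/-! ### Sets of codimension two are removable -/

/-- Slice in direction j. On a slice ζ increases with slope at least m while |ζ| ≤ ε, so the slice
has diameter at most 2ε/m; among the transverse coordinates, the last one is confined to [-ε, ε].
Two factors ε express codimension two. -/
theorem exists_volume_slab_le {x₀ : E n} {r m : ℝ} (hm : 0 < m) {ζ : E n → ℝ}
    (hζ : ContDiff ℝ ∞ ζ) {j : Fin (n + 1)} (hj : j ≠ Fin.last n)
    (hd : ∀ y ∈ cube x₀ r, m ≤ pderiv j ζ y) :
    ∃ C : ℝ≥0∞, C ≠ ⊤ ∧ ∀ ε : ℝ, 0 ≤ ε →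
      volume {y | y ∈ cube x₀ r ∧ |y (Fin.last n)| ≤ ε ∧ |ζ y| ≤ ε} ≤ C * ENNReal.ofReal ε ^ 2 := by
  obtain ⟨k₀, hk₀⟩ := Fin.exists_succAbove_eq hj.symm
  set P : ℝ≥0∞ := ∏ k ∈ Finset.univ.erase k₀, ENNReal.ofReal (2 * r) with hP
  refine ⟨ENNReal.ofReal (2 / m) * (2 * P), ENNReal.mul_ne_top ENNReal.ofReal_ne_top
    (ENNReal.mul_ne_top (by simp) (ENNReal.prod_ne_top fun _ _ => ENNReal.ofReal_ne_top)),
    fun ε hε => ?_⟩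
  set A : Set (E n) := {y | y ∈ cube x₀ r ∧ |y (Fin.last n)| ≤ ε ∧ |ζ y| ≤ ε} with hA
  have hAm : MeasurableSet A := (measurableSet_cube x₀ r).inter
    ((isClosed_le (contDiff_coord _).continuous.abs continuous_const).inter
      (isClosed_le hζ.continuous.abs continuous_const)).measurableSet
  let b : Fin n → Set ℝ := fun k => if k = k₀ then Set.Icc (-ε) ε else
    Set.Ioo (x₀ (j.succAbove k) - r) (x₀ (j.succAbove k) + r)
  set B : Set (Fin n → ℝ) := Set.pi Set.univ b with hB
  have hBm : MeasurableSet B := MeasurableSet.univ_pi fun k => by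
    simp only [b]; split_ifs
    exacts [measurableSet_Icc, measurableSet_Ioo]
  have hBvol : volume B ≤ 2 * ENNReal.ofReal ε * P := by
    rw [hB, volume_pi_pi, ← Finset.mul_prod_erase _ _ (Finset.mem_univ k₀)]
    refine mul_le_mul' ?_ (Finset.prod_le_prod' fun k hk => ?_)
    · simp only [b, if_true, Real.volume_Icc]
      rw [show ε - -ε = 2 * ε by ring, ENNReal.ofReal_mul (by norm_num)]
      simp
    · simp only [b, if_neg (Finset.ne_of_mem_erase hk), Real.volume_Ioo]
      exact ENNReal.ofReal_le_ofReal (by linarith)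
  have hsec : ∀ y : Fin n → ℝ, ∫⁻ t, A.indicator 1 (ins j t y) ≤
      B.indicator (fun _ => ENNReal.ofReal (2 * ε / m)) y := by
    intro y
    have hS : ∀ t, A.indicator (1 : E n → ℝ≥0∞) (ins j t y) =
        {t | ins j t y ∈ A}.indicator 1 t := fun t => rfl
    have hSm : MeasurableSet {t | ins j t y ∈ A} :=
      hAm.preimage (contDiff_ins j y).continuous.measurable
    simp only [hS]
    rw [lintegral_indicator_one hSm]
    by_cases hne : ∃ t, ins j t y ∈ A
    · obtain ⟨t₀, ht₀⟩ := hne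
      have hyc := (ins_mem_cube.1 ht₀.1).2
      have hyB : y ∈ B := by
        intro k _
        simp only [b]
        split_ifs with hk
        · have := ht₀.2.1
          rw [← hk₀, ins_succAbove, abs_le] at this
          rw [hk]
          exact this
        · exact hyc k
      rw [Set.indicator_of_mem hyB]
      refine (Real.volume_le_diam _).trans ?_
      refine Metric.ediam_le fun s hs t ht => ?_
      wlog hst : s ≤ t generalizing s t
      · rw [edist_comm]
        exact this t ht s hs (le_of_not_ge hst)
      rw [edist_dist, Real.dist_eq, abs_sub_comm, abs_of_nonneg (sub_nonneg.2 hst)]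
      refine ENNReal.ofReal_le_ofReal ?_
      have hI : ∀ u ∈ Set.Icc s t, ins j u y ∈ cube x₀ r := fun u hu =>
        ins_mem_cube.2 ⟨⟨(ins_mem_cube.1 hs.1).1.1.trans_le hu.1,
          hu.2.trans_lt (ins_mem_cube.1 ht.1).1.2⟩, hyc⟩
      have hmv := (convex_Icc s t).mul_sub_le_image_sub_of_le_deriv (C := m)
        (f := fun u => ζ (ins j u y)) (hζ.comp (contDiff_ins j y)).continuous.continuousOn
        ((hζ.comp (contDiff_ins j y)).differentiable (by simp)).differentiableOn
        (fun u hu => by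
          rw [(hasDerivAt_comp_ins hζ j u y).deriv]
          exact hd _ (hI u (interior_subset hu)))
        s (Set.left_mem_Icc.2 hst) t (Set.right_mem_Icc.2 hst) hst
      have h1 := abs_le.1 hs.2.2
      have h2 := abs_le.1 ht.2.2
      rw [le_div_iff₀ hm]
      linarith [h1.1, h2.2]
    · have : {t | ins j t y ∈ A} = ∅ := by
        ext t
        simp only [Set.mem_ofPred_eq, Set.mem_empty_iff_false, iff_false]
        exact fun h => hne ⟨t, h⟩
      simp [this]
  calc volume A = ∫⁻ x, A.indicator 1 x := (lintegral_indicator_one hAm).symm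
    _ = ∫⁻ y : Fin n → ℝ, ∫⁻ t : ℝ, A.indicator 1 (ins j t y) :=
        lintegral_eq_lintegral_ins j (measurable_one.indicator hAm)
    _ ≤ ∫⁻ y, B.indicator (fun _ => ENNReal.ofReal (2 * ε / m)) y := lintegral_mono hsec
    _ = ENNReal.ofReal (2 * ε / m) * volume B := by
        rw [lintegral_indicator hBm, lintegral_const, Measure.restrict_apply_univ]
    _ ≤ ENNReal.ofReal (2 * ε / m) * (2 * ENNReal.ofReal ε * P) := by gcongr
    _ = _ := by
        rw [show 2 * ε / m = 2 / m * ε by ring, ENNReal.ofReal_mul (by positivity)]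
        ring

theorem exists_deriv_smoothTransition_bound :
    ∃ M, 0 ≤ M ∧ (∀ t, |deriv Real.smoothTransition t| ≤ M) ∧
      ∀ t, 1 < t → deriv Real.smoothTransition t = 0 := by
  have h1 : ∀ t, 1 < t → deriv Real.smoothTransition t = 0 := fun t ht => by
    have : Real.smoothTransition =ᶠ[𝓝 t] fun _ => 1 := by
      filter_upwards [lt_mem_nhds ht] with s hs using Real.smoothTransition.one_of_one_le hs.le
    rw [this.deriv_eq, deriv_const]
  have h0 : ∀ t, t < 0 → deriv Real.smoothTransition t = 0 := fun t ht => by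
    have : Real.smoothTransition =ᶠ[𝓝 t] fun _ => 0 := by
      filter_upwards [gt_mem_nhds ht] with s hs using Real.smoothTransition.zero_of_nonpos hs.le
    rw [this.deriv_eq, deriv_const]
  have hsupp : HasCompactSupport (deriv Real.smoothTransition) := by
    refine HasCompactSupport.of_support_subset_isCompact (isCompact_Icc (a := 0) (b := 1))
      fun t ht => ⟨?_, ?_⟩
    · by_contra hcon; exact ht (h0 t (not_le.1 hcon))
    · by_contra hcon; exact ht (h1 t (not_le.1 hcon))
  obtain ⟨M, hM⟩ := hsupp.exists_bound_of_continuous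
    ((Real.smoothTransition.contDiff (n := 1)).continuous_deriv le_rfl)
  exact ⟨M, (norm_nonneg _).trans (hM 0), hM, h1⟩

theorem tendsto_eLpNorm_two_restrict {α : Type*} [MeasurableSpace α] {μ : Measure α} {f : α → ℝ}
    (hf : MemLp f 2 μ) {S : ℕ → Set α} (hS : Tendsto (fun k => μ (S k)) atTop (𝓝 0)) :
    Tendsto (fun k => eLpNorm f 2 (μ.restrict (S k))) atTop (𝓝 0) := by
  simp only [eLpNorm_eq_lintegral_rpow_enorm_toReal (p := 2) two_ne_zero ENNReal.ofNat_ne_top]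
  have hfin : ∫⁻ x, ‖f x‖ₑ ^ (2 : ℝ≥0∞).toReal ∂μ ≠ ⊤ :=
    (lintegral_rpow_enorm_lt_top_of_eLpNorm_lt_top two_ne_zero ENNReal.ofNat_ne_top hf.2).ne
  have h := tendsto_setLIntegral_zero hfin hS
  have hc := (ENNReal.continuous_rpow_const (y := 1 / (2 : ℝ≥0∞).toReal)).tendsto 0
  rw [ENNReal.zero_rpow_of_pos (by norm_num)] at hc
  exact hc.comp h

/-- A set of codimension two has zero 2-capacity: there are cutoffs equal to 0 near it whose
gradients have size O(k) on sets of volume O(k⁻²). The gradients stay bounded in L² while their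
supports shrink, so their pairing with V ∈ L² tends to zero. -/
theorem HasDivOn.exists_of_compl {Ω Γ : Set (E n)}
    {V : Fin (n + 1) → E n → ℝ} {d : E n → ℝ}
    (hV : IsDivPair Ω V d) (h : HasDivOn Ω Γᶜ V d) {x₀ : E n} {ζ : E n → ℝ}
    (hζ : ContDiff ℝ ∞ ζ) {j : Fin (n + 1)} (hj : j ≠ Fin.last n) (hζj : pderiv j ζ x₀ ≠ 0)
    (hΓ : ∀ᶠ y in 𝓝 x₀, y ∈ Γ → y (Fin.last n) = 0 ∧ ζ y = 0) :
    ∃ U, IsOpen U ∧ x₀ ∈ U ∧ HasDivOn Ω U V d := by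
  wlog hpos : 0 < pderiv j ζ x₀ generalizing ζ
  · have hneg : pderiv j (fun y => -ζ y) x₀ = -pderiv j ζ x₀ := by
      have := pderiv_sub (contDiff_const (c := (0 : ℝ))) hζ j x₀
      simpa [pderiv_const] using this
    refine this (ζ := fun y => -ζ y) hζ.neg ?_ ?_ ?_
    · rw [hneg]; exact neg_ne_zero.2 hζj
    · filter_upwards [hΓ] with y hy hyΓ
      exact ⟨(hy hyΓ).1, by rw [(hy hyΓ).2, neg_zero]⟩
    · rw [hneg]
      exact neg_pos.2 (lt_of_le_of_ne (not_lt.1 hpos) hζj)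
  set m := pderiv j ζ x₀ / 2 with hm
  have hm0 : 0 < m := by positivity
  obtain ⟨L, hL0, hL⟩ : ∃ L : ℝ, 0 ≤ L ∧ ∀ᶠ y in 𝓝 x₀, ∀ i, |pderiv i ζ y| ≤ L := by
    refine ⟨∑ i, (|pderiv i ζ x₀| + 1), by positivity, ?_⟩
    refine eventually_all.2 fun i => ?_
    have hc := ((contDiff_pderiv hζ i).continuous.abs.continuousAt (x := x₀)).eventually_lt_const
      (lt_add_one |pderiv i ζ x₀|)
    filter_upwards [hc] with y hy
    exact hy.le.trans (Finset.single_le_sum (f := fun i => |pderiv i ζ x₀| + 1)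
      (fun i _ => by positivity) (Finset.mem_univ i))
  have hev : ∀ᶠ y in 𝓝 x₀, m ≤ pderiv j ζ y ∧ (∀ i, |pderiv i ζ y| ≤ L) ∧
      (y ∈ Γ → y (Fin.last n) = 0 ∧ ζ y = 0) := by
    filter_upwards [((contDiff_pderiv hζ j).continuous.continuousAt (x := x₀)).eventually_const_lt
      (show m < pderiv j ζ x₀ by rw [hm]; linarith), hL, hΓ] with y h1 h2 h3 using ⟨h1.le, h2, h3⟩
  obtain ⟨r, hr, hcube⟩ := exists_cube_subset hev
  refine ⟨cube x₀ r, isOpen_cube x₀ hr, mem_cube_self x₀ hr, fun ψ hψ => ?_⟩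
  obtain ⟨C, hC, hslab⟩ := exists_volume_slab_le (r := r) hm0 hζ hj fun y hy => (hcube hy).1
  obtain ⟨M, hM0, hM, hM1⟩ := exists_deriv_smoothTransition_bound
  obtain ⟨Cψ, hCψ0, hCψ⟩ := hψ.bounded
  set s : E n → ℝ := fun y => y (Fin.last n) * y (Fin.last n) + ζ y * ζ y with hs
  have hsm : ContDiff ℝ ∞ s :=
    ((contDiff_coord _).mul (contDiff_coord _)).add (hζ.mul hζ)
  have hs0 : ∀ y, 0 ≤ s y := fun y => add_nonneg (mul_self_nonneg _) (mul_self_nonneg _)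
  let K : ℕ → ℝ := fun k => k + 1
  have hK : ∀ k, 0 < K k := fun k => by positivity
  have hθ : ∀ k, ContDiff ℝ ∞ (fun t => Real.smoothTransition (K k ^ 2 * t - 1)) := fun k =>
    Real.smoothTransition.contDiff.comp ((contDiff_const.mul contDiff_id).sub contDiff_const)
  -- With s the squared distance surrogate x_{n+1}² + ζ², χ_k vanishes for s ≤ K⁻² and equals 1 for
  -- s ≥ 2K⁻². Its gradient inside the cube therefore lives in `S k`.
  let χ : ℕ → E n → ℝ := fun k y => Real.smoothTransition (K k ^ 2 * s y - 1)
  have hχ : ∀ k, ContDiff ℝ ∞ (χ k) := fun k => (hθ k).comp hsm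
  let S : ℕ → Set (E n) := fun k =>
    {y | y ∈ cube x₀ r ∧ |y (Fin.last n)| ≤ 2 / K k ∧ |ζ y| ≤ 2 / K k}
  have hder : ∀ k i y, pderiv i (χ k) y = deriv Real.smoothTransition (K k ^ 2 * s y - 1) *
      (K k ^ 2 * (2 * (y (Fin.last n) * (if i = Fin.last n then 1 else 0) +
        ζ y * pderiv i ζ y))) := by
    intro k i y
    have e1 : pderiv i (χ k) y = deriv Real.smoothTransition (K k ^ 2 * s y - 1) *
        pderiv i (fun y => K k ^ 2 * s y - 1) y :=
      pderiv_comp ((contDiff_const.mul hsm).sub contDiff_const) Real.smoothTransition.contDiff i y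
    rw [e1, pderiv_sub (contDiff_const.mul hsm) contDiff_const, pderiv_mul contDiff_const hsm,
      pderiv_const, pderiv_const, hs,
      pderiv_add ((contDiff_coord _).mul (contDiff_coord _)) (hζ.mul hζ),
      pderiv_mul (contDiff_coord _) (contDiff_coord _), pderiv_mul hζ hζ, pderiv_coord]
    ring
  have hder0 : ∀ k i, ∀ y ∈ cube x₀ r, y ∉ S k → pderiv i (χ k) y = 0 := by
    intro k i y hy hyS
    rw [hder, hM1, zero_mul]
    have hKk := hK k
    have : 4 / K k ^ 2 < s y := by
      by_contra hcon
      refine hyS ⟨hy, ?_, ?_⟩ <;> refine abs_le_of_sq_le_sq ?_ (by positivity) <;>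
      · rw [div_pow, show (2 : ℝ) ^ 2 = 4 by norm_num]
        simp only [hs] at hcon
        nlinarith [mul_self_nonneg (ζ y), mul_self_nonneg (y (Fin.last n))]
    rw [div_lt_iff₀ (by positivity)] at this
    linarith
  -- The chain rule contributes K² · 2 · (2/K)(1 + L) = 4K(1 + L) on `S k`.
  set c : ℝ := Cψ * (M * (4 * (1 + L))) with hc
  have hbd : ∀ k i, ∀ y ∈ cube x₀ r, y ∈ S k → |ψ y * pderiv i (χ k) y| ≤ c * K k := by
    intro k i y hy hyS
    have hKk := hK k
    have h1 : |y (Fin.last n) * (if i = Fin.last n then 1 else 0) + ζ y * pderiv i ζ y| ≤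
        2 / K k * (1 + L) := by
      refine (abs_add_le _ _).trans ?_
      rw [abs_mul, abs_mul, mul_add]
      gcongr
      · exact hyS.2.1
      · split_ifs <;> simp
      · exact hyS.2.2
      · exact (hcube hy).2.1 i
    rw [hder, abs_mul, abs_mul, abs_mul, abs_mul, abs_of_pos (show 0 < K k ^ 2 by positivity),
      abs_two]
    calc |ψ y| * (|deriv Real.smoothTransition (K k ^ 2 * s y - 1)| * (K k ^ 2 * (2 *
          |y (Fin.last n) * (if i = Fin.last n then 1 else 0) + ζ y * pderiv i ζ y|)))
        ≤ Cψ * (M * (K k ^ 2 * (2 * (2 / K k * (1 + L))))) := by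
          gcongr
          · exact hCψ y
          · exact hM _
      _ = c * K k := by rw [hc]; field_simp; ring
  set F : E n → ℝ := fun x => ∑ i, V i x * pderiv i ψ x + d x * ψ x with hF
  have hFi : Integrable F (volume.restrict Ω) := hV.integrable_term hψ
  have hterm : ∀ k i, Integrable (fun x => V i x * (ψ x * pderiv i (χ k) x)) (volume.restrict Ω) :=
    fun k i => (hV.memLp i).integrable_mul_fun ((hψ.mul (contDiff_pderiv (hχ k) i)).memLp 2 _)
  have hχle : ∀ k y, |χ k y| ≤ 1 := fun k y => by
    rw [abs_of_nonneg (Real.smoothTransition.nonneg _)]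
    exact Real.smoothTransition.le_one _
  have hχF : ∀ k, Integrable (fun x => χ k x * F x) (volume.restrict Ω) := fun k =>
    hFi.bdd_mul (hχ k).continuous.aestronglyMeasurable (.of_forall (hχle k))
  have hsplit : ∀ k, ∫ x in Ω, χ k x * F x =
      -∑ i, ∫ x in Ω, V i x * (ψ x * pderiv i (χ k) x) := by
    intro k
    have htest : IsTest Γᶜ (fun x => ψ x * χ k x) := by
      refine ⟨hψ.smooth.mul (hχ k), hψ.compact.mul_right, fun y hy hyΓ => ?_⟩
      have hyU : y ∈ cube x₀ r := hψ.supp (tsupport_mul_subset_left hy)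
      obtain ⟨hy1, hy2⟩ := (hcube hyU).2.2 hyΓ
      have hsy : s y = 0 := by simp [hs, hy1, hy2]
      refine notMem_tsupport_iff_eventuallyEq.2 ?_ hy
      have hlt : K k ^ 2 * s y - 1 < 0 := by rw [hsy]; norm_num
      filter_upwards [((contDiff_const.mul hsm).sub contDiff_const).continuous.continuousAt
        (x := y) |>.eventually_lt_const hlt] with z hz
      simp only [χ, Real.smoothTransition.zero_of_nonpos hz.le, mul_zero, Pi.zero_apply]
    have h0 := h _ htest
    have : ∀ x, ∑ i, V i x * pderiv i (fun y => ψ y * χ k y) x + d x * (ψ x * χ k x) =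
        χ k x * F x + ∑ i, V i x * (ψ x * pderiv i (χ k) x) := by
      intro x
      simp only [pderiv_mul hψ.smooth (hχ k), mul_add, Finset.sum_add_distrib, hF,
        Finset.mul_sum]
      rw [add_right_comm]
      congr 2
      · exact Finset.sum_congr rfl fun i _ => by ring
      · ring
    simp only [this] at h0
    rw [integral_add (hχF k) (integrable_finsetSum _ fun i _ => hterm k i),
      integral_finsetSum _ fun i _ => hterm k i] at h0
    linarith
  have hlimF : Tendsto (fun k => ∫ x in Ω, χ k x * F x) atTop (𝓝 (∫ x in Ω, F x)) := by
    refine tendsto_integral_of_dominated_convergence (fun x => |F x|) (fun k => (hχF k).1)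
      hFi.abs (fun k => .of_forall fun x => ?_) ?_
    · rw [Real.norm_eq_abs, abs_mul]
      exact mul_le_of_le_one_left (abs_nonneg _) (hχle k x)
    · have hnull : volume {y | y ∈ cube x₀ r ∧ |y (Fin.last n)| ≤ 0 ∧ |ζ y| ≤ 0} = 0 := by
        have := hslab 0 le_rfl
        simpa using this
      refine ae_restrict_of_ae ?_
      filter_upwards [compl_mem_ae_iff.2 hnull] with x hx
      by_cases hxU : x ∈ cube x₀ r
      · have hsx : 0 < s x := by
          refine lt_of_le_of_ne (hs0 x) fun h0 => hx ⟨hxU, ?_, ?_⟩ <;>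
          · rw [abs_nonpos_iff, ← mul_self_eq_zero]
            simp only [hs] at h0
            linarith [mul_self_nonneg (ζ x), mul_self_nonneg (x (Fin.last n))]
        obtain ⟨k₀, hk₀⟩ := exists_nat_gt (2 / s x)
        refine tendsto_const_nhds.congr' ?_
        filter_upwards [eventually_ge_atTop k₀] with k hk
        have h1 : 2 / s x ≤ K k ^ 2 := by
          have h2 : (k₀ : ℝ) ≤ k := by exact_mod_cast hk
          have h3 : (1 : ℝ) ≤ K k := by simp [K]
          have h4 : (k : ℝ) ≤ K k := by simp [K]
          nlinarith
        rw [div_le_iff₀ hsx] at h1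
        simp only [χ]
        rw [Real.smoothTransition.one_of_one_le (by linarith), one_mul]
      · have hF0 : F x = 0 := by
          simp [hF, hψ.eq_zero_of_notMem hxU, fun i => (hψ.pderiv i).eq_zero_of_notMem hxU]
        simp [hF0]
  have hvS : ∀ k, (volume.restrict Ω) (S k) ≤ C * ENNReal.ofReal (2 / K k) ^ 2 := fun k =>
    (Measure.restrict_apply_le _ _).trans (hslab _ (by have := hK k; positivity))
  have hK0 : Tendsto (fun k => 2 / K k) atTop (𝓝 0) :=
    (tendsto_natCast_atTop_atTop.atTop_add tendsto_const_nhds).const_div_atTop 2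
  have hvS0 : Tendsto (fun k => (volume.restrict Ω) (S k)) atTop (𝓝 0) := by
    refine tendsto_of_tendsto_of_tendsto_of_le_of_le tendsto_const_nhds ?_ (fun _ => zero_le) hvS
    have h1 := ENNReal.Tendsto.pow (n := 2) (ENNReal.tendsto_ofReal hK0)
    simpa using ENNReal.Tendsto.const_mul h1 (Or.inr hC)
  have hSm : ∀ k, MeasurableSet (S k) := fun k => (measurableSet_cube x₀ r).inter
    ((isClosed_le (contDiff_coord _).continuous.abs continuous_const).inter
      (isClosed_le hζ.continuous.abs continuous_const)).measurableSet
  -- Cauchy–Schwarz on `S k`: the factor cK times the square root of the volume is at most 2c√C, and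
  -- the L² norm of V_i over `S k` tends to zero.
  have hlimV : ∀ i, Tendsto (fun k => ∫ x in Ω, V i x * (ψ x * pderiv i (χ k) x)) atTop
      (𝓝 0) := by
    intro i
    rw [tendsto_iff_edist_tendsto_0]
    have hle : ∀ k, edist (∫ x in Ω, V i x * (ψ x * pderiv i (χ k) x)) 0 ≤
        ENNReal.ofReal (2 * c) * C ^ ((1 : ℝ) / 2) *
          eLpNorm (V i) 2 ((volume.restrict Ω).restrict (S k)) := by
      intro k
      have hKk := hK k
      rw [edist_zero_right]
      calc ‖∫ x in Ω, V i x * (ψ x * pderiv i (χ k) x)‖ₑ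
          ≤ ∫⁻ x in Ω, ‖V i x * (ψ x * pderiv i (χ k) x)‖ₑ := enorm_integral_le_lintegral_enorm _
        _ ≤ ∫⁻ x in Ω, (S k).indicator (fun x => ENNReal.ofReal (c * K k) * ‖V i x‖ₑ) x := by
            refine lintegral_mono fun x => ?_
            by_cases hxS : x ∈ S k
            · rw [Set.indicator_of_mem hxS, enorm_mul, mul_comm]
              gcongr
              rw [Real.enorm_eq_ofReal_abs]
              exact ENNReal.ofReal_le_ofReal (hbd k i x hxS.1 hxS)
            · by_cases hxU : x ∈ cube x₀ r
              · simp [hder0 k i x hxU hxS]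
              · simp [hψ.eq_zero_of_notMem hxU]
        _ = ENNReal.ofReal (c * K k) * eLpNorm (V i) 1 ((volume.restrict Ω).restrict (S k)) := by
            rw [lintegral_indicator (hSm k), lintegral_const_mul' _ _ ENNReal.ofReal_ne_top,
              eLpNorm_one_eq_lintegral_enorm]
        _ ≤ ENNReal.ofReal (c * K k) *
            (eLpNorm (V i) 2 ((volume.restrict Ω).restrict (S k)) *
              (C * ENNReal.ofReal (2 / K k) ^ 2) ^ ((1 : ℝ) / 2)) := by
            have h1 := eLpNorm_le_eLpNorm_mul_rpow_measure_univ
              (μ := (volume.restrict Ω).restrict (S k)) (one_le_two : (1 : ℝ≥0∞) ≤ 2)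
              (hV.memLp i).1.restrict
            rw [Measure.restrict_apply_univ, ENNReal.toReal_one, ENNReal.toReal_ofNat,
              show (1 : ℝ) / 1 - 1 / 2 = 1 / 2 by norm_num] at h1
            gcongr
            exact h1.trans (by gcongr; exact hvS k)
        _ = _ := by
            have e1 : ∀ a : ℝ≥0∞, (a ^ 2) ^ ((1 : ℝ) / 2) = a := fun a => by
              rw [← ENNReal.rpow_natCast, ← ENNReal.rpow_mul]
              norm_num
            rw [ENNReal.mul_rpow_of_nonneg _ _ one_half_pos.le, e1,
              show 2 * c = (c * K k) * (2 / K k) by field_simp,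
              ENNReal.ofReal_mul (p := c * K k) (by rw [hc]; positivity)]
            ring
    refine tendsto_of_tendsto_of_tendsto_of_le_of_le tendsto_const_nhds ?_ (fun _ => zero_le) hle
    have h1 := tendsto_eLpNorm_two_restrict (hV.memLp i) hvS0
    simpa only [mul_zero] using ENNReal.Tendsto.const_mul h1
      (Or.inr (ENNReal.mul_ne_top (ENNReal.ofReal_ne_top (r := 2 * c))
        (ENNReal.rpow_ne_top_of_nonneg one_half_pos.le hC)))
  simp only [hsplit] at hlimF
  have := (tendsto_finsetSum Finset.univ fun i _ => hlimV i).neg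
  rw [Finset.sum_const_zero, neg_zero] at this
  exact tendsto_nhds_unique hlimF this

/-! ### Weak derivatives -/

theorem integrableOn_mul_test {Ω : Set (E n)} {w φ : E n → ℝ}
    (hw : LocallyIntegrableOn w Ω) (hφ : IsTest Ω φ) : IntegrableOn (fun x => w x * φ x) Ω := by
  obtain ⟨C, -, hC⟩ := hφ.bounded
  have h1 : IntegrableOn w (tsupport φ) := hw.integrableOn_compact_subset hφ.supp hφ.compact
  have h2 : IntegrableOn (fun x => φ x * w x) (tsupport φ) :=
    h1.bdd_mul hφ.continuous.aestronglyMeasurable (.of_forall hC)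
  have h3 : Integrable (fun x => φ x * w x) := by
    refine (integrableOn_iff_integrable_of_support_subset fun x hx => ?_).1 h2
    exact subset_tsupport _ (left_ne_zero_of_mul hx)
  simpa [mul_comm] using h3.integrableOn

theorem ae_eq_of_forall_test {Ω : Set (E n)} (hΩ : IsOpen Ω) {w w' : E n → ℝ}
    (hw : LocallyIntegrableOn w Ω) (hw' : LocallyIntegrableOn w' Ω)
    (h : ∀ φ, IsTest Ω φ → ∫ x in Ω, w x * φ x = ∫ x in Ω, w' x * φ x) :
    w =ᵐ[volume.restrict Ω] w' := by
  have hz : ∀ᵐ x, x ∈ Ω → (w - w') x = 0 := by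
    refine hΩ.ae_eq_zero_of_integral_contDiff_smul_eq_zero (hw.sub hw') fun g hg hgc hgs => ?_
    have ht : IsTest Ω g := ⟨hg, hgc, hgs⟩
    have h0 := h g ht
    rw [← sub_eq_zero, ← integral_sub (integrableOn_mul_test hw ht) (integrableOn_mul_test hw' ht),
      setIntegral_eq_integral_of_forall_compl_eq_zero] at h0
    · rw [← h0]
      exact integral_congr_ae (.of_forall fun x => by
        simp only [Pi.sub_apply, smul_eq_mul]; ring)
    · intro x hx
      simp [ht.eq_zero_of_notMem hx]
  rw [EventuallyEq, ae_restrict_iff' hΩ.measurableSet]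
  filter_upwards [hz] with x hx hxΩ
  exact sub_eq_zero.1 (hx hxΩ)

theorem HasWeakPartial.ibp {Ω : Set (E n)} {i : Fin (n + 1)} {u w : E n → ℝ}
    (h : HasWeakPartial Ω i u w) {φ : E n → ℝ} (hφ : IsTest Ω φ) :
    ∫ x in Ω, u x * pderiv i φ x = -∫ x in Ω, w x * φ x :=
  h.2.2 φ hφ.smooth hφ.compact hφ.supp

theorem HasWeakPartial.ae_unique {Ω : Set (E n)} (hΩ : IsOpen Ω) {i : Fin (n + 1)}
    {u u' w w' : E n → ℝ} (h : HasWeakPartial Ω i u w) (h' : HasWeakPartial Ω i u' w')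
    (hu : u =ᵐ[volume.restrict Ω] u') : w =ᵐ[volume.restrict Ω] w' := by
  refine ae_eq_of_forall_test hΩ h.2.1 h'.2.1 fun φ hφ => ?_
  rw [← neg_inj, ← h.ibp hφ, ← h'.ibp hφ]
  refine integral_congr_ae ?_
  filter_upwards [hu] with x hx
  rw [hx]

theorem HasWeakPartial.ae_symm {Ω : Set (E n)} (hΩ : IsOpen Ω) {i j : Fin (n + 1)}
    {u wi wj wij wji : E n → ℝ} (hi : HasWeakPartial Ω i u wi) (hj : HasWeakPartial Ω j u wj)
    (hij : HasWeakPartial Ω j wi wij) (hji : HasWeakPartial Ω i wj wji) :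
    wij =ᵐ[volume.restrict Ω] wji := by
  refine ae_eq_of_forall_test hΩ hij.2.1 hji.2.1 fun φ hφ => ?_
  rw [← neg_inj, ← hij.ibp hφ, ← hji.ibp hφ, ← neg_inj, ← hi.ibp (hφ.pderiv j),
    ← hj.ibp (hφ.pderiv i)]
  simp only [pderiv_comm hφ.smooth i j]

/-! ### Traces -/

/-- The functions `φ k` approximate `u` in `W^{1,2}(Ω)` and `g` in `L²(S)`. -/
structure IsTraceApprox (Ω S : Set (E n)) (u : E n → ℝ) (u' : Fin (n + 1) → E n → ℝ) (g : E n → ℝ)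
    (φ : ℕ → E n → ℝ) : Prop where
  approx : IsApprox Ω u u' φ
  meas : AEStronglyMeasurable g (μHE[n].restrict S)
  trace : Tendsto (fun k => eLpNorm (φ k - g) 2 (μHE[n].restrict S)) atTop (𝓝 0)

theorem HasTrace.exists_isTraceApprox {Ω S : Set (E n)} (hΩ : IsOpen Ω) {u v g : E n → ℝ}
    {u' : Fin (n + 1) → E n → ℝ} (h : HasTrace Ω S v g) (hu : ∀ i, HasWeakPartial Ω i u (u' i))
    (hvu : v =ᵐ[volume.restrict Ω] u) : ∃ φ, IsTraceApprox Ω S u u' g φ := by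
  obtain ⟨hv2, hg, φ, hφ, ⟨hφv, hφ'⟩, hφg⟩ := h
  choose w hw hw2 hwt using hφ'
  have hwu : ∀ i, w i =ᵐ[volume.restrict Ω] u' i := fun i => (hw i).ae_unique hΩ (hu i) hvu
  refine ⟨φ, ⟨⟨hv2.ae_eq hvu, fun i => (hw2 i).ae_eq (hwu i), hφ, ?_, fun i => ?_⟩, hg.1, hφg⟩⟩
  · refine hφv.congr fun k => eLpNorm_congr_ae ?_
    filter_upwards [hvu] with x hx
    simp [hx]
  · refine (hwt i).congr fun k => eLpNorm_congr_ae ?_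
    filter_upwards [hwu i] with x hx
    simp [hx]

/-- The weak gradient `w` and the weak Hessian `D` of a solution, with their approximations. -/
structure IsSolution (Ω : Set (E n)) (ν : E n → E n) (c c₀ : ℝ) (f : E n → ℝ)
    (w : Fin (n + 1) → E n → ℝ) (D : Fin (n + 1) → Fin (n + 1) → E n → ℝ) : Prop where
  bdd : MemLp f ⊤ (volume.restrict Ω)
  bdd' : ∀ i, MemLp (w i) ⊤ (volume.restrict Ω)
  memLp : ∀ i j, MemLp (D i j) 2 (volume.restrict Ω)
  symm : ∀ i j, D i j =ᵐ[volume.restrict Ω] D j i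
  laplacian : ∀ᵐ x ∂(volume.restrict Ω), ∑ i, D i i x = 1
  dirichlet : ∃ φ, IsTraceApprox Ω (capPart Ω) f w (fun _ => 0) φ
  cap : ∃ (γ : Fin (n + 1) → E n → ℝ) (φ : Fin (n + 1) → ℕ → E n → ℝ),
    (∀ i, IsTraceApprox Ω (capPart Ω) (w i) (D i) (γ i) (φ i)) ∧
    ∀ᵐ x ∂(μHE[n].restrict (capPart Ω)), ∑ i, γ i x * ν x i = c₀
  flat : ∃ (γ : Fin (n + 1) → E n → ℝ) (φ : Fin (n + 1) → ℕ → E n → ℝ),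
    (∀ i, IsTraceApprox Ω (flatPart Ω) (w i) (D i) (γ i) (φ i)) ∧
    ∀ᵐ x ∂(μHE[n].restrict (flatPart Ω)), γ (Fin.last n) x = -c

/-- Each hypothesis comes with its own choice of weak derivatives. They agree a.e., so one gradient
and one Hessian can be fixed for all of them. -/
theorem exists_isSolution {Ω : Set (E n)} (hΩ : IsOpen Ω) {ν : E n → E n} {c c₀ : ℝ} {f : E n → ℝ}
    (hf : IsMixedSolution Ω c f) (hover : NormalDerivEq Ω (capPart Ω) ν f c₀) :
    ∃ w D, IsSolution Ω ν c c₀ f w D := by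
  obtain ⟨hfb, hw⟩ := hf.memW1
  choose w hw hwb using hw
  obtain ⟨-, hw2⟩ := hf.memW2
  choose v hv hvW using hw2
  have hvw : ∀ i, v i =ᵐ[volume.restrict Ω] w i := fun i => (hv i).ae_unique hΩ (hw i) .rfl
  choose D hD hD2 using fun i => (hvW i).2
  have hDw : ∀ i j, HasWeakPartial Ω j (w i) (D i j) := fun i j => by
    refine ⟨(hw i).2.1, (hD i j).2.1, fun φ h1 h2 h3 => ?_⟩
    rw [← (hD i j).2.2 φ h1 h2 h3]
    refine integral_congr_ae ?_
    filter_upwards [hvw i] with x hx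
    rw [hx]
  have htr : ∀ {S : Set (E n)} {u γ : Fin (n + 1) → E n → ℝ}, (∀ i, HasWeakPartial Ω i f (u i)) →
      (∀ i, HasTrace Ω S (u i) (γ i)) →
      ∃ φ : Fin (n + 1) → ℕ → E n → ℝ, ∀ i, IsTraceApprox Ω S (w i) (D i) (γ i) (φ i) :=
    fun hu ht => ⟨_, fun i => ((ht i).exists_isTraceApprox hΩ (hDw i)
      ((hu i).ae_unique hΩ (hw i) .rfl)).choose_spec⟩
  refine ⟨w, D, ⟨hfb, hwb, hD2, fun i j => (hw i).ae_symm hΩ (hw j) (hDw i j) (hDw j i),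
    ?_, hf.dirichlet.exists_isTraceApprox hΩ hw .rfl, ?_, ?_⟩⟩
  · obtain ⟨u, d, hu, hd, hsum⟩ := hf.laplacian
    have hdD : ∀ i, d i =ᵐ[volume.restrict Ω] D i i := fun i =>
      (hd i).ae_unique hΩ (hDw i i) ((hu i).ae_unique hΩ (hw i) .rfl)
    filter_upwards [hsum, eventually_countable_forall.2 hdD] with x hx hxD
    rw [← hx]
    exact Finset.sum_congr rfl fun i _ => (hxD i).symm
  · obtain ⟨u, γ, hu, hγ, hsum⟩ := hover
    obtain ⟨φ, hφ⟩ := htr hu hγ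
    exact ⟨γ, φ, hφ, hsum⟩
  · obtain ⟨u, γ, hu, hγ, hsum⟩ := hf.neumann
    obtain ⟨φ, hφ⟩ := htr hu hγ
    refine ⟨γ, φ, hφ, ?_⟩
    filter_upwards [hsum] with x hx
    have : ∑ i, γ i x * Nbar n i = -γ (Fin.last n) x := by
      simp [Nbar, e]
    rw [this] at hx
    linarith

/-! ### Vanishing traces -/

theorem tendsto_eLpNorm_add_sub_add {α : Type*} [MeasurableSpace α] {μ : Measure α}
    {F G : ℕ → α → ℝ} {f g : α → ℝ} (hF : ∀ k, AEStronglyMeasurable (F k - f) μ)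
    (hG : ∀ k, AEStronglyMeasurable (G k - g) μ)
    (hf : Tendsto (fun k => eLpNorm (F k - f) 2 μ) atTop (𝓝 0))
    (hg : Tendsto (fun k => eLpNorm (G k - g) 2 μ) atTop (𝓝 0)) :
    Tendsto (fun k => eLpNorm ((fun x => F k x + G k x) - fun x => f x + g x) 2 μ) atTop
      (𝓝 0) := by
  refine tendsto_of_tendsto_of_tendsto_of_le_of_le tendsto_const_nhds
    (by simpa using hf.add hg) (fun _ => zero_le) fun k => ?_
  have : ((fun x => F k x + G k x) - fun x => f x + g x) = (F k - f) + (G k - g) := by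
    funext x; simp only [Pi.sub_apply, Pi.add_apply]; ring
  simp only [this]
  exact eLpNorm_add_le (hF k) (hG k) one_le_two

theorem tendsto_eLpNorm_mul_sub_mul {α : Type*} [MeasurableSpace α] {μ : Measure α}
    {F : ℕ → α → ℝ} {f m : α → ℝ} {C : ℝ} (hm : ∀ᵐ x ∂μ, |m x| ≤ C)
    (hf : Tendsto (fun k => eLpNorm (F k - f) 2 μ) atTop (𝓝 0)) :
    Tendsto (fun k => eLpNorm ((fun x => F k x * m x) - fun x => f x * m x) 2 μ) atTop
      (𝓝 0) := by
  have h0 := ENNReal.Tendsto.const_mul hf (Or.inr (ENNReal.ofReal_ne_top (r := C)))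
  rw [mul_zero] at h0
  refine tendsto_of_tendsto_of_tendsto_of_le_of_le tendsto_const_nhds h0 (fun _ => zero_le)
    fun k => eLpNorm_le_mul_eLpNorm_of_ae_le_mul ?_ 2
  filter_upwards [hm] with x hx
  simp only [Pi.sub_apply, ← sub_mul, Real.norm_eq_abs, abs_mul]
  rw [mul_comm]
  gcongr

section

variable {Ω S U : Set (E n)} {u v g h : E n → ℝ} {u' v' : Fin (n + 1) → E n → ℝ}
  {φ χ : ℕ → E n → ℝ}

theorem IsApprox.aestronglyMeasurable (hu : IsApprox Ω u u' φ) (k : ℕ) :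
    AEStronglyMeasurable (φ k - u) (volume.restrict Ω) :=
  (hu.smooth k).continuous.aestronglyMeasurable.sub hu.memLp.1

theorem IsApprox.aestronglyMeasurable' (hu : IsApprox Ω u u' φ) (k : ℕ) (i : Fin (n + 1)) :
    AEStronglyMeasurable (pderiv i (φ k) - u' i) (volume.restrict Ω) :=
  (contDiff_pderiv (hu.smooth k) i).continuous.aestronglyMeasurable.sub (hu.memLp' i).1

theorem IsApprox.add (hu : IsApprox Ω u u' φ) (hv : IsApprox Ω v v' χ) :
    IsApprox Ω (fun x => u x + v x) (fun i x => u' i x + v' i x) (fun k x => φ k x + χ k x) := by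
  refine ⟨hu.memLp.add hv.memLp, fun i => (hu.memLp' i).add (hv.memLp' i),
    fun k => (hu.smooth k).add (hv.smooth k), tendsto_eLpNorm_add_sub_add hu.aestronglyMeasurable
      hv.aestronglyMeasurable hu.tendsto hv.tendsto, fun i => ?_⟩
  have : ∀ k, pderiv i (fun x => φ k x + χ k x) = fun x => pderiv i (φ k) x + pderiv i (χ k) x :=
    fun k => funext fun x => pderiv_add (hu.smooth k) (hv.smooth k) i x
  simp only [this]
  exact tendsto_eLpNorm_add_sub_add (fun k => hu.aestronglyMeasurable' k i)
    (fun k => hv.aestronglyMeasurable' k i) (hu.tendsto' i) (hv.tendsto' i)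

theorem exists_abs_le_of_continuous (hb : Bornology.IsBounded Ω) {m : E n → ℝ}
    (hm : Continuous m) : ∃ C, ∀ x ∈ closure Ω, |m x| ≤ C :=
  hb.isCompact_closure.exists_bound_of_continuousOn hm.continuousOn

theorem IsApprox.mul_contDiff (hb : Bornology.IsBounded Ω) (hΩ : IsOpen Ω)
    (hu : IsApprox Ω u u' φ) {m : E n → ℝ} (hm : ContDiff ℝ ∞ m) :
    IsApprox Ω (fun x => u x * m x) (fun i x => u' i x * m x + u x * pderiv i m x)
      (fun k x => φ k x * m x) := by
  have hae : ∀ {m : E n → ℝ}, Continuous m → ∃ C, ∀ᵐ x ∂(volume.restrict Ω), |m x| ≤ C :=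
    fun hm => by
      obtain ⟨C, hC⟩ := exists_abs_le_of_continuous hb hm
      refine ⟨C, ?_⟩
      filter_upwards [ae_restrict_mem hΩ.measurableSet] with x hx using hC x (subset_closure hx)
  obtain ⟨C, hC⟩ := hae hm.continuous
  have hmt := memLp_of_continuous hb hm.continuous ⊤
  have hmi := fun i => memLp_of_continuous hb (contDiff_pderiv hm i).continuous ⊤
  refine ⟨hmt.mul' hu.memLp, fun i => (hmt.mul' (hu.memLp' i)).add ((hmi i).mul' hu.memLp),
    fun k => (hu.smooth k).mul hm, tendsto_eLpNorm_mul_sub_mul hC hu.tendsto, fun i => ?_⟩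
  obtain ⟨C', hC'⟩ := hae (contDiff_pderiv hm i).continuous
  have : ∀ k, pderiv i (fun x => φ k x * m x) =
      fun x => pderiv i (φ k) x * m x + φ k x * pderiv i m x :=
    fun k => funext fun x => pderiv_mul (hu.smooth k) hm i x
  simp only [this]
  refine tendsto_eLpNorm_add_sub_add (fun k => ?_) (fun k => ?_)
    (tendsto_eLpNorm_mul_sub_mul hC (hu.tendsto' i)) (tendsto_eLpNorm_mul_sub_mul hC' hu.tendsto)
  · exact (((contDiff_pderiv (hu.smooth k) i).mul hm).continuous.aestronglyMeasurable.sub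
      ((hu.memLp' i).1.mul hmt.1))
  · exact (((hu.smooth k).mul (contDiff_pderiv hm i)).continuous.aestronglyMeasurable.sub
      (hu.memLp.1.mul (hmi i).1))

theorem IsTraceApprox.aestronglyMeasurable (hu : IsTraceApprox Ω S u u' g φ) (k : ℕ) :
    AEStronglyMeasurable (φ k - g) (μHE[n].restrict S) :=
  (hu.approx.smooth k).continuous.aestronglyMeasurable.sub hu.meas

theorem IsTraceApprox.add (hu : IsTraceApprox Ω S u u' g φ) (hv : IsTraceApprox Ω S v v' h χ) :
    IsTraceApprox Ω S (fun x => u x + v x) (fun i x => u' i x + v' i x) (fun x => g x + h x)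
      (fun k x => φ k x + χ k x) :=
  ⟨hu.approx.add hv.approx, hu.meas.add hv.meas, tendsto_eLpNorm_add_sub_add
    hu.aestronglyMeasurable hv.aestronglyMeasurable hu.trace hv.trace⟩

theorem IsTraceApprox.of_contDiff (hb : Bornology.IsBounded Ω) {m : E n → ℝ}
    (hm : ContDiff ℝ ∞ m) :
    IsTraceApprox Ω S m (fun i => pderiv i m) m (fun _ => m) :=
  ⟨isApprox_of_contDiff hb hm, hm.continuous.aestronglyMeasurable, by simp⟩

theorem IsTraceApprox.mul_contDiff (hb : Bornology.IsBounded Ω) (hΩ : IsOpen Ω)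
    (hSm : MeasurableSet S) (hS : S ⊆ closure Ω)
    (hu : IsTraceApprox Ω S u u' g φ) {m : E n → ℝ} (hm : ContDiff ℝ ∞ m) :
    IsTraceApprox Ω S (fun x => u x * m x) (fun i x => u' i x * m x + u x * pderiv i m x)
      (fun x => g x * m x) (fun k x => φ k x * m x) := by
  obtain ⟨C, hC⟩ := exists_abs_le_of_continuous hb hm.continuous
  refine ⟨hu.approx.mul_contDiff hb hΩ hm, hu.meas.mul hm.continuous.aestronglyMeasurable,
    tendsto_eLpNorm_mul_sub_mul (C := C) ?_ hu.trace⟩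
  filter_upwards [ae_restrict_mem hSm] with x hx using hC x (hS hx)

theorem IsTraceApprox.sum (hb : Bornology.IsBounded Ω) {ι : Type*} (s : Finset ι)
    {u : ι → E n → ℝ} {u' : ι → Fin (n + 1) → E n → ℝ} {g : ι → E n → ℝ}
    {φ : ι → ℕ → E n → ℝ} (h : ∀ l ∈ s, IsTraceApprox Ω S (u l) (u' l) (g l) (φ l)) :
    IsTraceApprox Ω S (fun x => ∑ l ∈ s, u l x) (fun i x => ∑ l ∈ s, u' l i x)
      (fun x => ∑ l ∈ s, g l x) (fun k x => ∑ l ∈ s, φ l k x) := by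
  classical
  induction s using Finset.induction_on with
  | empty =>
    simp only [Finset.sum_empty]
    convert IsTraceApprox.of_contDiff (S := S) hb (contDiff_const (c := (0 : ℝ))) using 2
    funext x
    rw [pderiv_const]
  | insert a s ha ih =>
    simp only [Finset.sum_insert ha]
    exact (h a (by simp)).add (ih fun l hl => h l (by simp [hl]))

theorem IsTraceApprox.mono (hu : IsTraceApprox Ω S u u' g φ) {S' : Set (E n)} (hS : S' ⊆ S) :
    IsTraceApprox Ω S' u u' g φ :=
  ⟨hu.approx, hu.meas.mono_measure (Measure.restrict_mono_set _ hS),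
    tendsto_of_tendsto_of_tendsto_of_le_of_le tendsto_const_nhds hu.trace (fun _ => zero_le)
      fun _ => eLpNorm_mono_measure _ (Measure.restrict_mono_set _ hS)⟩

theorem IsTraceApprox.congr_trace (hu : IsTraceApprox Ω S u u' g φ)
    (hgh : g =ᵐ[μHE[n].restrict S] h) : IsTraceApprox Ω S u u' h φ := by
  refine ⟨hu.approx, hu.meas.congr hgh, hu.trace.congr fun k => eLpNorm_congr_ae ?_⟩
  filter_upwards [hgh] with x hx
  simp [hx]

/-- A function with zero trace on the boundary in `U` can be extended by zero. -/
theorem IsTraceApprox.extPartial (hb : Bornology.IsBounded Ω) {N : Fin (n + 1) → E n → ℝ}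
    (hU : IsBoundaryChart Ω U N) (hu : IsTraceApprox Ω (frontier Ω ∩ U) u u' (fun _ => 0) φ)
    (hub : MemLp u ⊤ (volume.restrict Ω)) (i : Fin (n + 1)) : ExtPartial Ω U i u (u' i) := by
  refine ⟨hub, hu.approx.memLp' i, fun ψ hψ => ?_⟩
  obtain ⟨C, hC, hflux⟩ := hU.flux
  obtain ⟨M, hM0, hM⟩ := hψ.bounded
  have g1 := (hψ.pderiv i).memLp 2 (volume.restrict Ω)
  have g2 := hψ.memLp 2 (volume.restrict Ω)
  have hlim := (hu.approx.tendsto_integral hb g1).add (hu.approx.tendsto_integral' hb g2 i)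
  have hk : ∀ k, (∫ x in Ω, pderiv i ψ x * φ k x) + ∫ x in Ω, ψ x * pderiv i (φ k) x =
      ∫ x in Ω, pderiv i (fun y => ψ y * φ k y) x := fun k => by
    rw [← integral_add (g1.integrable_mul_fun (memLp_of_continuous hb
      (hu.approx.smooth k).continuous 2)) (g2.integrable_mul_fun (memLp_of_continuous hb
      (contDiff_pderiv (hu.approx.smooth k) i).continuous 2))]
    exact integral_congr_ae (.of_forall fun x => (pderiv_mul hψ.smooth (hu.approx.smooth k) i x).symm)
  simp only [hk] at hlim
  -- The flux of ψ φ_k is controlled by the L² norm of φ_k on the boundary, which tends to the norm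
  -- of the trace, here zero.
  have hz : Tendsto (fun k => ∫ x in Ω, pderiv i (fun y => ψ y * φ k y) x) atTop (𝓝 0) := by
    rw [tendsto_zero_iff_enorm_tendsto_zero]
    have h0 := ENNReal.Tendsto.const_mul hu.trace
      (Or.inr (ENNReal.mul_ne_top hC (ENNReal.ofReal_ne_top (r := M))))
    rw [mul_zero] at h0
    refine tendsto_of_tendsto_of_tendsto_of_le_of_le tendsto_const_nhds h0 (fun _ => zero_le)
      fun k => (hflux _ (hψ.mul (hu.approx.smooth k)) i).trans ?_
    rw [mul_assoc]
    gcongr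
    refine eLpNorm_le_mul_eLpNorm_of_ae_le_mul (.of_forall fun x => ?_) 2
    simp only [Pi.sub_apply, sub_zero, Real.norm_eq_abs, abs_mul]
    gcongr
    exact hM x
  have heq := tendsto_nhds_unique hlim hz
  rw [eq_neg_iff_add_eq_zero, ← heq]
  congr 1 <;> exact integral_congr_ae (.of_forall fun x => mul_comm _ _)

/-! ### Equality of traces -/

/-- `u` and `v` are multipliers whose traces on the boundary in `U` agree. -/
structure IsFluxEq (Ω U : Set (E n)) (u : E n → ℝ) (u' : Fin (n + 1) → E n → ℝ) (v : E n → ℝ)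
    (v' : Fin (n + 1) → E n → ℝ) : Prop where
  left : IsMultiplier Ω u u'
  right : IsMultiplier Ω v v'
  sub : ∀ i, ExtPartial Ω U i (fun x => u x - v x) (fun x => u' i x - v' i x)

theorem IsFluxEq.rfl (h : IsMultiplier Ω u u') : IsFluxEq Ω U u u' u u' :=
  ⟨h, h, fun i => ExtPartial.zero.congr (fun x => by ring) (fun x => by ring)⟩

theorem IsFluxEq.add {a b : E n → ℝ} {a' b' : Fin (n + 1) → E n → ℝ} (hb : Bornology.IsBounded Ω)
    (h₁ : IsFluxEq Ω U u u' v v') (h₂ : IsFluxEq Ω U a a' b b') :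
    IsFluxEq Ω U (fun x => u x + a x) (fun i x => u' i x + a' i x) (fun x => v x + b x)
      (fun i x => v' i x + b' i x) :=
  ⟨h₁.left.add hb h₂.left, h₁.right.add hb h₂.right, fun i =>
    ((h₁.sub i).add hb (h₂.sub i)).congr (fun x => by ring) (fun x => by ring)⟩

/-- From ua - vb = (u - v)a + v(a - b). -/
theorem IsFluxEq.mul_mul {a b : E n → ℝ} {a' b' : Fin (n + 1) → E n → ℝ}
    (hb : Bornology.IsBounded Ω) (h₁ : IsFluxEq Ω U u u' v v') (h₂ : IsFluxEq Ω U a a' b b') :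
    IsFluxEq Ω U (fun x => u x * a x) (fun i x => u' i x * a x + u x * a' i x)
      (fun x => v x * b x) (fun i x => v' i x * b x + v x * b' i x) :=
  ⟨h₁.left.mul_mul h₂.left, h₁.right.mul_mul h₂.right, fun i =>
    ((h₂.left.mul _ _ _ _ (h₁.sub i)).add hb (h₁.right.mul _ _ _ _ (h₂.sub i))).congr
      (fun x => by ring) (fun x => by ring)⟩

theorem IsFluxEq.sum {ι : Type*} (hb : Bornology.IsBounded Ω) (s : Finset ι)
    {u v : ι → E n → ℝ} {u' v' : ι → Fin (n + 1) → E n → ℝ}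
    (h : ∀ l ∈ s, IsFluxEq Ω U (u l) (u' l) (v l) (v' l)) :
    IsFluxEq Ω U (fun x => ∑ l ∈ s, u l x) (fun i x => ∑ l ∈ s, u' l i x)
      (fun x => ∑ l ∈ s, v l x) (fun i x => ∑ l ∈ s, v' l i x) := by
  refine ⟨.sum hb s fun l hl => (h l hl).left, .sum hb s fun l hl => (h l hl).right, fun i => ?_⟩
  refine (ExtPartial.sum hb s fun l hl => (h l hl).sub i).congr (fun x => ?_) (fun x => ?_) <;>
  · rw [Finset.sum_sub_distrib]

theorem ExtPartial.congr_on {i : Fin (n + 1)} {a b : E n → ℝ} (h : ExtPartial Ω U i u a)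
    (hv : MemLp v ⊤ (volume.restrict Ω)) (hb : MemLp b 2 (volume.restrict Ω))
    (huv : ∀ x ∈ U, u x = v x) (hab : ∀ x ∈ U, a x = b x) : ExtPartial Ω U i v b := by
  refine ⟨hv, hb, fun ψ hψ => ?_⟩
  have e1 : ∀ x, v x * pderiv i ψ x = u x * pderiv i ψ x := fun x => by
    by_cases hx : x ∈ U
    · rw [huv x hx]
    · simp [(hψ.pderiv i).eq_zero_of_notMem hx]
  have e2 : ∀ x, b x * ψ x = a x * ψ x := fun x => by
    by_cases hx : x ∈ U
    · rw [hab x hx]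
    · simp [hψ.eq_zero_of_notMem hx]
  simp only [e1, e2, h.ibp ψ hψ]

/-- V and Y have the same boundary flux, because each V_i - Y_i extends by zero. Thus the flux of a
rough field can be read off from a smooth comparison field. -/
theorem HasDivOn.of_isFluxEq (hb : Bornology.IsBounded Ω) {V Y : Fin (n + 1) → E n → ℝ}
    {V' Y' : Fin (n + 1) → Fin (n + 1) → E n → ℝ}
    (h : ∀ i, IsFluxEq Ω U (V i) (V' i) (Y i) (Y' i))
    (hY : HasDivOn Ω U Y (fun x => ∑ i, Y' i i x)) :
    HasDivOn Ω U V (fun x => ∑ i, V' i i x) := by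
  have hfin : IsFiniteMeasure (volume.restrict Ω) :=
    ⟨by rw [Measure.restrict_apply_univ]; exact hb.measure_lt_top⟩
  have hE : ∀ i, ExtPartial Ω U i (fun x => V i x - Y i x) (fun x => V' i i x - Y' i i x) :=
    fun i => (h i).sub i
  have hYp : IsDivPair Ω Y (fun x => ∑ i, Y' i i x) :=
    ⟨fun i => memLp_two_of_top hb (h i).right.bdd,
      integrable_finsetSum _ fun i _ => ((h i).right.memLp i).integrable one_le_two⟩
  refine ((HasDivOn.of_extPartial hb hE).add (IsDivPair.of_extPartial hb hE) hYp hY).congr_ae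
    (.of_forall fun x => ⟨fun i => by ring, ?_⟩)
  rw [Finset.sum_sub_distrib]
  ring

/-- A smooth field which is tangential to the boundary has no flux. -/
theorem IsBoundaryChart.hasDivOn_of_tangential
    {N : Fin (n + 1) → E n → ℝ} (hU : IsBoundaryChart Ω U N) {Y : Fin (n + 1) → E n → ℝ}
    (hY : ∀ i, ContDiff ℝ ∞ (Y i)) (hYN : ∀ x ∈ U, ∑ i, Y i x * N i x = 0) :
    HasDivOn Ω U Y (fun x => ∑ i, pderiv i (Y i) x) := by
  intro ψ hψ
  have hd : ∀ x, ∑ i, Y i x * pderiv i ψ x + (∑ i, pderiv i (Y i) x) * ψ x =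
      ∑ i, pderiv i (fun y => ψ y * Y i y) x := fun x => by
    simp only [pderiv_mul hψ.smooth (hY _)]
    rw [Finset.sum_add_distrib, Finset.sum_mul]
    congr 1 <;> exact Finset.sum_congr _root_.rfl fun i _ => mul_comm _ _
  have ht : ∀ i j, IsTest U (fun y => ψ y * N j y * Y i y) := fun i j =>
    (hψ.mul (hU.smooth j)).mul (hY i)
  have hint : ∀ i j k, Integrable (pderiv k fun y => (ψ y * N j y * Y i y) * N k y)
    (volume.restrict Ω) := fun i j k => (((ht i j).mul (hU.smooth k)).pderiv k).integrable _
  have hint' : ∀ i j, Integrable (pderiv i fun y => (ψ y * N j y * Y i y) * N j y)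
    (volume.restrict Ω) := fun i j => (((ht i j).mul (hU.smooth j)).pderiv i).integrable _
  -- Insert 1 = ∑ N_j². The tangential identity then exchanges the derivative ∂_i with the factor
  -- N_j, leaving ∂_j of ∑ ψ N_j Y_i N_i over i, which vanishes since Y is tangential.
  have e1 : ∀ i, (fun y => ψ y * Y i y) = fun y => ∑ j, (ψ y * N j y * Y i y) * N j y := fun i => by
    funext y
    by_cases hy : y ∈ U
    · have := hU.unit y hy
      calc ψ y * Y i y = ψ y * Y i y * ∑ j, N j y * N j y := by rw [this, mul_one]
        _ = _ := by
          rw [Finset.mul_sum]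
          exact Finset.sum_congr _root_.rfl fun j _ => by ring
    · simp [hψ.eq_zero_of_notMem hy]
  have e2 : ∀ j, (fun y => ∑ i, (ψ y * N j y * Y i y) * N i y) = fun _ => 0 := fun j => by
    funext y
    by_cases hy : y ∈ U
    · have := hYN y hy
      calc ∑ i, (ψ y * N j y * Y i y) * N i y = ψ y * N j y * ∑ i, Y i y * N i y := by
            rw [Finset.mul_sum]
            exact Finset.sum_congr _root_.rfl fun j _ => by ring
        _ = 0 := by rw [this, mul_zero]
    · simp [hψ.eq_zero_of_notMem hy]
  simp only [hd, e1]
  have e3 : ∀ i x, pderiv i (fun y => ∑ j, (ψ y * N j y * Y i y) * N j y) x =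
      ∑ j, pderiv i (fun y => (ψ y * N j y * Y i y) * N j y) x := fun i x =>
    pderiv_sum _ (fun j _ => ((ht i j).mul (hU.smooth j)).smooth) i x
  have e4 : ∀ j, ∑ i, ∫ x in Ω, pderiv j (fun y => (ψ y * N j y * Y i y) * N i y) x = 0 := by
    intro j
    rw [← integral_finsetSum _ fun i _ =>
      (((ht i j).mul (hU.smooth i)).pderiv j).integrable _]
    simp only [← pderiv_sum _ (fun i _ => ((ht i j).mul (hU.smooth i)).smooth), e2 j,
      pderiv_const, integral_zero]
  simp only [e3]
  rw [integral_finsetSum _ fun i _ => integrable_finsetSum _ fun j _ => hint' i j]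
  simp only [integral_finsetSum _ fun j _ => hint' _ j, hU.tangential _ (ht _ _) _ _]
  rw [Finset.sum_comm]
  exact Finset.sum_eq_zero fun j _ => e4 j

/-- Density carries the fact that the flux is parallel to N over to Sobolev functions u: the two
sides are the integrals of ∂_k(ψ N_j u) and ∂_j(ψ N_k u). -/
theorem IsBoundaryChart.tangential_of_isApprox (hb : Bornology.IsBounded Ω)
    {N : Fin (n + 1) → E n → ℝ} (hU : IsBoundaryChart Ω U N) (hu : IsApprox Ω u u' φ)
    {ψ : E n → ℝ} (hψ : IsTest U ψ) (j k : Fin (n + 1)) :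
    (∫ x in Ω, pderiv k (fun y => ψ y * N j y) x * u x) + ∫ x in Ω, (ψ x * N j x) * u' k x =
      (∫ x in Ω, pderiv j (fun y => ψ y * N k y) x * u x) + ∫ x in Ω, (ψ x * N k x) * u' j x := by
  have hlim : ∀ j k, Tendsto (fun l => ∫ x in Ω, pderiv k (fun y => ψ y * φ l y * N j y) x) atTop
      (𝓝 ((∫ x in Ω, pderiv k (fun y => ψ y * N j y) x * u x) +
        ∫ x in Ω, (ψ x * N j x) * u' k x)) := fun j k => by
    have ht := hψ.mul (hU.smooth j)
    have g1 := (ht.pderiv k).memLp 2 (volume.restrict Ω)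
    have g2 := ht.memLp 2 (volume.restrict Ω)
    refine ((hu.tendsto_integral hb g1).add (hu.tendsto_integral' hb g2 k)).congr fun l => ?_
    rw [← integral_add (g1.integrable_mul_fun (memLp_of_continuous hb
      (hu.smooth l).continuous 2)) (g2.integrable_mul_fun (memLp_of_continuous hb
      (contDiff_pderiv (hu.smooth l) k).continuous 2))]
    refine integral_congr_ae (.of_forall fun x => ?_)
    have : (fun y => ψ y * φ l y * N j y) = fun y => (ψ y * N j y) * φ l y := by
      funext y; ring
    simp only [this, pderiv_mul ht.smooth (hu.smooth l)]
  refine tendsto_nhds_unique (hlim j k) ((hlim k j).congr fun l => ?_)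
  exact (hU.tangential _ (hψ.mul (hu.smooth l)) j k).symm

end

/-! ### Solutions in charts -/

/-- A boundary chart at the curved part `Σ` of the boundary, away from the hyperplane. -/
structure IsCapChart (Ω : Set (E n)) (ν : E n → E n) (U : Set (E n))
    (N : Fin (n + 1) → E n → ℝ) : Prop extends IsBoundaryChart Ω U N where
  cap : frontier Ω ∩ U ⊆ capPart Ω
  nu : ∀ y ∈ frontier Ω ∩ U, ∀ i, ν y i = N i y

/-- A boundary chart at the flat part `T` of the boundary, away from `Γ`. -/
structure IsFlatChart (Ω U : Set (E n)) (N : Fin (n + 1) → E n → ℝ) : Prop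
    extends IsBoundaryChart Ω U N where
  flat : frontier Ω ∩ U ⊆ flatPart Ω
  eq_single : ∀ y ∈ U, ∀ i, N i y = if i = Fin.last n then -1 else 0

section

variable {Ω U : Set (E n)} {N : Fin (n + 1) → E n → ℝ} {ν : E n → E n} {c c₀ : ℝ} {f : E n → ℝ}
  {w : Fin (n + 1) → E n → ℝ} {D : Fin (n + 1) → Fin (n + 1) → E n → ℝ}

theorem extPartial_one_interior (hb : Bornology.IsBounded Ω) (i : Fin (n + 1)) :
    ExtPartial Ω Ω i (fun _ => 1) (fun _ => 0) := by
  refine ⟨memLp_of_continuous hb continuous_const _, MemLp.zero', fun ψ hψ => ?_⟩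
  rw [setIntegral_eq_integral_of_forall_compl_eq_zero
    fun x hx => by rw [(hψ.pderiv i).eq_zero_of_notMem hx, mul_zero]]
  simpa using hψ.integral_pderiv i

/-- On the flat part N_i = 0 and N_{n+1} = -1, so exchanging the directions i and n + 1 in the
tangential identity leaves nothing. -/
theorem IsFlatChart.extPartial_one (hb : Bornology.IsBounded Ω) (hU : IsFlatChart Ω U N)
    {i : Fin (n + 1)} (hi : i ≠ Fin.last n) : ExtPartial Ω U i (fun _ => 1) (fun _ => 0) := by
  refine ⟨memLp_of_continuous hb continuous_const _, MemLp.zero', fun ψ hψ => ?_⟩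
  have h := hU.tangential ψ hψ (Fin.last n) i
  have e1 : (fun y => ψ y * N (Fin.last n) y) = fun y => (fun _ => -1) y * ψ y := by
    funext y
    by_cases hy : y ∈ U
    · simp [hU.eq_single y hy]
    · simp [hψ.eq_zero_of_notMem hy]
  have e2 : (fun y => ψ y * N i y) = fun _ => 0 := by
    funext y
    by_cases hy : y ∈ U
    · simp [hU.eq_single y hy, hi]
    · simp [hψ.eq_zero_of_notMem hy]
  simp only [e1, e2, pderiv_const, pderiv_mul contDiff_const hψ.smooth, integral_zero, zero_mul,
    zero_add, integral_const_mul] at h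
  simp only [one_mul, zero_mul, integral_zero, neg_zero]
  linarith

theorem IsFlatChart.extPartial_coord (hb : Bornology.IsBounded Ω) (hU : IsFlatChart Ω U N)
    (i : Fin (n + 1)) :
    ExtPartial Ω U i (fun x => x (Fin.last n)) (fun _ => if i = Fin.last n then 1 else 0) := by
  have h := IsTraceApprox.of_contDiff (S := frontier Ω ∩ U) hb (contDiff_coord (Fin.last n))
  have h0 : (fun x : E n => x (Fin.last n)) =ᵐ[μHE[n].restrict (frontier Ω ∩ U)] fun _ => 0 := by
    filter_upwards [ae_restrict_mem (isClosed_frontier.measurableSet.inter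
      hU.isOpen.measurableSet)] with x hx using (hU.flat hx).2
  exact ((h.congr_trace h0).extPartial hb hU.toIsBoundaryChart
    (memLp_of_continuous hb (contDiff_coord _).continuous _) i).congr (fun _ => rfl)
    fun x => pderiv_coord _ _ _

namespace IsSolution

theorem isMultiplier_f (h : IsSolution Ω ν c c₀ f w D)
    (hb : Bornology.IsBounded Ω) : IsMultiplier Ω f w := by
  obtain ⟨φ, hφ⟩ := h.dirichlet
  exact hφ.approx.isMultiplier hb h.bdd

theorem exists_isApprox (h : IsSolution Ω ν c c₀ f w D) (i : Fin (n + 1)) : ∃ φ, IsApprox Ω (w i) (D i) φ := by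
  obtain ⟨γ, φ, hφ, -⟩ := h.cap
  exact ⟨φ i, (hφ i).approx⟩

theorem isMultiplier_w (h : IsSolution Ω ν c c₀ f w D)
    (hb : Bornology.IsBounded Ω) (i : Fin (n + 1)) : IsMultiplier Ω (w i) (D i) := by
  obtain ⟨φ, hφ⟩ := h.exists_isApprox i
  exact hφ.isMultiplier hb (h.bdd' i)

theorem extPartial_f (h : IsSolution Ω ν c c₀ f w D)
    (hb : Bornology.IsBounded Ω) (hU : IsCapChart Ω ν U N) (i : Fin (n + 1)) : ExtPartial Ω U i f (w i) := by
  obtain ⟨φ, hφ⟩ := h.dirichlet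
  exact (hφ.mono hU.cap).extPartial hb hU.toIsBoundaryChart h.bdd i

theorem extPartial_w_last (h : IsSolution Ω ν c c₀ f w D)
    (hb : Bornology.IsBounded Ω) (hU : IsFlatChart Ω U N) (i : Fin (n + 1)) :
    ExtPartial Ω U i (fun x => w (Fin.last n) x + c) (D (Fin.last n) i) := by
  obtain ⟨γ, φ, hφ, hγ⟩ := h.flat
  have h1 := (hφ (Fin.last n)).add (IsTraceApprox.of_contDiff hb (contDiff_const (c := c)))
  have h2 := (h1.congr_trace (h := fun _ => 0) (by
    filter_upwards [hγ] with x hx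
    rw [hx]; ring)).mono hU.flat
  refine (h2.extPartial hb hU.toIsBoundaryChart
    ((h.bdd' _).add (memLp_of_continuous hb continuous_const _)) i).congr (fun _ => rfl)
    fun x => ?_
  rw [pderiv_const, add_zero]

/-- The tangential part of ∇f vanishes on Σ because f does. In weak form: the flux in direction k of
w_i N_j - w_j N_i is moved by the tangential identity to the integral of ∂_j(ψ N_k w_i) - ∂_i(ψ N_k
w_j). The second derivatives cancel by symmetry, and the rest cancels because f extends by zero. -/
theorem extPartial_rot (h : IsSolution Ω ν c c₀ f w D)
    (hb : Bornology.IsBounded Ω) (hU : IsCapChart Ω ν U N) (i j k : Fin (n + 1)) :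
    ExtPartial Ω U k (fun x => w i x * N j x - w j x * N i x)
      (fun x => (D i k x * N j x + w i x * pderiv k (N j) x) -
        (D j k x * N i x + w j x * pderiv k (N i) x)) := by
  have hN := fun i => memLp_of_continuous hb (hU.smooth i).continuous ⊤
  have hN' := fun i => memLp_of_continuous hb (contDiff_pderiv (hU.smooth i) k).continuous ⊤
  have hw2 := fun i => memLp_two_of_top hb (h.bdd' i)
  refine ⟨((hN j).mul' (h.bdd' i)).sub ((hN i).mul' (h.bdd' j)), ?_, fun ψ hψ => ?_⟩
  · exact (((hN j).mul' (h.memLp i k)).add ((hN' j).mul' (hw2 i))).sub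
      (((hN i).mul' (h.memLp j k)).add ((hN' i).mul' (hw2 j)))
  obtain ⟨φ, hφ⟩ := h.exists_isApprox i
  obtain ⟨χ, hχ⟩ := h.exists_isApprox j
  have t1 := hU.tangential_of_isApprox hb hφ hψ j k
  have t2 := hU.tangential_of_isApprox hb hχ hψ i k
  have hk := hψ.mul (hU.smooth k)
  have f1 := (h.extPartial_f hb hU i).ibp _ (hk.pderiv j)
  have f2 := (h.extPartial_f hb hU j).ibp _ (hk.pderiv i)
  simp only [pderiv_comm hk.smooth i j] at f1
  have sym : ∫ x in Ω, (ψ x * N k x) * D i j x = ∫ x in Ω, (ψ x * N k x) * D j i x := by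
    refine integral_congr_ae ?_
    filter_upwards [h.symm i j] with x hx
    rw [hx]
  have m1 : ∫ x in Ω, pderiv j (fun y => ψ y * N k y) x * w i x =
      ∫ x in Ω, w i x * pderiv j (fun y => ψ y * N k y) x := by simp only [mul_comm]
  have m2 : ∫ x in Ω, pderiv i (fun y => ψ y * N k y) x * w j x =
      ∫ x in Ω, w j x * pderiv i (fun y => ψ y * N k y) x := by simp only [mul_comm]
  have hj := hψ.mul (hU.smooth j)
  have hi := hψ.mul (hU.smooth i)
  have i1 := ((hj.pderiv k).memLp 2 (volume.restrict Ω)).integrable_mul_fun (hw2 i)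
  have i2 := (hj.memLp 2 (volume.restrict Ω)).integrable_mul_fun (h.memLp i k)
  have i3 := ((hi.pderiv k).memLp 2 (volume.restrict Ω)).integrable_mul_fun (hw2 j)
  have i4 := (hi.memLp 2 (volume.restrict Ω)).integrable_mul_fun (h.memLp j k)
  have key : (∫ x in Ω, (w i x * N j x - w j x * N i x) * pderiv k ψ x) +
      ∫ x in Ω, ((D i k x * N j x + w i x * pderiv k (N j) x) -
        (D j k x * N i x + w j x * pderiv k (N i) x)) * ψ x =
      ((∫ x in Ω, pderiv k (fun y => ψ y * N j y) x * w i x) +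
        ∫ x in Ω, (ψ x * N j x) * D i k x) -
      ((∫ x in Ω, pderiv k (fun y => ψ y * N i y) x * w j x) +
        ∫ x in Ω, (ψ x * N i x) * D j k x) := by
    rw [← integral_add i1 i2, ← integral_add i3 i4, ← integral_sub (i1.fun_add i2) (i3.fun_add i4),
      ← integral_add]
    · refine integral_congr_ae (.of_forall fun x => ?_)
      simp only [pderiv_mul hψ.smooth (hU.smooth _)]
      ring
    · exact (((hN j).mul' (hw2 i)).sub ((hN i).mul' (hw2 j))).integrable_mul_fun
        ((hψ.pderiv k).memLp 2 _)
    · exact ((((hN j).mul' (h.memLp i k)).add ((hN' j).mul' (hw2 i))).sub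
        (((hN i).mul' (h.memLp j k)).add ((hN' i).mul' (hw2 j)))).integrable_mul_fun
        (hψ.memLp 2 _)
  rw [eq_neg_iff_add_eq_zero, key]
  linarith

/-- The overdetermined condition: the normal derivative of f minus c₀ has zero trace, since ν = N on
the boundary in U. -/
theorem extPartial_normal (h : IsSolution Ω ν c c₀ f w D)
    (hb : Bornology.IsBounded Ω) (hΩ : IsOpen Ω) (hU : IsCapChart Ω ν U N) (k : Fin (n + 1)) :
    ExtPartial Ω U k (fun x => ∑ j, w j x * N j x - c₀)
      (fun x => ∑ j, (D j k x * N j x + w j x * pderiv k (N j) x)) := by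
  obtain ⟨γ, φ, hφ, hγ⟩ := h.cap
  have hS : MeasurableSet (frontier Ω ∩ U) :=
    isClosed_frontier.measurableSet.inter hU.isOpen.measurableSet
  have hsub : frontier Ω ∩ U ⊆ closure Ω := Set.inter_subset_left.trans frontier_subset_closure
  have h1 := (IsTraceApprox.sum hb Finset.univ fun j _ =>
    ((hφ j).mono hU.cap).mul_contDiff hb hΩ hS hsub (hU.smooth j)).add
    (IsTraceApprox.of_contDiff hb (contDiff_const (c := -c₀)))
  have h2 := h1.congr_trace (h := fun _ => 0) (by
    filter_upwards [ae_restrict_mem hS,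
      ae_mono (Measure.restrict_mono_set μHE[n] hU.cap) hγ] with x hx hxγ
    simp only [← hU.nu x hx, hxγ]
    ring)
  have hbd : MemLp (fun x => ∑ j, w j x * N j x + -c₀) ⊤ (volume.restrict Ω) := by
    refine MemLp.add (f := fun x => ∑ j, w j x * N j x) (memLp_finsetSum _ fun j _ => ?_)
      (memLp_of_continuous hb continuous_const _)
    exact (memLp_of_continuous hb (hU.smooth j).continuous ⊤).mul' (h.bdd' j)
  refine (h2.extPartial hb hU.toIsBoundaryChart hbd k).congr (fun x => by ring) fun x => ?_
  rw [pderiv_const, add_zero]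

/-- This is ∇f = c₀ν on Σ. The tangential and the normal condition combine through w_i = ∑ (w_i N_j
- w_j N_i) N_j + N_i ∑ w_j N_j, which uses |N| = 1 on all of U; the matching identity for the
derivatives also needs ∑ N_j ∂_k N_j = 0. -/
theorem isFluxEq_w (h : IsSolution Ω ν c c₀ f w D)
    (hb : Bornology.IsBounded Ω) (hΩ : IsOpen Ω) (hU : IsCapChart Ω ν U N) (i : Fin (n + 1)) :
    IsFluxEq Ω U (w i) (D i) (fun x => c₀ * N i x) (fun k x => c₀ * pderiv k (N i) x) := by
  have hNm : IsMultiplier Ω (fun x => c₀ * N i x) (fun k x => c₀ * pderiv k (N i) x) :=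
    (isMultiplier_of_contDiff hb (contDiff_const.mul (hU.smooth i))).congr (fun _ => rfl)
      fun k x => by rw [pderiv_mul contDiff_const (hU.smooth i), pderiv_const]; ring
  refine ⟨h.isMultiplier_w hb i, hNm, fun k => ?_⟩
  have hmul := fun j => isMultiplier_of_contDiff hb (hU.smooth j)
  have h1 := (ExtPartial.sum hb Finset.univ fun j _ =>
    (hmul j).mul _ _ _ _ (h.extPartial_rot hb hU i j k)).add hb
    ((hmul i).mul _ _ _ _ (h.extPartial_normal hb hΩ hU k))
  refine h1.congr_on ((h.bdd' i).sub hNm.bdd) ((h.memLp i k).sub (hNm.memLp k)) ?_ ?_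
  · intro x hx
    have hu := hU.unit x hx
    have e1 : ∑ j, (w i x * N j x - w j x * N i x) * N j x =
        w i x * (∑ j, N j x * N j x) - N i x * ∑ j, w j x * N j x := by
      rw [Finset.mul_sum, Finset.mul_sum, ← Finset.sum_sub_distrib]
      exact Finset.sum_congr rfl fun j _ => by ring
    rw [e1, hu]
    ring
  · intro x hx
    have hu := hU.unit x hx
    have hu' : ∑ j, N j x * pderiv k (N j) x = 0 := by
      have e : (fun y => ∑ j, N j y * N j y) =ᶠ[𝓝 x] fun _ => 1 := by
        filter_upwards [hU.isOpen.mem_nhds hx] with y hy using hU.unit y hy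
      have := pderiv_eq_of_eventuallyEq e k
      rw [pderiv_const, pderiv_sum _ fun j _ => (hU.smooth j).mul (hU.smooth j)] at this
      simp only [pderiv_mul (hU.smooth _) (hU.smooth _)] at this
      have h2 : ∑ j, (pderiv k (N j) x * N j x + N j x * pderiv k (N j) x) =
          2 * ∑ j, N j x * pderiv k (N j) x := by
        rw [Finset.mul_sum]
        exact Finset.sum_congr rfl fun j _ => by ring
      linarith
    have e1 : ∑ j, (((D i k x * N j x + w i x * pderiv k (N j) x) -
        (D j k x * N i x + w j x * pderiv k (N i) x)) * N j x +
        (w i x * N j x - w j x * N i x) * pderiv k (N j) x) =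
        D i k x * (∑ j, N j x * N j x) + 2 * w i x * (∑ j, N j x * pderiv k (N j) x) -
        N i x * (∑ j, (D j k x * N j x + w j x * pderiv k (N j) x)) -
        pderiv k (N i) x * ∑ j, w j x * N j x := by
      simp only [Finset.mul_sum, ← Finset.sum_sub_distrib, ← Finset.sum_add_distrib]
      exact Finset.sum_congr rfl fun j _ => by ring
    rw [e1, hu, hu']
    ring

end IsSolution

end

/-! ### Local structure of admissible domains -/

theorem isOpen_upper : IsOpen (upper n) :=
  isOpen_lt continuous_const (contDiff_coord (Fin.last n)).continuous

theorem convex_upper : Convex ℝ (upper n) := by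
  intro x hx y hy a b ha hb hab
  change 0 < (a • x + b • y) (Fin.last n)
  have hx' : 0 < x (Fin.last n) := hx
  have hy' : 0 < y (Fin.last n) := hy
  simp only [PiLp.add_apply, PiLp.smul_apply, smul_eq_mul]
  rcases ha.eq_or_lt with rfl | ha
  · rw [zero_add] at hab
    subst hab
    simpa using hy'
  · have := mul_pos ha hx'
    have := mul_nonneg hb hy'.le
    linarith

theorem _root_.IsPreconnected.subset_of_disjoint_frontier {X : Type*} [TopologicalSpace X]
    {s u : Set X} (hs : IsPreconnected s) (hu : IsOpen u) (hne : (s ∩ u).Nonempty)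
    (h : ∀ x ∈ s, x ∉ frontier u) : s ⊆ u := by
  refine hs.subset_of_closure_inter_subset hu hne fun x hx => ?_
  by_contra hxu
  exact h x hx.2 (by rw [hu.frontier_eq]; exact ⟨hx.1, hxu⟩)

/-- Otherwise both gradients would lie on the line spanned by e_{n+1}. -/
theorem exists_pderiv_ne_zero_of_linearIndependent {ρ η : E n → ℝ} {x : E n}
    (hli : LinearIndependent ℝ ![gradient ρ x, gradient η x]) :
    ∃ j, j ≠ Fin.last n ∧ (pderiv j ρ x ≠ 0 ∨ pderiv j η x ≠ 0) := by
  by_contra! hcon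
  rw [LinearIndependent.pair_iff] at hli
  have h3 := hli (pderiv (Fin.last n) η x) (-pderiv (Fin.last n) ρ x) (by
    ext i
    by_cases hi : i = Fin.last n
    · subst hi
      simp [gradient_apply]
      ring
    · simp [gradient_apply, (hcon i hi).1, (hcon i hi).2])
  have h4 := hli 1 0 (by
    ext i
    by_cases hi : i = Fin.last n
    · subst hi
      simpa [gradient_apply] using h3.2
    · simp [gradient_apply, (hcon i hi).1])
  exact one_ne_zero h4.1

/-- `d` is integrable with integral zero. -/
def IsNull (Ω : Set (E n)) (d : E n → ℝ) : Prop :=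
  Integrable d (volume.restrict Ω) ∧ ∫ x in Ω, d x = 0

theorem IsNull.add {Ω : Set (E n)} {d e : E n → ℝ} (h : IsNull Ω d) (h' : IsNull Ω e) :
    IsNull Ω (fun x => d x + e x) :=
  ⟨h.1.add h'.1, by rw [integral_add h.1 h'.1, h.2, h'.2, add_zero]⟩

theorem IsNull.const_mul {Ω : Set (E n)} {d : E n → ℝ} (h : IsNull Ω d) (a : ℝ) :
    IsNull Ω (fun x => a * d x) :=
  ⟨h.1.const_mul a, by rw [integral_const_mul, h.2, mul_zero]⟩

theorem IsNull.sum {Ω : Set (E n)} {ι : Type*} (s : Finset ι) {d : ι → E n → ℝ}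
    (h : ∀ l ∈ s, IsNull Ω (d l)) : IsNull Ω (fun x => ∑ l ∈ s, d l x) :=
  ⟨integrable_finsetSum _ fun l hl => (h l hl).1, by
    rw [integral_finsetSum _ fun l hl => (h l hl).1]
    exact Finset.sum_eq_zero fun l hl => (h l hl).2⟩

theorem IsNull.congr_ae {Ω : Set (E n)} {d e : E n → ℝ} (h : IsNull Ω d)
    (hde : d =ᵐ[volume.restrict Ω] e) : IsNull Ω e :=
  ⟨h.1.congr hde, by rw [← integral_congr_ae hde, h.2]⟩

namespace IsAdmissible

variable {Ω : Set (E n)} {ν : E n → E n}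

theorem nonneg_of_mem_closure (hΩ : IsAdmissible Ω) {x : E n} (hx : x ∈ closure Ω) :
    0 ≤ x (Fin.last n) := by
  have hc : IsClosed {x : E n | 0 ≤ x (Fin.last n)} :=
    isClosed_le continuous_const (contDiff_coord (Fin.last n)).continuous
  exact closure_minimal (s := Ω) (t := {x : E n | 0 ≤ x (Fin.last n)})
    (fun y hy => by
      have h : 0 < y (Fin.last n) := hΩ.subset_upper hy
      exact h.le) hc hx

theorem exists_isCapChart (hΩ : IsAdmissible Ω) (hν : IsOuterNormalField Ω ν) {x : E n}
    (hx : x ∈ frontier Ω ∩ upper n) :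
    ∃ U N, x ∈ U ∧ U ⊆ upper n ∧ IsCapChart Ω ν U N := by
  obtain ⟨v, hv, ρ, hρ, ⟨a, ha, hga⟩, hnear⟩ := hΩ.smooth_interior x hx
  have hg : gradient ρ x ≠ 0 := by
    rw [hga]
    refine smul_ne_zero ha.ne' ?_
    rintro rfl
    simp at hv
  obtain ⟨U, N, hxU, hUV, hchart, -⟩ :=
    exists_isBoundaryChart hΩ.isOpen hρ hg hnear (isOpen_upper.mem_nhds hx.2)
  refine ⟨U, N, hxU, hUV, ⟨hchart, fun y hy => subset_closure ⟨hy.1, hUV hy.2⟩, fun y hy i => ?_⟩⟩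
  exact hchart.normal y hy.2 hy.1 _ (hν.isNormal y ⟨hy.1, hUV hy.2⟩) i

/-- A small half-ball at such a point is connected, contains points of Ω and misses ∂Ω, so it lies
in Ω. -/
theorem eventually_mem_iff_of_mem_flatPart (hΩ : IsAdmissible Ω) {x : E n} (hx : x ∈ flatPart Ω)
    (hx' : x ∉ capPart Ω) : ∀ᶠ y in 𝓝 x, y ∈ Ω ↔ y ∈ upper n := by
  obtain ⟨r, hr, hsub⟩ := Metric.isOpen_iff.1 (isClosed_closure (s := frontier Ω ∩ upper n)).isOpen_compl x hx'
  have hconv : IsPreconnected (Metric.ball x r ∩ upper n) :=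
    ((convex_ball x r).inter convex_upper).isPreconnected
  obtain ⟨y, hyΩ, hyb⟩ := Metric.mem_closure_iff.1 (frontier_subset_closure hx.1) r hr
  rw [dist_comm] at hyb
  filter_upwards [Metric.ball_mem_nhds x hr] with p hp
  refine ⟨fun h => hΩ.subset_upper h, fun hpu => ?_⟩
  exact hconv.subset_of_disjoint_frontier hΩ.isOpen ⟨y, ⟨hyb, hΩ.subset_upper hyΩ⟩, hyΩ⟩
    (fun q hq hqf => hsub hq.1 (subset_closure ⟨hqf, hq.2⟩)) ⟨hp, hpu⟩

theorem exists_isFlatChart (hΩ : IsAdmissible Ω) {x : E n} (hx : x ∈ flatPart Ω)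
    (hx' : x ∉ capPart Ω) : ∃ U N, x ∈ U ∧ IsFlatChart Ω U N := by
  have hρ : ContDiff ℝ ∞ fun y : E n => -y (Fin.last n) := (contDiff_coord _).neg
  have hpd : ∀ i y, pderiv i (fun y : E n => -y (Fin.last n)) y = if i = Fin.last n then -1 else 0 := by
    intro i y
    have := pderiv_mul (contDiff_const (c := (-1 : ℝ))) (contDiff_coord (Fin.last n)) i y
    simp only [neg_one_mul, pderiv_const, pderiv_coord, zero_mul, zero_add] at this
    rw [this]
    split_ifs <;> norm_num
  have hn : ∀ y, ‖gradient (fun y : E n => -y (Fin.last n)) y‖ = 1 := fun y => by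
    rw [← sq_eq_sq₀ (norm_nonneg _) zero_le_one, norm_gradient_sq]
    simp [hpd]
  have hg : gradient (fun y : E n => -y (Fin.last n)) x ≠ 0 := by
    rw [← norm_ne_zero_iff, hn]; exact one_ne_zero
  have hnear : ∀ᶠ y in 𝓝 x, (y ∈ Ω ↔ -y (Fin.last n) < 0) := by
    filter_upwards [hΩ.eventually_mem_iff_of_mem_flatPart hx hx'] with y hy
    rw [hy, neg_lt_zero]
    rfl
  obtain ⟨U, N, hxU, -, hchart, hUN⟩ := exists_isBoundaryChart hΩ.isOpen hρ hg hnear univ_mem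
  refine ⟨U, N, hxU, ⟨hchart, fun y hy => ⟨hy.1, ?_⟩, fun y hy i => ?_⟩⟩
  · have := eq_zero_of_mem_frontier hΩ.isOpen hchart.isOpen hρ.continuous
      (fun z hz => (hUN z hz).1) hy.2 hy.1
    change y (Fin.last n) = 0
    linarith
  · rw [(hUN y hy).2 i, hn, hpd]
    simp

/-- Γ lies in the hyperplane, so besides x_{n+1} only one of its two defining functions is needed:
one whose gradient is not vertical. This is the form required by the removability argument. -/
theorem exists_corner_function (hΩ : IsAdmissible Ω) {x : E n} (hx : x ∈ corner Ω) :
    ∃ (ζ : E n → ℝ) (j : Fin (n + 1)), ContDiff ℝ ∞ ζ ∧ j ≠ Fin.last n ∧ pderiv j ζ x ≠ 0 ∧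
      ∀ᶠ y in 𝓝 x, y ∈ corner Ω → y (Fin.last n) = 0 ∧ ζ y = 0 := by
  obtain ⟨ρ, η, hρ, hη, hli, hnear⟩ := hΩ.smooth_boundary x hx
  obtain ⟨j, hj, h | h⟩ := exists_pderiv_ne_zero_of_linearIndependent hli
  · refine ⟨ρ, j, hρ, hj, h, ?_⟩
    filter_upwards [hnear] with y hy hyc using ⟨hyc.2.2, (hy.2.1 hyc).1⟩
  · refine ⟨η, j, hη, hj, h, ?_⟩
    filter_upwards [hnear] with y hy hyc using ⟨hyc.2.2, (hy.2.1 hyc).2⟩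

/-- The divergence theorem for fields without flux. Off Γ, every point lies in Ω, outside its
closure, on Σ inside the half-space, or on T away from Σ, and the local statements glue; Γ is then
removable and the test function 1 may be used. -/
theorem isNull_div (hΩ : IsAdmissible Ω) (hν : IsOuterNormalField Ω ν)
    {V : Fin (n + 1) → E n → ℝ} {d : E n → ℝ} (hV : IsDivPair Ω V d) (hint : HasDivOn Ω Ω V d)
    (hcap : ∀ U N, IsCapChart Ω ν U N → HasDivOn Ω U V d)
    (hflat : ∀ U N, IsFlatChart Ω U N → HasDivOn Ω U V d) : IsNull Ω d := by
  refine ⟨hV.integrable, ?_⟩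
  have hloc : HasDivOn Ω (corner Ω)ᶜ V d := by
    refine HasDivOn.of_local hV fun x hx => ?_
    by_cases hxΩ : x ∈ Ω
    · exact ⟨Ω, hΩ.isOpen, hxΩ, hint⟩
    by_cases hxc : x ∈ closure Ω
    · have hf : x ∈ frontier Ω := by
        rw [hΩ.isOpen.frontier_eq]
        exact ⟨hxc, hxΩ⟩
      rcases (hΩ.nonneg_of_mem_closure hxc).eq_or_lt with h0 | hpos
      · have hT : x ∈ flatPart Ω := ⟨hf, h0.symm⟩
        obtain ⟨U, N, hxU, hU⟩ := hΩ.exists_isFlatChart hT fun h => hx ⟨h, hT⟩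
        exact ⟨U, hU.isOpen, hxU, hflat U N hU⟩
      · obtain ⟨U, N, hxU, -, hU⟩ := hΩ.exists_isCapChart hν ⟨hf, hpos⟩
        exact ⟨U, hU.isOpen, hxU, hcap U N hU⟩
    · refine ⟨(closure Ω)ᶜ, isClosed_closure.isOpen_compl, hxc, fun ψ hψ => ?_⟩
      refine setIntegral_eq_zero_of_forall_eq_zero fun y hy => ?_
      have hy' : y ∉ (closure Ω)ᶜ := fun h => h (subset_closure hy)
      simp [hψ.eq_zero_of_notMem hy', (hψ.pderiv _).eq_zero_of_notMem hy']
  refine HasDivOn.integral_eq_zero hΩ.isBounded hΩ.isOpen.measurableSet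
    (HasDivOn.of_local hV fun x _ => ?_)
  by_cases hx : x ∈ corner Ω
  · obtain ⟨ζ, j, hζ, hj, hζj, hΓ⟩ := hΩ.exists_corner_function hx
    exact hloc.exists_of_compl hV hζ hj hζj hΓ
  · refine ⟨(corner Ω)ᶜ, ?_, hx, hloc⟩
    exact (isClosed_closure.inter (isClosed_frontier.inter (isClosed_eq
      (contDiff_coord (Fin.last n)).continuous continuous_const))).isOpen_compl

/-- The divergence theorem for fields with multipliers as components. -/
theorem isNull_sum (hΩ : IsAdmissible Ω) (hν : IsOuterNormalField Ω ν)
    {V : Fin (n + 1) → E n → ℝ} {V' : Fin (n + 1) → Fin (n + 1) → E n → ℝ}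
    (hV : ∀ i, IsMultiplier Ω (V i) (V' i))
    (hcap : ∀ U N, IsCapChart Ω ν U N → HasDivOn Ω U V (fun x => ∑ i, V' i i x))
    (hflat : ∀ U N, IsFlatChart Ω U N →
      ExtPartial Ω U (Fin.last n) (V (Fin.last n)) (V' (Fin.last n) (Fin.last n))) :
    IsNull Ω (fun x => ∑ i, V' i i x) := by
  have hb := hΩ.isBounded
  have hint : ∀ i, ExtPartial Ω Ω i (V i) (V' i i) := fun i =>
    (hV i).extPartial (extPartial_one_interior hb i)
  refine hΩ.isNull_div hν (IsDivPair.of_extPartial hb hint)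
    (HasDivOn.of_extPartial hb hint) hcap fun U N hU => HasDivOn.of_extPartial hb fun i => ?_
  by_cases hi : i = Fin.last n
  · subst hi
    exact hflat U N hU
  · exact (hV i).extPartial (hU.extPartial_one hb hi)

end IsAdmissible

/-! ### Integral identities -/

section

variable {Ω U : Set (E n)} {N : Fin (n + 1) → E n → ℝ} {ν : E n → E n} {c c₀ : ℝ} {f : E n → ℝ}
  {w : Fin (n + 1) → E n → ℝ} {D : Fin (n + 1) → Fin (n + 1) → E n → ℝ}

theorem ExtPartial.ae_unique (hb : Bornology.IsBounded Ω) (hΩ : IsOpen Ω) {i : Fin (n + 1)}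
    {u a b : E n → ℝ} (h : ExtPartial Ω Ω i u a) (h' : ExtPartial Ω Ω i u b) :
    a =ᵐ[volume.restrict Ω] b := by
  have hfin : IsFiniteMeasure (volume.restrict Ω) :=
    ⟨by rw [Measure.restrict_apply_univ]; exact hb.measure_lt_top⟩
  have hloc : ∀ {a : E n → ℝ}, MemLp a 2 (volume.restrict Ω) → LocallyIntegrableOn a Ω :=
    fun ha => IntegrableOn.locallyIntegrableOn (ha.integrable one_le_two)
  refine ae_eq_of_forall_test hΩ (hloc h.memLp) (hloc h'.memLp) fun φ hφ => ?_
  rw [← neg_inj, ← h.ibp φ hφ, ← h'.ibp φ hφ]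

theorem IsBoundaryChart.hasDivOn_of_isMultiplier (hb : Bornology.IsBounded Ω) (hΩ : IsOpen Ω)
    (hU : IsBoundaryChart Ω U N) {Y : Fin (n + 1) → E n → ℝ}
    {Y' : Fin (n + 1) → Fin (n + 1) → E n → ℝ} (hY : ∀ i, ContDiff ℝ ∞ (Y i))
    (hY' : ∀ i, IsMultiplier Ω (Y i) (Y' i)) (hYN : ∀ x ∈ U, ∑ i, Y i x * N i x = 0) :
    HasDivOn Ω U Y (fun x => ∑ i, Y' i i x) := by
  refine (hU.hasDivOn_of_tangential hY hYN).congr_ae ?_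
  have : ∀ i, pderiv i (Y i) =ᵐ[volume.restrict Ω] Y' i i := fun i =>
    ((isMultiplier_of_contDiff hb (hY i)).extPartial (extPartial_one_interior hb i)).ae_unique hb hΩ
      ((hY' i).extPartial (extPartial_one_interior hb i))
  filter_upwards [eventually_countable_forall.2 this] with x hx
  exact ⟨fun _ => rfl, Finset.sum_congr rfl fun i _ => hx i⟩

/-- The gradient `g = ∇(f + c x_{n+1})`, whose last component vanishes on `T`. -/
def shift (c : ℝ) (w : Fin (n + 1) → E n → ℝ) (i : Fin (n + 1)) (x : E n) : ℝ :=
  w i x + if i = Fin.last n then c else 0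

/-! ### Fields without boundary flux -/

namespace IsSolution

theorem isMultiplier_shift (h : IsSolution Ω ν c c₀ f w D) (hb : Bornology.IsBounded Ω)
    (i : Fin (n + 1)) : IsMultiplier Ω (shift c w i) (D i) :=
  ((h.isMultiplier_w hb i).add hb (isMultiplier_const hb _)).congr (fun _ => rfl)
    fun k x => by rw [add_zero]

theorem extPartial_shift (h : IsSolution Ω ν c c₀ f w D) (hb : Bornology.IsBounded Ω)
    (hU : IsFlatChart Ω U N) (k : Fin (n + 1)) :
    ExtPartial Ω U k (shift c w (Fin.last n)) (D (Fin.last n) k) :=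
  (h.extPartial_w_last hb hU k).congr (fun x => by simp [shift]) fun x => rfl

theorem isFluxEq_shift (h : IsSolution Ω ν c c₀ f w D) (hb : Bornology.IsBounded Ω)
    (hΩ : IsOpen Ω) (hU : IsCapChart Ω ν U N) (i : Fin (n + 1)) :
    IsFluxEq Ω U (shift c w i) (fun k x => D i k x + 0)
      (fun x => c₀ * N i x + if i = Fin.last n then c else 0)
      (fun k x => c₀ * pderiv k (N i) x + 0) :=
  (h.isFluxEq_w hb hΩ hU i).add hb (IsFluxEq.rfl (isMultiplier_const hb _))

theorem isMultiplier_excess (h : IsSolution Ω ν c c₀ f w D) (hb : Bornology.IsBounded Ω) :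
    IsMultiplier Ω (fun x => ∑ j, w j x * w j x + -c₀ ^ 2)
      (fun k x => ∑ j, (D j k x * w j x + w j x * D j k x) + 0) :=
  (IsMultiplier.sum hb Finset.univ fun j _ =>
    (h.isMultiplier_w hb j).mul_mul (h.isMultiplier_w hb j)).add hb (isMultiplier_const hb _)

/-- Since w = c₀N on Σ, the comparison function for |w|² is c₀²|N|², which is the constant c₀² on
the whole chart. -/
theorem extPartial_excess (h : IsSolution Ω ν c c₀ f w D) (hb : Bornology.IsBounded Ω)
    (hΩ : IsOpen Ω) (hU : IsCapChart Ω ν U N) (k : Fin (n + 1)) :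
    ExtPartial Ω U k (fun x => ∑ j, w j x * w j x + -c₀ ^ 2)
      (fun x => ∑ j, (D j k x * w j x + w j x * D j k x) + 0) := by
  have hw := h.isFluxEq_w hb hΩ hU
  have hQ := (IsFluxEq.sum hb Finset.univ fun j _ => (hw j).mul_mul hb (hw j)).add hb
    (IsFluxEq.rfl (isMultiplier_const hb (-c₀ ^ 2)))
  have hval : ∀ x ∈ U, ∑ j, c₀ * N j x * (c₀ * N j x) = c₀ ^ 2 := fun x hx => by
    calc ∑ j, c₀ * N j x * (c₀ * N j x) = c₀ ^ 2 * ∑ j, N j x * N j x := by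
          rw [Finset.mul_sum]
          exact Finset.sum_congr rfl fun j _ => by ring
      _ = c₀ ^ 2 := by rw [hU.unit x hx, mul_one]
  have hder : ∀ x ∈ U, ∑ j, (c₀ * pderiv k (N j) x * (c₀ * N j x) +
      c₀ * N j x * (c₀ * pderiv k (N j) x)) = 0 := fun x hx => by
    have e : (fun y => ∑ j, c₀ * N j y * (c₀ * N j y)) =ᶠ[𝓝 x] fun _ => c₀ ^ 2 := by
      filter_upwards [hU.isOpen.mem_nhds hx] with y hy using hval y hy
    have hs := fun j => (contDiff_const (c := c₀)).mul (hU.smooth j)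
    have := pderiv_eq_of_eventuallyEq e k
    rw [pderiv_const, pderiv_sum _ fun j _ => (hs j).mul (hs j)] at this
    simpa only [pderiv_mul (hs _) (hs _), pderiv_mul contDiff_const (hU.smooth _), pderiv_const,
      zero_mul, zero_add] using this
  refine (hQ.sub k).congr_on hQ.left.bdd (hQ.left.memLp k) (fun x hx => ?_) fun x hx => ?_
  · rw [hval x hx]; ring
  · rw [hder x hx]; ring

/-- The field is u g: u vanishes on Σ and g_{n+1} vanishes on T. It is applied to u = f and u = |w|²
- c₀². -/
theorem isNull_mul_shift (h : IsSolution Ω ν c c₀ f w D) (hΩ : IsAdmissible Ω)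
    (hν : IsOuterNormalField Ω ν) {u : E n → ℝ} {u' : Fin (n + 1) → E n → ℝ}
    (hu : IsMultiplier Ω u u')
    (hcap : ∀ U N, IsCapChart Ω ν U N → ∀ k, ExtPartial Ω U k u (u' k)) :
    IsNull Ω (fun x => ∑ i, (u' i x * shift c w i x + u x * D i i x)) := by
  have hb := hΩ.isBounded
  have hg := h.isMultiplier_shift hb
  refine hΩ.isNull_sum hν (fun i => hu.mul_mul (hg i)) (fun U N hU => ?_) fun U N hU => ?_
  · exact HasDivOn.of_extPartial hb fun i => (hg i).mul _ _ _ _ (hcap U N hU i)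
  · exact (hu.mul _ _ _ _ (h.extPartial_shift hb hU _)).congr (fun x => by ring) fun x => by ring

/-- The field is u x: u vanishes on Σ and x_{n+1} vanishes on T. -/
theorem isNull_mul_coord (hΩ : IsAdmissible Ω)
    (hν : IsOuterNormalField Ω ν) {u : E n → ℝ} {u' : Fin (n + 1) → E n → ℝ}
    (hu : IsMultiplier Ω u u')
    (hcap : ∀ U N, IsCapChart Ω ν U N → ∀ k, ExtPartial Ω U k u (u' k)) :
    IsNull Ω (fun x => ∑ i, (u' i x * x i + u x * if i = i then 1 else 0)) := by
  have hb := hΩ.isBounded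
  have hg := isMultiplier_coord hb
  refine hΩ.isNull_sum hν (fun i => hu.mul_mul (hg i)) (fun U N hU => ?_) fun U N hU => ?_
  · exact HasDivOn.of_extPartial hb fun i => (hg i).mul _ _ _ _ (hcap U N hU i)
  · exact (hu.mul _ _ _ _ (hU.extPartial_coord hb _)).congr (fun x => by ring)
      fun x => by ring

/-- The field is ⟨w,x⟩ g - ⟨w,g⟩ x. On Σ, where w = c₀ν, its normal component is c₀(⟨ν,x⟩⟨g,ν⟩ -
⟨ν,g⟩⟨x,ν⟩) = 0; on T the last components of g and x vanish. The integrand is kept in the shape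
produced by the product rules. -/
theorem isNull_rotation (h : IsSolution Ω ν c c₀ f w D) (hΩ : IsAdmissible Ω)
    (hν : IsOuterNormalField Ω ν) :
    IsNull Ω (fun x => ∑ i,
      ((∑ j, (D j i x * x j + w j x * if i = j then 1 else 0)) * shift c w i x +
        (∑ j, w j x * x j) * (D i i x + 0) +
      (0 * ((∑ j, w j x * shift c w j x) * x i) +
        -1 * ((∑ j, (D j i x * shift c w j x + w j x * (D j i x + 0))) * x i +
          (∑ j, w j x * shift c w j x) * if i = i then 1 else 0)))) := by
  have hb := hΩ.isBounded
  have hx := isMultiplier_coord hb (n := n) (Ω := Ω)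
  -- The comparison field arises by replacing w by c₀N and g by c₀N + c e_{n+1}. It is smooth, and
  -- the pointwise computation shows that it is tangential.
  have hflux : ∀ U N, IsCapChart Ω ν U N → ∀ i, _ := fun U N hU i =>
    let hw := h.isFluxEq_w hb hΩ.isOpen hU
    let hg := h.isFluxEq_shift hb hΩ.isOpen hU
    let hX := fun i => IsFluxEq.rfl (U := U) (hx i)
    ((IsFluxEq.sum hb Finset.univ fun j _ => (hw j).mul_mul hb (hX j)).mul_mul hb (hg i)).add hb
      ((IsFluxEq.rfl (isMultiplier_const hb (-1))).mul_mul hb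
      ((IsFluxEq.sum hb Finset.univ fun j _ => (hw j).mul_mul hb (hg j)).mul_mul hb (hX i)))
  have hw := h.isMultiplier_w hb
  have hg : ∀ i, IsMultiplier Ω (shift c w i) (fun k x => D i k x + 0) := fun i =>
    (h.isMultiplier_shift hb i).congr (fun _ => rfl) fun k x => (add_zero _).symm
  have hmul := fun i => ((IsMultiplier.sum hb Finset.univ fun j _ =>
    (hw j).mul_mul (hx j)).mul_mul (hg i)).add hb ((isMultiplier_const hb (-1)).mul_mul
      ((IsMultiplier.sum hb Finset.univ fun j _ => (hw j).mul_mul (hg j)).mul_mul (hx i)))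
  refine hΩ.isNull_sum hν hmul (fun U N hU => ?_) fun U N hU => ?_
  · refine HasDivOn.of_isFluxEq hb (hflux U N hU) (hU.hasDivOn_of_isMultiplier hb hΩ.isOpen
      (fun i => ?_) (fun i => (hflux U N hU i).right) fun x hx => ?_)
    · have hN := fun j => (contDiff_const (c := c₀)).mul (hU.smooth j)
      have hN' := fun j : Fin (n + 1) => (hN j).add
        (contDiff_const (c := if j = Fin.last n then c else 0))
      exact ((ContDiff.sum fun j _ => (hN j).mul (contDiff_coord j)).mul (hN' i)).add
        (contDiff_const.mul ((ContDiff.sum fun j _ => (hN j).mul (hN' j)).mul (contDiff_coord i)))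
    · have hu := hU.unit x hx
      set A := ∑ j, c₀ * N j x * x j with hA
      set B := ∑ j, c₀ * N j x * (c₀ * N j x + if j = Fin.last n then c else 0) with hB
      have hA' : A = c₀ * ∑ j, x j * N j x := by
        rw [hA, Finset.mul_sum]
        exact Finset.sum_congr rfl fun j _ => by ring
      have hS : ∑ j, (c₀ * N j x + if j = Fin.last n then c else 0) * N j x =
          c₀ + c * N (Fin.last n) x := by
        simp only [add_mul, Finset.sum_add_distrib, mul_assoc, ← Finset.mul_sum, hu, ite_mul,
          zero_mul, Finset.sum_ite_eq', Finset.mem_univ, if_true, mul_one]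
      have hB' : B = c₀ * (c₀ + c * N (Fin.last n) x) := by
        rw [← hS, hB, Finset.mul_sum]
        exact Finset.sum_congr rfl fun j _ => by ring
      calc ∑ i, (A * (c₀ * N i x + if i = Fin.last n then c else 0) + -1 * (B * x i)) * N i x
          = A * (∑ i, (c₀ * N i x + if i = Fin.last n then c else 0) * N i x) -
            B * ∑ i, x i * N i x := by
            rw [Finset.mul_sum, Finset.mul_sum, ← Finset.sum_sub_distrib]
            exact Finset.sum_congr rfl fun j _ => by ring
        _ = 0 := by rw [hS, hA', hB']; ring
  · have h1 := (IsMultiplier.sum hb Finset.univ fun j _ => (hw j).mul_mul (hx j)).mul _ _ _ _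
      ((h.extPartial_shift hb hU (Fin.last n)))
    have h2 := ((IsMultiplier.sum hb Finset.univ fun j _ => (hw j).mul_mul (hg j)).mul _ _ _ _
      (hU.extPartial_coord hb (Fin.last n))).const_mul (-1)
    exact (h1.add hb h2).congr (fun x => by ring) fun x => by ring

/-- Formally the flux contains ∂_j w_{n+1} with j tangential, and w_{n+1} is constant on T; but ∂_j
w_{n+1} is only L² and has no trace. With l the last index, write f∇g_l = ∇(f g_l) - g_l∇f. The
first term gives a rotated gradient of a function vanishing on T, and the second has the factor g_l,
which vanishes on T. -/
theorem hasDivOn_rotField_flat (h : IsSolution Ω ν c c₀ f w D) (hΩ : IsAdmissible Ω)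
    (hU : IsFlatChart Ω U N) {j : Fin (n + 1)} (hj : j ≠ Fin.last n) :
    HasDivOn Ω U (rotField (Fin.last n) j (fun x => f x * shift c w j x) (D (Fin.last n)))
      (fun x => (w (Fin.last n) x * shift c w j x + f x * D j (Fin.last n) x) * D (Fin.last n) j x -
        (w j x * shift c w j x + f x * D j j x) * D (Fin.last n) (Fin.last n) x) := by
  have hb := hΩ.isBounded
  set l := Fin.last n with hl
  have hg := h.isMultiplier_shift hb
  have hw := h.isMultiplier_w hb
  have hgl : ∀ k, ExtPartial Ω U k (shift c w l) (D l k) := h.extPartial_shift hb hU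
  have hp : ∀ k, ExtPartial Ω U k (fun x => f x * shift c w l x)
      (fun x => w k x * shift c w l x + f x * D l k x) := fun k =>
    ((h.isMultiplier_f hb).mul _ _ _ _ (hgl k)).congr (fun x => by ring) fun x => by ring
  have hp' : ∀ k, MemLp (fun x => w k x * shift c w l x + f x * D l k x) 2 (volume.restrict Ω) :=
    fun k => (hp k).memLp
  obtain ⟨φ, hφ⟩ := h.exists_isApprox j
  have hφ' := hφ.add (isApprox_of_contDiff hb (contDiff_const (c := if j = l then c else 0)))
  have hright := hasDivOn_rotField_of_extPartial_right hb l j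
    (v' := fun k x => w k x * shift c w l x + f x * D l k x) (hp l) (hp j) hφ'
  have hrp := isDivPair_rotField (Ω := Ω) l j (hg j).bdd hφ'.memLp' hp'
  have hcorr : ∀ k, ExtPartial Ω U k
      (rotField l j (shift c w l) (fun i x => -(shift c w j x * w i x)) k)
      (fun x => (if k = l then -(D l l x * (shift c w j x * w j x) +
          shift c w l x * (D j l x * w j x + shift c w j x * D j l x)) else 0) +
        if k = j then D l j x * (shift c w j x * w l x) +
          shift c w l x * (D j j x * w l x + shift c w j x * D l j x) else 0) := fun k => by
    by_cases hkl : k = l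
    · subst hkl
      have hne : ¬ l = j := fun h => hj h.symm
      have := (((hg j).mul_mul (hw j)).mul _ _ _ _ (hgl l)).const_mul (-1)
      refine this.congr (fun x => ?_) fun x => ?_
      · simp [rotField, hne]
      · simp [hne]
    · by_cases hkj : k = j
      · subst hkj
        refine (((hg k).mul_mul (hw l)).mul _ _ _ _ (hgl k)).congr (fun x => ?_) fun x => ?_
        · simp [rotField, hkl]
        · simp [hkl]
      · refine ExtPartial.zero.congr (fun x => ?_) fun x => ?_
        · simp [rotField, hkl, hkj]
        · simp [hkl, hkj]
  refine (hright.add hrp (IsDivPair.of_extPartial hb hcorr)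
    (HasDivOn.of_extPartial hb hcorr)).congr_ae ?_
  filter_upwards [h.symm l j] with x hx
  refine ⟨fun k => ?_, ?_⟩
  · simp only [rotField]
    split_ifs <;> ring
  · simp only [Finset.sum_add_distrib, Finset.sum_ite_eq', Finset.mem_univ, if_true, pderiv_const,
      hx]
    ring

/-- The field is f g_j (D_ij E_i - D_ii E_j). On Σ the factor f vanishes. On T, either g_j vanishes
(j last), or the field is tangential (neither index is last), or the delicate case i last, j not
last occurs. Summed over i and j, these divergences contain f|D|². -/
theorem isNull_hessian (h : IsSolution Ω ν c c₀ f w D) (hΩ : IsAdmissible Ω)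
    (hν : IsOuterNormalField Ω ν) (i j : Fin (n + 1)) :
    IsNull Ω (fun x => (w i x * shift c w j x + f x * D j i x) * D i j x -
      (w j x * shift c w j x + f x * D j j x) * D i i x) := by
  have hb := hΩ.isBounded
  have hg := h.isMultiplier_shift hb
  have hf := h.isMultiplier_f hb
  have hfg := fun j => hf.mul_mul (hg j)
  obtain ⟨φ, hφ⟩ := h.exists_isApprox i
  refine hΩ.isNull_div hν (isDivPair_rotField (Ω := Ω) i j (hfg j).bdd (hfg j).memLp (h.memLp i))
    ?_ (fun U N hU => ?_) fun U N hU => ?_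
  · exact hasDivOn_rotField_of_extPartial_left hb i j
      (u' := fun k x => w k x * shift c w j x + f x * D j k x)
      ((hfg j).extPartial (extPartial_one_interior hb i))
      ((hfg j).extPartial (extPartial_one_interior hb j)) hφ
  · exact hasDivOn_rotField_of_extPartial_left hb i j
      (u' := fun k x => w k x * shift c w j x + f x * D j k x)
      ((hg j).mul _ _ _ _ (h.extPartial_f hb hU i))
      ((hg j).mul _ _ _ _ (h.extPartial_f hb hU j)) hφ
  · by_cases hj : j = Fin.last n
    · subst hj
      have hp : ∀ k, ExtPartial Ω U k (fun x => f x * shift c w (Fin.last n) x)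
          (fun x => w k x * shift c w (Fin.last n) x + f x * D (Fin.last n) k x) := fun k =>
        (hf.mul _ _ _ _ (h.extPartial_shift hb hU k)).congr (fun x => by ring) fun x => by ring
      exact hasDivOn_rotField_of_extPartial_left hb i (Fin.last n)
        (u' := fun k x => w k x * shift c w (Fin.last n) x + f x * D (Fin.last n) k x)
        (hp i) (hp _) hφ
    · by_cases hi : i = Fin.last n
      · subst hi
        exact h.hasDivOn_rotField_flat hΩ hU hj
      · exact hasDivOn_rotField_of_extPartial_left hb i j
          (u' := fun k x => w k x * shift c w j x + f x * D j k x)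
          ((hfg j).extPartial (hU.extPartial_one hb hi))
          ((hfg j).extPartial (hU.extPartial_one hb hj)) hφ

end IsSolution

end

/-! ### The Hessian of a solution -/

section

variable {ι : Type*} [Fintype ι] {D : ι → ι → ℝ}

theorem sum_grad_add_laplacian (htr : ∑ i, D i i = 1) (w g : ι → ℝ) (a : ℝ) :
    ∑ i, (w i * g i + a * D i i) = ∑ i, w i * g i + a := by
  rw [Finset.sum_add_distrib, ← Finset.mul_sum, htr, mul_one]

theorem sum_grad_add_card [DecidableEq ι] (w y : ι → ℝ) (a : ℝ) :
    ∑ i, (w i * y i + a * if i = i then 1 else 0) = ∑ i, w i * y i + Fintype.card ι * a := by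
  simp [Finset.sum_add_distrib]

theorem sum_excess (w y : ι → ℝ) :
    ∑ i, (∑ j, (D j i * w j + w j * D j i) + 0) * y i = 2 * ∑ i, ∑ j, w j * D j i * y i := by
  rw [Finset.mul_sum]
  refine Finset.sum_congr rfl fun i _ => ?_
  rw [add_zero, Finset.sum_mul, Finset.mul_sum]
  exact Finset.sum_congr rfl fun j _ => by ring

theorem sum_rotation [DecidableEq ι] (hs : ∀ i j, D i j = D j i) (htr : ∑ i, D i i = 1) (w g y : ι → ℝ) :
    ∑ i, ((∑ j, (D j i * y j + w j * if i = j then 1 else 0)) * g i +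
        (∑ j, w j * y j) * (D i i + 0) +
      (0 * ((∑ j, w j * g j) * y i) +
        -1 * ((∑ j, (D j i * g j + w j * (D j i + 0))) * y i +
          (∑ j, w j * g j) * if i = i then 1 else 0))) =
      (1 - Fintype.card ι) * (∑ j, w j * g j) + ∑ j, w j * y j -
        ∑ i, ∑ j, w j * D j i * y i := by
  have h1 : ∀ i, ∑ j, (D j i * y j + w j * if i = j then 1 else 0) = ∑ j, D j i * y j + w i :=
    fun i => by simp [Finset.sum_add_distrib]
  have h2 : ∑ i, ∑ j, D j i * y j * g i = ∑ i, ∑ j, D j i * g j * y i := by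
    rw [Finset.sum_comm]
    exact Finset.sum_congr rfl fun i _ => Finset.sum_congr rfl fun j _ => by rw [hs i j]; ring
  set G := ∑ j, w j * g j with hG
  set X := ∑ j, w j * y j
  simp only [h1, if_true, add_mul, Finset.sum_add_distrib, ← Finset.mul_sum, mul_add,
    zero_mul, add_zero, h2, htr, ← hG, Finset.sum_mul]
  simp
  ring

theorem sum_hessian (hs : ∀ i j, D i j = D j i) (htr : ∑ i, D i i = 1) (w g : ι → ℝ) (a : ℝ) :
    ∑ i, ∑ j, ((w i * g j + a * D j i) * D i j - (w j * g j + a * D j j) * D i i) =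
      ∑ i, ∑ j, w j * D j i * g i - ∑ j, w j * g j + a * (∑ i, ∑ j, D i j * D i j - 1) := by
  have h1 : ∑ i, ∑ j, (w j * g j + a * D j j) * D i i = ∑ j, w j * g j + a := by
    simp only [← Finset.sum_mul, ← Finset.mul_sum, Finset.sum_add_distrib, htr, mul_one]
  have h2 : ∑ i, ∑ j, (w i * g j + a * D j i) * D i j =
      ∑ i, ∑ j, w j * D j i * g i + a * ∑ i, ∑ j, D i j * D i j := by
    simp only [add_mul, Finset.sum_add_distrib, Finset.mul_sum]
    congr 1
    · rw [Finset.sum_comm]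
      exact Finset.sum_congr rfl fun i _ => Finset.sum_congr rfl fun j _ => by ring
    · exact Finset.sum_congr rfl fun i _ => Finset.sum_congr rfl fun j _ => by rw [hs j i]; ring
  simp only [Finset.sum_sub_distrib, h1, h2]
  ring

/-- The trace-free part: |D - I/K|² = |D|² - 1/K because tr D = 1. -/
theorem sum_sub_diag_sq [DecidableEq ι] (htr : ∑ i, D i i = 1) :
    ∑ i, ∑ j, (D i j - if i = j then (Fintype.card ι : ℝ)⁻¹ else 0) ^ 2 =
      ∑ i, ∑ j, D i j * D i j - (Fintype.card ι : ℝ)⁻¹ := by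
  have h1 : ∀ i j, (D i j - if i = j then (Fintype.card ι : ℝ)⁻¹ else 0) ^ 2 =
      D i j * D i j + if i = j then (Fintype.card ι : ℝ)⁻¹ ^ 2 - 2 * (Fintype.card ι : ℝ)⁻¹ * D i j
        else 0 := fun i j => by
    split_ifs <;> ring
  have hne : (Fintype.card ι : ℝ) ≠ 0 := by
    intro h0
    have : IsEmpty ι := Fintype.card_eq_zero_iff.1 (by exact_mod_cast h0)
    simp at htr
  simp only [h1, Finset.sum_add_distrib, Finset.sum_ite_eq, Finset.mem_univ, if_true,
    Finset.sum_sub_distrib, ← Finset.mul_sum, htr, Finset.sum_const, Finset.card_univ, nsmul_eq_mul]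
  field_simp
  ring

end

/-- Abbreviate G = ⟨w,g⟩, X = ⟨w,x⟩. The divergences are G + f, X + Kf, 2⟨Dw,x⟩ + KQ, (1 - K)G + X -
⟨Dw,x⟩, 2⟨Dw,g⟩ + Q and ⟨Dw,g⟩ - G + f(|D|² - 1). The coefficients are determined by cancelling all
terms except those with the factor f. -/
theorem IsSolution.isNull_traceless {Ω : Set (E n)} {ν : E n → E n} {c c₀ : ℝ} {f : E n → ℝ}
    {w : Fin (n + 1) → E n → ℝ} {D : Fin (n + 1) → Fin (n + 1) → E n → ℝ}
    (h : IsSolution Ω ν c c₀ f w D) (hΩ : IsAdmissible Ω) (hν : IsOuterNormalField Ω ν) :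
    IsNull Ω (fun x => f x * ∑ i, ∑ j, (D i j x -
      if i = j then (Fintype.card (Fin (n + 1)) : ℝ)⁻¹ else 0) ^ 2) := by
  have hb := hΩ.isBounded
  have hf := h.isMultiplier_f hb
  have hQ := h.isMultiplier_excess hb
  have hfc := fun U N (hU : IsCapChart Ω ν U N) => h.extPartial_f hb hU
  have hQc := fun U N (hU : IsCapChart Ω ν U N) => h.extPartial_excess hb hΩ.isOpen hU
  have d1 := h.isNull_mul_shift hΩ hν hf hfc
  have d2 := isNull_mul_coord hΩ hν hf hfc
  have d3 := isNull_mul_coord hΩ hν hQ hQc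
  have d4 := h.isNull_rotation hΩ hν
  have d5 := h.isNull_mul_shift hΩ hν hQ hQc
  have d6 := IsNull.sum Finset.univ fun i _ => IsNull.sum Finset.univ fun j _ =>
    h.isNull_hessian hΩ hν i j
  set K : ℝ := (Fintype.card (Fin (n + 1)) : ℝ) with hK
  have hK0 : K ≠ 0 := by simp [hK]; positivity
  refine (((((d6.add (d5.const_mul (-1 / 2))).add (d1.const_mul ((2 * K - 1) / K))).add
    (d3.const_mul (1 / (2 * K)))).add (d2.const_mul (-1 / K))).add
    (d4.const_mul (1 / K))).congr_ae ?_
  filter_upwards [h.laplacian, eventually_countable_forall.2 fun i =>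
    eventually_countable_forall.2 fun j => h.symm i j] with x htr hs
  have hL := fun (g : Fin (n + 1) → ℝ) => sum_grad_add_laplacian (D := fun i j => D i j x) htr g
    (fun i => shift c w i x)
  rw [sum_rotation hs htr, sum_hessian hs htr, hL, hL, sum_grad_add_card, sum_grad_add_card, sum_excess, sum_excess,
    sum_sub_diag_sq htr, ← hK]
  field_simp
  ring

/-! ### Vanishing of the gradient on level sets -/

/-- The left side is the probability of at most one success in m + 1 trials of probability s; the
induction conditions on one further trial. -/
theorem mul_mul_one_sub_pow_le_one {s : ℝ} (h0 : 0 ≤ s) (h1 : s ≤ 1) (m : ℕ) :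
    (m + 1) * s * (1 - s) ^ m + (1 - s) ^ (m + 1) ≤ 1 := by
  induction m with
  | zero => simp
  | succ m ih =>
    have hr : 0 ≤ 1 - s := by linarith
    have h2 : (1 - s) ^ (m + 1) ≤ 1 := pow_le_one₀ hr (by linarith)
    have h3 := mul_le_mul_of_nonneg_left ih hr
    have h4 := mul_le_mul_of_nonneg_left h2 h0
    have e : ((m + 1 : ℕ) + 1 : ℝ) * s * (1 - s) ^ (m + 1) + (1 - s) ^ (m + 1 + 1) =
        (1 - s) * ((m + 1) * s * (1 - s) ^ m + (1 - s) ^ (m + 1)) + s * (1 - s) ^ (m + 1) := by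
      push_cast
      ring
    rw [e]
    linarith

/-- The derivative of `t (1 - t²)^{m+1}`. -/
def spikeDeriv (m : ℕ) (t : ℝ) : ℝ := (1 - t ^ 2) ^ (m + 1) - 2 * (m + 1) * t ^ 2 * (1 - t ^ 2) ^ m

theorem abs_spikeDeriv_le {t : ℝ} (ht : |t| ≤ 1) (m : ℕ) : |spikeDeriv m t| ≤ 2 := by
  have hs : t ^ 2 ≤ 1 := (sq_le_one_iff_abs_le_one t).2 ht
  have h := mul_mul_one_sub_pow_le_one (sq_nonneg t) hs m
  have h1 : 0 ≤ (1 - t ^ 2) ^ (m + 1) := pow_nonneg (by linarith) _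
  have h2 : 0 ≤ (m + 1) * t ^ 2 * (1 - t ^ 2) ^ m :=
    mul_nonneg (by positivity) (pow_nonneg (by linarith) _)
  rw [spikeDeriv, abs_le]
  constructor <;> nlinarith

theorem tendsto_spikeDeriv {t : ℝ} (ht : |t| ≤ 1) :
    Tendsto (fun m => spikeDeriv m t) atTop (𝓝 (if t = 0 then 1 else 0)) := by
  by_cases h0 : t = 0
  · subst h0
    simp [spikeDeriv]
  have hs : t ^ 2 ≤ 1 := (sq_le_one_iff_abs_le_one t).2 ht
  have hpos : 0 < t ^ 2 := by positivity
  have h1 : Tendsto (fun m : ℕ => (1 - t ^ 2) ^ m) atTop (𝓝 0) :=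
    tendsto_pow_atTop_nhds_zero_of_lt_one (by linarith) (by linarith)
  have h2 : Tendsto (fun m : ℕ => (m : ℝ) * (1 - t ^ 2) ^ m) atTop (𝓝 0) :=
    tendsto_self_mul_const_pow_of_lt_one (by linarith) (by linarith)
  have h3 := ((h1.const_mul (1 - t ^ 2)).sub ((h2.add h1).const_mul (2 * t ^ 2)))
  simp only [mul_zero, add_zero, sub_zero] at h3
  rw [if_neg h0]
  refine h3.congr fun m => ?_
  rw [spikeDeriv]
  ring

theorem tendsto_spike {t : ℝ} (ht : |t| ≤ 1) :
    Tendsto (fun m : ℕ => t * (1 - t ^ 2) ^ (m + 1)) atTop (𝓝 0) := by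
  by_cases h0 : t = 0
  · simp [h0]
  have hs : t ^ 2 ≤ 1 := (sq_le_one_iff_abs_le_one t).2 ht
  have hpos : 0 < t ^ 2 := by positivity
  have h1 : Tendsto (fun m : ℕ => (1 - t ^ 2) ^ m) atTop (𝓝 0) :=
    tendsto_pow_atTop_nhds_zero_of_lt_one (by linarith) (by linarith)
  simpa using ((tendsto_add_atTop_iff_nat 1).2 h1).const_mul t

section

variable {Ω : Set (E n)} {v : E n → ℝ} {v' : Fin (n + 1) → E n → ℝ}

theorem IsMultiplier.pow (h : IsMultiplier Ω v v') (m : ℕ) :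
    IsMultiplier Ω (fun x => v x ^ (m + 1)) (fun i x => (m + 1) * v x ^ m * v' i x) := by
  induction m with
  | zero => exact h.congr (fun x => by simp) fun i x => by simp
  | succ m ih =>
    exact (ih.mul_mul h).congr (fun x => by ring) fun i x => by push_cast; ring

/-- Polynomials in v are at hand because multipliers form an algebra; compositions with general
functions are not. -/
theorem IsMultiplier.spike (hb : Bornology.IsBounded Ω) (h : IsMultiplier Ω v v') (m : ℕ) :
    IsMultiplier Ω (fun x => v x * (1 - v x ^ 2) ^ (m + 1))
      (fun i x => spikeDeriv m (v x) * v' i x) := by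
  have h1 := (isMultiplier_const hb 1).add hb ((isMultiplier_const hb (-1)).mul_mul (h.pow 1))
  have h2 : IsMultiplier Ω (fun x => 1 - v x ^ 2) (fun i x => -(2 * v x * v' i x)) :=
    h1.congr (fun x => by ring) fun i x => by push_cast; ring
  refine (h.mul_mul (h2.pow m)).congr (fun x => rfl) fun i x => ?_
  rw [spikeDeriv]
  ring

/-- The polynomials v(1 - v²)^{m+1} tend to 0 boundedly, while their gradients tend dominatedly to
v' on {v = 0} and to 0 elsewhere. The weak gradient of the limit 0 is 0. -/
theorem IsMultiplier.ae_eq_zero_of_abs_le (hb : Bornology.IsBounded Ω) (hΩ : IsOpen Ω)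
    (h : IsMultiplier Ω v v') (hv : ∀ᵐ x ∂(volume.restrict Ω), |v x| ≤ 1) (i : Fin (n + 1)) :
    ∀ᵐ x ∂(volume.restrict Ω), v x = 0 → v' i x = 0 := by
  have hfin : IsFiniteMeasure (volume.restrict Ω) :=
    ⟨by rw [Measure.restrict_apply_univ]; exact hb.measure_lt_top⟩
  have hm := h.spike hb
  set k : E n → ℝ := fun x => (if v x = 0 then 1 else 0) * v' i x with hk
  have hlim : ∀ᵐ x ∂(volume.restrict Ω),
      Tendsto (fun m => spikeDeriv m (v x) * v' i x) atTop (𝓝 (k x)) := by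
    filter_upwards [hv] with x hx using (tendsto_spikeDeriv hx).mul_const _
  have hkm : AEStronglyMeasurable k (volume.restrict Ω) :=
    aestronglyMeasurable_of_tendsto_ae atTop (fun m => ((hm m).memLp i).1) hlim
  have hv'1 : Integrable (v' i) (volume.restrict Ω) := (h.memLp i).integrable one_le_two
  have hk1 : Integrable k (volume.restrict Ω) := by
    refine hv'1.mono hkm (.of_forall fun x => ?_)
    simp only [hk]
    split_ifs <;> simp
  have hz : k =ᵐ[volume.restrict Ω] fun _ => 0 := by
    refine ae_eq_of_forall_test hΩ (IntegrableOn.locallyIntegrableOn hk1)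
      (IntegrableOn.locallyIntegrableOn (integrable_zero _ _ _)) fun φ hφ => ?_
    have e : ∀ m, ∫ x in Ω, (v x * (1 - v x ^ 2) ^ (m + 1)) * pderiv i φ x =
        -∫ x in Ω, (spikeDeriv m (v x) * v' i x) * φ x := fun m =>
      ((hm m).extPartial (extPartial_one_interior hb i)).ibp φ hφ
    have hφ1 := (hφ.pderiv i).integrable (volume.restrict Ω)
    have l1 : Tendsto (fun m => ∫ x in Ω, (v x * (1 - v x ^ 2) ^ (m + 1)) * pderiv i φ x) atTop
        (𝓝 (∫ x in Ω, 0 * pderiv i φ x)) := by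
      refine tendsto_integral_of_dominated_convergence (fun x => ‖pderiv i φ x‖)
        (fun m => (hm m).bdd.1.mul hφ1.1) hφ1.norm (fun m => ?_) ?_
      · filter_upwards [hv] with x hx
        have hs : v x ^ 2 ≤ 1 := (sq_le_one_iff_abs_le_one _).2 hx
        rw [norm_mul]
        refine mul_le_of_le_one_left (norm_nonneg _) ?_
        rw [Real.norm_eq_abs, abs_mul, abs_pow]
        refine mul_le_one₀ hx (by positivity) (pow_le_one₀ (abs_nonneg _) ?_)
        rw [abs_le]
        constructor <;> nlinarith [sq_nonneg (v x)]
      · filter_upwards [hv] with x hx using (tendsto_spike hx).mul_const _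
    have l2 : Tendsto (fun m => ∫ x in Ω, (spikeDeriv m (v x) * v' i x) * φ x) atTop
        (𝓝 (∫ x in Ω, k x * φ x)) := by
      refine tendsto_integral_of_dominated_convergence (fun x => 2 * ‖v' i x * φ x‖)
        (fun m => ((hm m).memLp i).1.mul (hφ.integrable _).1)
        (((h.memLp i).integrable_mul_fun (hφ.memLp 2 _)).norm.const_mul 2) (fun m => ?_) ?_
      · filter_upwards [hv] with x hx
        rw [mul_assoc, norm_mul]
        exact mul_le_mul_of_nonneg_right (abs_spikeDeriv_le hx m) (norm_nonneg _)
      · filter_upwards [hlim] with x hx using hx.mul_const _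
    simp only [e, zero_mul, integral_zero] at l1 ⊢
    simpa using tendsto_nhds_unique l2 (by simpa using l1.neg)
  filter_upwards [hz] with x hx hvx
  simpa [hk, hvx] using hx

theorem IsMultiplier.ae_eq_zero (hb : Bornology.IsBounded Ω) (hΩ : IsOpen Ω)
    (h : IsMultiplier Ω v v') (i : Fin (n + 1)) :
    ∀ᵐ x ∂(volume.restrict Ω), v x = 0 → v' i x = 0 := by
  obtain ⟨M, hM⟩ : ∃ M : ℝ, ∀ᵐ x ∂(volume.restrict Ω), |v x| ≤ M := by
    refine ⟨(eLpNormEssSup v (volume.restrict Ω)).toReal, ?_⟩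
    have hlt : eLpNormEssSup v (volume.restrict Ω) ≠ ⊤ := by
      have := h.bdd.2.ne
      rwa [eLpNorm_exponent_top] at this
    filter_upwards [enorm_ae_le_eLpNormEssSup v (volume.restrict Ω)] with x hx
    have := ENNReal.toReal_mono hlt hx
    simpa using this
  set a : ℝ := (|M| + 1)⁻¹ with ha
  have hpos : 0 < |M| + 1 := by positivity
  have h1 := ((isMultiplier_const hb a).mul_mul h).ae_eq_zero_of_abs_le hb hΩ (by
    filter_upwards [hM] with x hx
    rw [abs_mul, ha, abs_of_pos (inv_pos.2 hpos), inv_mul_le_iff₀ hpos]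
    linarith [le_abs_self M]) i
  filter_upwards [h1] with x hx hvx
  have := hx (by rw [hvx, mul_zero])
  simpa [ha, hpos.ne'] using this

end

/-- By the sign of f the integrand of `isNull_traceless` vanishes a.e. Where f = 0, the gradient and
then the Hessian vanish a.e., against tr D = 1, so one may divide by f. -/
theorem IsSolution.hessian_eq {Ω : Set (E n)} {ν : E n → E n} {c c₀ : ℝ} {f : E n → ℝ}
    {w : Fin (n + 1) → E n → ℝ} {D : Fin (n + 1) → Fin (n + 1) → E n → ℝ}
    (h : IsSolution Ω ν c c₀ f w D) (hΩ : IsAdmissible Ω) (hν : IsOuterNormalField Ω ν)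
    (hneg : ∀ᵐ x ∂(volume.restrict Ω), f x ≤ 0) :
    ∀ᵐ x ∂(volume.restrict Ω), ∀ i j, D i j x = if i = j then ((n : ℝ) + 1)⁻¹ else 0 := by
  have hb := hΩ.isBounded
  have hnull := h.isNull_traceless hΩ hν
  set S : E n → ℝ := fun x => ∑ i, ∑ j, (D i j x -
      if i = j then (Fintype.card (Fin (n + 1)) : ℝ)⁻¹ else 0) ^ 2 with hS
  have hS0 : ∀ x, 0 ≤ S x := fun x =>
    Finset.sum_nonneg fun i _ => Finset.sum_nonneg fun j _ => sq_nonneg _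
  have hfS : ∀ᵐ x ∂(volume.restrict Ω), f x * S x = 0 := by
    have h1 := hnull.const_mul (-1)
    have h2 := (integral_eq_zero_iff_of_nonneg_ae (by
      filter_upwards [hneg] with x hx
      change 0 ≤ -1 * (f x * S x)
      nlinarith [hS0 x]) h1.1).1 h1.2
    filter_upwards [h2] with x hx
    have : -1 * (f x * S x) = 0 := hx
    linarith
  filter_upwards [hfS, h.laplacian, eventually_countable_forall.2 fun i =>
    (h.isMultiplier_f hb).ae_eq_zero hb hΩ.isOpen i, eventually_countable_forall.2 fun i =>
    (h.isMultiplier_w hb i).ae_eq_zero hb hΩ.isOpen i] with x hx htr hfw hwD i j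
  have hf : f x ≠ 0 := fun hf => by
    rw [Finset.sum_eq_zero fun i _ => hwD i (hfw i hf)] at htr
    exact zero_ne_one htr
  have hSx : S x = 0 := (mul_eq_zero.1 hx).resolve_left hf
  have h1 := (Finset.sum_eq_zero_iff_of_nonneg fun i _ =>
    Finset.sum_nonneg fun j _ => sq_nonneg _).1 hSx i (Finset.mem_univ i)
  have h2 := (Finset.sum_eq_zero_iff_of_nonneg fun j _ => sq_nonneg _).1 h1 j (Finset.mem_univ j)
  have h3 := sub_eq_zero.1 (pow_eq_zero_iff two_ne_zero |>.1 h2)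
  rw [h3]
  simp

/-! ### Functions with vanishing weak gradient -/

/-- Mollifications of v have zero gradient on a ball of half the available radius, hence are
constant there, and they converge to v a.e. The test function may cross ∂Ω, so the lemma also
applies to indicator functions. -/
theorem exists_ae_eq_const_ball {O : Set (E n)} (hO : IsOpen O) {v : E n → ℝ}
    (hv : LocallyIntegrable v) (h : ∀ ψ, IsTest O ψ → ∀ i, ∫ x, v x * pderiv i ψ x = 0)
    {x₀ : E n} (hx₀ : x₀ ∈ O) :
    ∃ r > 0, ∃ a, ∀ᵐ x, x ∈ Metric.ball x₀ r → v x = a := by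
  obtain ⟨R, hR, hball⟩ := Metric.isOpen_iff.1 hO x₀ hx₀
  set r := R / 2 with hr
  have hr0 : 0 < r := by positivity
  let L := (ContinuousLinearMap.lsmul ℝ ℝ : ℝ →L[ℝ] ℝ →L[ℝ] ℝ).flip
  -- The fixed ratio 2 of the radii is what the a.e. convergence of mollifications asks for; k + 2
  -- keeps the outer radius below r.
  let φ : ℕ → ContDiffBump (0 : E n) := fun k =>
    ⟨r / (2 * (k + 2)), r / (k + 2), by positivity, by
      rw [div_lt_div_iff₀ (by positivity) (by positivity)]
      nlinarith [show (0 : ℝ) ≤ k from k.cast_nonneg]⟩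
  have hφr : ∀ k, (φ k).rOut < r := fun k => by
    change r / (k + 2) < r
    rw [div_lt_iff₀ (by positivity)]
    nlinarith [show (0 : ℝ) ≤ k from k.cast_nonneg]
  have hφ0 : Tendsto (fun k => (φ k).rOut) atTop (𝓝 0) := by
    have : Tendsto (fun k : ℕ => r / ((k + 2 : ℕ) : ℝ)) atTop (𝓝 0) :=
      (tendsto_const_div_atTop_nhds_zero_nat r).comp (tendsto_add_atTop_nat 2)
    refine this.congr fun k => ?_
    change _ = r / (k + 2)
    push_cast
    rfl
  have hae := ContDiffBump.ae_convolution_tendsto_right_of_locallyIntegrable (K := 2) hφ0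
    (.of_forall fun k => by
      change r / (k + 2) ≤ 2 * (r / (2 * (k + 2)))
      apply le_of_eq
      field_simp) hv
  set F : ℕ → E n → ℝ := fun k =>
    MeasureTheory.convolution ((φ k).normed volume) v (ContinuousLinearMap.lsmul ℝ ℝ) volume with hF
  have hconst : ∀ k, ∀ y ∈ Metric.ball x₀ r, F k y = F k x₀ := by
    intro k
    set g := (φ k).normed (volume : Measure (E n)) with hg
    have hgc : HasCompactSupport g := (φ k).hasCompactSupport_normed
    have hgs : ContDiff ℝ ∞ g := (φ k).contDiff_normed
    have hFL : F k = MeasureTheory.convolution v g L volume := (convolution_flip _).symm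
    have hder : ∀ y, HasFDerivAt (F k)
        ((MeasureTheory.convolution v (fderiv ℝ g) (L.precompR (E n)) volume) y) y := fun y => by
      rw [hFL]
      exact hgc.hasFDerivAt_convolution_right L hv (hgs.of_le (by simp)) y
    have hzero : ∀ y ∈ Metric.ball x₀ r, fderiv ℝ (F k) y = 0 := by
      intro y hy
      have hpd : ∀ i, pderiv i (F k) y = 0 := by
        intro i
        rw [pderiv, (hder y).fderiv, convolution_precompR_apply L hv (hgc.fderiv ℝ)
          (hgs.continuous_fderiv (by simp))]
        have ht : IsTest O (fun t => g (y - t)) := by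
          refine ⟨hgs.comp (contDiff_const.sub contDiff_id), ?_, ?_⟩
          · exact hgc.comp_homeomorph (Homeomorph.subLeft y)
          · intro t ht
            have h1 : t ∈ (fun t => y - t) ⁻¹' tsupport g :=
              tsupport_comp_subset_preimage g (f := fun t => y - t) (by fun_prop) ht
            rw [hg, Set.mem_preimage, (φ k).tsupport_normed_eq, mem_closedBall_zero_iff] at h1
            refine hball ?_
            rw [Metric.mem_ball] at hy ⊢
            calc dist t x₀ ≤ dist t y + dist y x₀ := dist_triangle _ _ _
              _ < r + r := by
                rw [dist_comm t y, dist_eq_norm]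
                linarith [hφr k]
              _ = R := by rw [hr]; ring
        have h0 := h _ ht i
        have hp : ∀ t, pderiv i (fun t => g (y - t)) t = -pderiv i g (y - t) := fun t => by
          have h1 : HasFDerivAt (fun t : E n => y - t) (-ContinuousLinearMap.id ℝ (E n)) t := by
            simpa using (hasFDerivAt_id t).const_sub y
          have h2 := (hgs.diffAt (y - t)).hasFDerivAt.comp t h1
          rw [pderiv, show (fun t => g (y - t)) = g ∘ fun t => y - t from rfl, h2.fderiv]
          simp [pderiv]
        simp only [hp, mul_neg, integral_neg, neg_eq_zero] at h0
        rw [← h0, MeasureTheory.convolution]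
        refine integral_congr_ae (.of_forall fun t => ?_)
        simp [L, pderiv, mul_comm]
      ext z
      rw [fderiv_eq_sum]
      simp [hpd]
    exact fun y hy => Metric.isOpen_ball.is_const_of_fderiv_eq_zero (𝕜 := ℝ)
      (convex_ball x₀ r).isPreconnected (fun z _ => (hder z).differentiableAt.differentiableWithinAt)
      hzero hy (Metric.mem_ball_self hr0)
  obtain ⟨y, hyb, hy⟩ : ∃ y ∈ Metric.ball x₀ r, Tendsto (fun k => F k y) atTop (𝓝 (v y)) := by
    by_contra! hcon
    have hnull : volume (Metric.ball x₀ r) = 0 :=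
      measure_mono_null (fun y hy => hcon y hy) (ae_iff.1 hae)
    exact (Metric.measure_ball_pos volume x₀ hr0).ne' hnull
  refine ⟨r, hr0, v y, ?_⟩
  filter_upwards [hae] with x hx hxb
  refine tendsto_nhds_unique hx (hy.congr fun k => ?_)
  rw [hconst k y hyb, ← hconst k x hxb]

theorem exists_ae_eq_const {Ω : Set (E n)} (hΩ : IsOpen Ω) (hc : IsConnected Ω)
    (hb : Bornology.IsBounded Ω) {u : E n → ℝ}
    (h : ∀ i, ExtPartial Ω Ω i u (fun _ => 0)) : ∃ a, ∀ᵐ x ∂(volume.restrict Ω), u x = a := by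
  have hfin : IsFiniteMeasure (volume.restrict Ω) :=
    ⟨by rw [Measure.restrict_apply_univ]; exact hb.measure_lt_top⟩
  set v := Ω.indicator u with hv
  have hvi : LocallyIntegrable v := by
    have : IntegrableOn u Ω := (memLp_two_of_top hb (h 0).bdd).integrable one_le_two
    exact (this.integrable_indicator hΩ.measurableSet).locallyIntegrable
  have hloc : ∀ x ∈ Ω, ∃ r > 0, ∃ a, ∀ᵐ y, y ∈ Metric.ball x r → v y = a := fun x hx => by
    refine exists_ae_eq_const_ball hΩ hvi (fun ψ hψ i => ?_) hx
    have h0 := (h i).ibp ψ hψ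
    simp only [zero_mul, integral_zero, neg_zero] at h0
    rw [← h0, ← integral_indicator hΩ.measurableSet]
    refine integral_congr_ae (.of_forall fun y => ?_)
    by_cases hy : y ∈ Ω <;> simp [hv, hy]
  obtain ⟨x₀, hx₀⟩ := hc.nonempty
  obtain ⟨r₀, hr₀, a, ha⟩ := hloc x₀ hx₀
  set A : Set (E n) := {x | ∃ r > 0, ∀ᵐ y, y ∈ Metric.ball x r → v y = a} with hA
  have hmono : ∀ {x y : E n} {r b : ℝ}, y ∈ Metric.ball x r →
      (∀ᵐ z, z ∈ Metric.ball x r → v z = b) →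
      ∃ s > 0, ∀ᵐ z, z ∈ Metric.ball y s → v z = b := by
    intro x y r b hy h
    obtain ⟨s, hs, hsub⟩ := Metric.isOpen_iff.1 Metric.isOpen_ball y hy
    exact ⟨s, hs, h.mono fun z hz hzs => hz (hsub hzs)⟩
  have hAo : IsOpen A := by
    rw [Metric.isOpen_iff]
    rintro x ⟨r, hr, hx⟩
    exact ⟨r, hr, fun y hy => hmono hy hx⟩
  have hsub : Ω ⊆ A := by
    refine hc.isPreconnected.subset_of_closure_inter_subset hAo ⟨x₀, hx₀, r₀, hr₀, ha⟩ ?_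
    rintro x ⟨hxA, hxΩ⟩
    obtain ⟨r, hr, b, hb⟩ := hloc x hxΩ
    obtain ⟨y, hyA, hyx⟩ := Metric.mem_closure_iff.1 hxA r hr
    rw [dist_comm] at hyx
    obtain ⟨s, hs, hys⟩ := hyA
    obtain ⟨t, ht, hyt⟩ := hmono (Metric.mem_ball.2 hyx) hb
    have hab : a = b := by
      obtain ⟨z, hz⟩ : ∃ z ∈ Metric.ball y (min s t), (z ∈ Metric.ball y s → v z = a) ∧
          (z ∈ Metric.ball y t → v z = b) := by
        by_contra! hcon
        refine (Metric.measure_ball_pos volume y (lt_min hs ht)).ne'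
          (measure_mono_null (fun z hz => ?_) (ae_iff.1 (hys.and hyt)))
        exact fun hh => (hcon z hz hh.1).2 (hh.2 (hcon z hz hh.1).1)
      rw [← hz.2.1 (Metric.ball_subset_ball (min_le_left _ _) hz.1),
        hz.2.2 (Metric.ball_subset_ball (min_le_right _ _) hz.1)]
    exact ⟨r, hr, hab ▸ hb⟩
  refine ⟨a, ?_⟩
  rw [ae_restrict_iff' hΩ.measurableSet, ae_iff]
  refine measure_null_of_locally_null _ fun x hx => ?_
  rw [Set.mem_ofPred_eq, Classical.not_imp] at hx
  obtain ⟨r, hr, hxr⟩ := hsub hx.1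
  refine ⟨_, inter_mem_nhdsWithin _ (Metric.ball_mem_nhds x hr), ?_⟩
  refine measure_mono_null (fun y hy => ?_) (ae_iff.1 hxr)
  obtain ⟨hy1, hy2⟩ := hy
  rw [Set.mem_ofPred_eq, Classical.not_imp] at hy1
  intro hcon
  exact hy1.2 (by rw [← hcon hy2, hv, Set.indicator_of_mem hy1.1])

/-- Two integrations of D = I/K on the connected set Ω: first w_i - x_i/K is constant, which defines
z, then f - |x - z|²/(2K) is constant. -/
theorem IsSolution.exists_quadratic {Ω : Set (E n)} {ν : E n → E n} {c c₀ : ℝ} {f : E n → ℝ}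
    {w : Fin (n + 1) → E n → ℝ} {D : Fin (n + 1) → Fin (n + 1) → E n → ℝ}
    (h : IsSolution Ω ν c c₀ f w D) (hΩ : IsAdmissible Ω) (hν : IsOuterNormalField Ω ν)
    (hneg : ∀ᵐ x ∂(volume.restrict Ω), f x ≤ 0) :
    ∃ (z : E n) (b : ℝ), (∀ᵐ x ∂(volume.restrict Ω), f x =
        (∑ i, (x i - z i) * (x i - z i)) / (2 * ((n : ℝ) + 1)) + b) ∧
      ∀ i, ∀ᵐ x ∂(volume.restrict Ω), w i x = (x i - z i) / ((n : ℝ) + 1) := by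
  have hb := hΩ.isBounded
  have hD := h.hessian_eq hΩ hν hneg
  set K : ℝ := (n : ℝ) + 1 with hK
  have hK0 : K ≠ 0 := by positivity
  have hone := fun i => extPartial_one_interior (Ω := Ω) hb i
  have hw : ∀ i, ∃ a, ∀ᵐ x ∂(volume.restrict Ω), w i x + -K⁻¹ * x i = a := fun i => by
    refine exists_ae_eq_const hΩ.isOpen hΩ.isConnected hb fun k => ?_
    refine (((h.isMultiplier_w hb i).add hb ((isMultiplier_const hb (-K⁻¹)).mul_mul
      (isMultiplier_coord hb i))).extPartial (hone k)).congr_ae .rfl ?_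
    filter_upwards [hD] with x hx
    rw [hx i k]
    by_cases hik : i = k
    · simp [hik]
    · simp [hik, Ne.symm hik]
  choose a ha using hw
  set z : E n := WithLp.toLp 2 fun i => -(K * a i) with hz
  have hwz : ∀ i, ∀ᵐ x ∂(volume.restrict Ω), w i x = (x i - z i) / K := fun i => by
    filter_upwards [ha i] with x hx
    have : z i = -(K * a i) := rfl
    rw [this, ← hx]
    field_simp
    ring
  have hxz : ∀ i, IsMultiplier Ω (fun x => x i - z i) (fun k _ => if k = i then 1 else 0) :=
    fun i => ((isMultiplier_coord hb i).add hb (isMultiplier_const hb (-z i))).congr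
      (fun x => by ring) fun k x => by ring
  obtain ⟨b, hb'⟩ : ∃ b, ∀ᵐ x ∂(volume.restrict Ω),
      f x + -(2 * K)⁻¹ * ∑ i, (x i - z i) * (x i - z i) = b := by
    refine exists_ae_eq_const hΩ.isOpen hΩ.isConnected hb fun k => ?_
    refine (((h.isMultiplier_f hb).add hb ((isMultiplier_const hb (-(2 * K)⁻¹)).mul_mul
      (IsMultiplier.sum hb Finset.univ fun i _ => (hxz i).mul_mul (hxz i)))).extPartial
      (hone k)).congr_ae .rfl ?_
    filter_upwards [hwz k] with x hx
    rw [hx]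
    simp [Finset.sum_add_distrib]
    field_simp
    ring
  refine ⟨z, b, ?_, hwz⟩
  filter_upwards [hb'] with x hx
  rw [← hx]
  field_simp
  ring

/-- A smooth function with no flux through the boundary vanishes there. -/
theorem IsBoundaryChart.eq_zero_of_extPartial {Ω U : Set (E n)} (hΩ : IsOpen Ω)
    (hb : Bornology.IsBounded Ω) {N : Fin (n + 1) → E n → ℝ} (hU : IsBoundaryChart Ω U N)
    {F : E n → ℝ} (hF : ContDiff ℝ ∞ F) (h : ∀ k, ExtPartial Ω U k F (pderiv k F)) {x₀ : E n}
    (hx : x₀ ∈ U) (hxf : x₀ ∈ frontier Ω) : F x₀ = 0 := by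
  by_contra hne
  have hVo : IsOpen {y | F y ≠ 0} := isOpen_ne_fun hF.continuous continuous_const
  -- Dividing by F near x₀ would make the constant 1 free of flux there. The indicator function of Ω
  -- would then be a.e. constant near x₀, although both Ω and the interior of its complement
  -- accumulate at x₀.
  obtain ⟨m, hm, hmF⟩ := exists_contDiff_extension hVo hne (h := fun y => (F y)⁻¹)
    fun y hy => (hF.contDiffAt.inv hy).contDiffWithinAt
  obtain ⟨V, hVsub, hVo', hxV⟩ := mem_nhds_iff.1
    ((hmF.and (hVo.mem_nhds hne)).and (hU.isOpen.mem_nhds hx))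
  have hFm : ∀ y ∈ V, F y * m y = 1 := fun y hy => by
    obtain ⟨⟨h1, h2⟩, -⟩ := hVsub hy
    rw [h1, mul_inv_cancel₀ h2]
  have hone : ∀ k, ExtPartial Ω V k (fun _ => 1) (fun _ => 0) := fun k => by
    refine (((isMultiplier_of_contDiff hb hm).mul _ _ _ _ (h k)).mono
      fun y hy => (hVsub hy).2).congr_on (memLp_of_continuous hb continuous_const _)
      MemLp.zero' hFm fun y hy => ?_
    have e : (fun y => F y * m y) =ᶠ[𝓝 y] fun _ => 1 := by
      filter_upwards [hVo'.mem_nhds hy] with z hz using hFm z hz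
    rw [← pderiv_mul hF hm, pderiv_eq_of_eventuallyEq e, pderiv_const]
  have hvi : LocallyIntegrable (Ω.indicator fun _ => (1 : ℝ)) := by
    have : IntegrableOn (fun _ : E n => (1 : ℝ)) Ω := integrableOn_const hb.measure_lt_top.ne
    exact (this.integrable_indicator hΩ.measurableSet).locallyIntegrable
  obtain ⟨r, hr, a, ha⟩ := exists_ae_eq_const_ball hVo' hvi (fun ψ hψ i => by
    have h0 := (hone i).ibp ψ hψ
    simp only [zero_mul, integral_zero, neg_zero] at h0
    rw [← h0, ← integral_indicator hΩ.measurableSet]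
    refine integral_congr_ae (.of_forall fun y => ?_)
    by_cases hy : y ∈ Ω <;> simp [hy]) hxV
  have hopen : ∀ G : Set (E n), IsOpen G → x₀ ∈ closure G →
      ∃ y ∈ G, (Ω.indicator fun _ => (1 : ℝ)) y = a := fun G hG hGx => by
    obtain ⟨p, hpG, hp⟩ := Metric.mem_closure_iff.1 hGx r hr
    rw [dist_comm] at hp
    by_contra! hcon
    refine ((hG.inter Metric.isOpen_ball).measure_pos volume ⟨p, hpG, hp⟩).ne'
      (measure_mono_null (fun y hy => ?_) (ae_iff.1 ha))
    exact fun hh => hcon y hy.1 (hh hy.2)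
  obtain ⟨y, hy, hya⟩ := hopen Ω hΩ (frontier_subset_closure hxf)
  obtain ⟨p, hp, hpa⟩ := hopen _ isOpen_interior (hU.exterior x₀ hx hxf)
  rw [Set.indicator_of_mem hy] at hya
  rw [Set.indicator_of_notMem (interior_subset hp)] at hpa
  exact one_ne_zero (hya.trans hpa.symm)

/-! ### Spherical caps -/

theorem sum_sub_mul_self (x z : E n) : ∑ i, (x i - z i) * (x i - z i) = ‖x - z‖ ^ 2 := by
  rw [EuclideanSpace.real_norm_sq_eq]
  exact Finset.sum_congr rfl fun i _ => by rw [PiLp.sub_apply, sq]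

theorem contDiff_coord_sub (z : E n) (i : Fin (n + 1)) :
    ContDiff ℝ ∞ fun x : E n => x i - z i := (contDiff_coord i).sub contDiff_const

theorem contDiff_sum_sub_mul_self (z : E n) :
    ContDiff ℝ ∞ fun x : E n => ∑ i, (x i - z i) * (x i - z i) :=
  ContDiff.sum fun i _ => (contDiff_coord_sub z i).mul (contDiff_coord_sub z i)

theorem pderiv_coord_sub (z : E n) (k i : Fin (n + 1)) (x : E n) :
    pderiv k (fun y : E n => y i - z i) x = if k = i then 1 else 0 := by
  rw [pderiv_sub (contDiff_coord i) contDiff_const, pderiv_coord, pderiv_const, sub_zero]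

theorem pderiv_sum_sub_mul_self (z : E n) (k : Fin (n + 1)) (x : E n) :
    pderiv k (fun y : E n => ∑ i, (y i - z i) * (y i - z i)) x = 2 * (x k - z k) := by
  have hs := contDiff_coord_sub z
  rw [pderiv_sum _ fun i _ => (hs i).mul (hs i)]
  simp only [pderiv_mul (hs _) (hs _), pderiv_coord_sub]
  simp [Finset.sum_add_distrib]
  ring

theorem norm_e : ‖e n‖ = 1 := by simp [e]

theorem inner_e (x : E n) : inner ℝ x (e n) = x (Fin.last n) := by
  simp [e, EuclideanSpace.inner_single_right]

theorem e_last : (e n) (Fin.last n) = 1 := by simp [e]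

/-- The trace conditions f = 0 and w = c₀N, known only in the weak sense, become pointwise
identities on Σ because f and w now coincide a.e. with smooth functions, and a smooth function
without flux vanishes on the frontier. -/
theorem IsSolution.sub_eq_of_mem_frontier {Ω : Set (E n)} {ν : E n → E n} {c c₀ : ℝ} {f : E n → ℝ}
    {w : Fin (n + 1) → E n → ℝ} {D : Fin (n + 1) → Fin (n + 1) → E n → ℝ}
    (h : IsSolution Ω ν c c₀ f w D) (hΩ : IsAdmissible Ω) (hν : IsOuterNormalField Ω ν)
    {z : E n} {b : ℝ} (hf : ∀ᵐ x ∂(volume.restrict Ω), f x =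
        (∑ i, (x i - z i) * (x i - z i)) / (2 * ((n : ℝ) + 1)) + b)
    (hw : ∀ i, ∀ᵐ x ∂(volume.restrict Ω), w i x = (x i - z i) / ((n : ℝ) + 1))
    {x : E n} (hx : x ∈ frontier Ω ∩ upper n) :
    x - z = (((n : ℝ) + 1) * c₀) • ν x ∧ ‖x - z‖ ^ 2 / (2 * ((n : ℝ) + 1)) + b = 0 := by
  have hb := hΩ.isBounded
  set K : ℝ := (n : ℝ) + 1 with hK
  have hK0 : K ≠ 0 := by positivity
  obtain ⟨U, N, hxU, -, hU⟩ := hΩ.exists_isCapChart hν hx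
  have hs := contDiff_coord_sub z
  constructor
  · have hzero : ∀ i, (fun y : E n => K⁻¹ * (y i - z i) - c₀ * N i y) x = 0 := fun i => by
      have hF : ContDiff ℝ ∞ fun y : E n => K⁻¹ * (y i - z i) - c₀ * N i y :=
        (contDiff_const.mul (hs i)).sub (contDiff_const.mul (hU.smooth i))
      refine hU.eq_zero_of_extPartial hΩ.isOpen hb hF (fun k => ?_) hxU hx.1
      have h1 := (h.isFluxEq_w hb hΩ.isOpen hU i).sub k
      have hval : (fun y => w i y - c₀ * N i y) =ᵐ[volume.restrict Ω]
          fun y => K⁻¹ * (y i - z i) - c₀ * N i y := by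
        filter_upwards [hw i] with y hy
        rw [hy]
        ring
      refine h1.congr_ae hval ?_
      have h2 := ((h.isMultiplier_w hb i).extPartial (extPartial_one_interior hb k))
      have h3 := (isMultiplier_of_contDiff hb ((contDiff_const (c := K⁻¹)).mul (hs i))).extPartial
        (extPartial_one_interior hb k)
      have h4 := (h2.congr_ae (v := fun y => K⁻¹ * (y i - z i)) (by
        filter_upwards [hw i] with y hy
        rw [hy]
        ring) .rfl).ae_unique hb hΩ.isOpen h3
      filter_upwards [h4] with y hy
      rw [hy, pderiv_sub (contDiff_const.mul (hs i)) (contDiff_const.mul (hU.smooth i)),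
        pderiv_mul (contDiff_const (c := c₀)) (hU.smooth i), pderiv_const]
      ring
    ext i
    have h0 := hzero i
    rw [PiLp.smul_apply, hU.nu x ⟨hx.1, hxU⟩ i, PiLp.sub_apply, smul_eq_mul]
    simp only at h0
    have : x i - z i = K * (K⁻¹ * (x i - z i)) := by field_simp
    rw [this, sub_eq_zero.1 h0]
    ring
  · have hsq := contDiff_sum_sub_mul_self z
    have hF : ContDiff ℝ ∞ fun y : E n =>
        (2 * K)⁻¹ * (∑ i, (y i - z i) * (y i - z i)) + b :=
      (contDiff_const.mul hsq).add contDiff_const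
    have hzero := hU.eq_zero_of_extPartial hΩ.isOpen hb hF (fun k => ?_) hxU hx.1
    · rw [← sum_sub_mul_self, div_eq_inv_mul]
      exact hzero
    · refine (h.extPartial_f hb hU k).congr_ae ?_ ?_
      · filter_upwards [hf] with y hy
        rw [hy, div_eq_inv_mul]
      · filter_upwards [hw k] with y hy
        rw [hy, pderiv_add (contDiff_const.mul hsq) contDiff_const,
          pderiv_mul contDiff_const hsq, pderiv_sum_sub_mul_self, pderiv_const, pderiv_const]
        field_simp
        ring

theorem IsAdmissible.nonempty_frontier_upper {Ω : Set (E n)} (hΩ : IsAdmissible Ω) :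
    (frontier Ω ∩ upper n).Nonempty := by
  obtain ⟨x, hx⟩ := hΩ.corner_nonempty
  exact closure_nonempty_iff.1 ⟨x, hx.1⟩

/-- The centre and the radius of the sphere which contains `Σ`. -/
theorem IsSolution.exists_center {Ω : Set (E n)} {ν : E n → E n} {c c₀ : ℝ} {f : E n → ℝ}
    {w : Fin (n + 1) → E n → ℝ} {D : Fin (n + 1) → Fin (n + 1) → E n → ℝ}
    (h : IsSolution Ω ν c c₀ f w D) (hΩ : IsAdmissible Ω) (hν : IsOuterNormalField Ω ν)
    (hneg : ∀ᵐ x ∂(volume.restrict Ω), f x ≤ 0) :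
    ∃ z : E n, 0 < c₀ ∧
      (∀ᵐ x ∂(volume.restrict Ω),
        f x = (‖x - z‖ ^ 2 - ((n : ℝ) + 1) ^ 2 * c₀ ^ 2) / (2 * ((n : ℝ) + 1))) ∧
      (∀ i, ∀ᵐ x ∂(volume.restrict Ω), w i x = (x i - z i) / ((n : ℝ) + 1)) ∧
      Ω ⊆ Metric.closedBall z (((n : ℝ) + 1) * c₀) ∧
      ∀ x ∈ frontier Ω ∩ upper n, x - z = (((n : ℝ) + 1) * c₀) • ν x := by
  obtain ⟨z, b, hf, hw⟩ := h.exists_quadratic hΩ hν hneg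
  have key := fun x (hx : x ∈ frontier Ω ∩ upper n) => h.sub_eq_of_mem_frontier hΩ hν hf hw hx
  set K : ℝ := (n : ℝ) + 1 with hK
  have hK0 : 0 < K := by positivity
  obtain ⟨x₀, hx₀⟩ := hΩ.nonempty_frontier_upper
  obtain ⟨hxz, hxb⟩ := key x₀ hx₀
  have hnorm : ‖x₀ - z‖ ^ 2 = K ^ 2 * c₀ ^ 2 := by
    rw [hxz, norm_smul, (hν.isNormal x₀ hx₀).1, mul_one, Real.norm_eq_abs, sq_abs, mul_pow]
  have hfq : ∀ᵐ x ∂(volume.restrict Ω), f x = (‖x - z‖ ^ 2 - K ^ 2 * c₀ ^ 2) / (2 * K) := by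
    filter_upwards [hf] with x hx
    have hb' : b = -(K ^ 2 * c₀ ^ 2) / (2 * K) := by
      rw [← hnorm]
      linarith [hxb, neg_div (2 * K) (‖x₀ - z‖ ^ 2)]
    rw [hx, sum_sub_mul_self, hb']
    ring
  have hle : ∀ x ∈ Ω, ‖x - z‖ ^ 2 ≤ K ^ 2 * c₀ ^ 2 := by
    have hopen : IsOpen (Ω ∩ {x | K ^ 2 * c₀ ^ 2 < ‖x - z‖ ^ 2}) :=
      hΩ.isOpen.inter (isOpen_lt continuous_const (by fun_prop))
    intro x hx
    by_contra hcon
    refine (hopen.measure_pos volume ⟨x, hx, not_le.1 hcon⟩).ne' ?_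
    have h0 : ∀ᵐ x ∂(volume.restrict Ω), ‖x - z‖ ^ 2 ≤ K ^ 2 * c₀ ^ 2 := by
      filter_upwards [hfq, hneg] with y hy hy'
      rw [hy, div_nonpos_iff] at hy'
      rcases hy' with hy' | hy'
      · linarith [hy'.2]
      · linarith [hy'.1]
    rw [ae_restrict_iff' hΩ.isOpen.measurableSet] at h0
    refine measure_mono_null (fun y hy => ?_) (ae_iff.1 h0)
    exact fun hh => not_lt.2 (hh hy.1) hy.2
  -- If c₀ = 0, then Ω would lie in the single point z. If c₀ < 0, then ν points towards z, and
  -- moving from x₀ into Ω along -ν leaves the closed ball that contains Ω.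
  have hpos : 0 < c₀ := by
    by_contra hcon
    rcases (not_lt.1 hcon).eq_or_lt with h0 | hlt
    · have hsub : Ω ⊆ {z} := fun x hx => by
        have := hle x hx
        rw [h0] at this
        have : ‖x - z‖ ^ 2 = 0 := le_antisymm (by simpa using this) (sq_nonneg _)
        simpa [sub_eq_zero] using this
      have := interior_mono hsub
      rw [hΩ.isOpen.interior_eq, interior_singleton] at this
      exact (hΩ.isConnected.nonempty.mono this).ne_empty rfl
    · obtain ⟨hν1, ρ, hρ, ⟨a, ha, hga⟩, hnear⟩ := hν.isNormal x₀ hx₀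
      obtain ⟨V, hVsub, hVo, hxV⟩ := mem_nhds_iff.1 hnear
      have h0 := eq_zero_of_mem_frontier hΩ.isOpen hVo hρ.continuous hVsub hxV hx₀.1
      have hin : inner ℝ (gradient ρ x₀) (-ν x₀) < 0 := by
        rw [hga, inner_smul_left, inner_neg_right, real_inner_self_eq_norm_sq, hν1]
        simpa using ha
      obtain ⟨t, ⟨ht1, ht2⟩, ht0⟩ := ((eventually_neg_of_inner_gradient_neg hρ h0 hin).and
        ((tendsto_add_smul x₀ (-ν x₀)).eventually (hVo.eventually_mem hxV))).and
        (self_mem_nhdsWithin) |>.exists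
      have htΩ := hle _ ((hVsub ht2).2 ht1)
      have e : x₀ + t • -ν x₀ - z = (K * c₀ - t) • ν x₀ := by
        rw [add_sub_right_comm, hxz]
        module
      rw [e, norm_smul, hν1, mul_one, Real.norm_eq_abs, sq_abs] at htΩ
      have ht0' : 0 < t := ht0
      nlinarith [mul_pos hK0 (neg_pos.2 hlt)]
  refine ⟨z, hpos, hfq, hw, fun x hx => ?_, fun x hx => (key x hx).1⟩
  rw [Metric.mem_closedBall, dist_eq_norm]
  refine abs_le_of_sq_le_sq' ?_ (by positivity) |>.2
  rw [mul_pow]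
  exact hle x hx

theorem isClosed_sphere_inter_halfSpace (z : E n) (R : ℝ) :
    IsClosed (Metric.sphere z R ∩ {x : E n | 0 ≤ x (Fin.last n)}) :=
  Metric.isClosed_sphere.inter
    (isClosed_le continuous_const (contDiff_coord (Fin.last n)).continuous)

/-- The open ball cut with the half-space is convex, meets Ω and contains no frontier point of Ω,
because these lie on the sphere. -/
theorem IsAdmissible.eq_ball_inter_upper {Ω : Set (E n)} (hΩ : IsAdmissible Ω) {z : E n} {R : ℝ}
    (hR : 0 < R) (hsub : Ω ⊆ Metric.closedBall z R)
    (hS : ∀ x ∈ frontier Ω ∩ upper n, ‖x - z‖ = R) : Ω = Metric.ball z R ∩ upper n := by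
  have hball : Ω ⊆ Metric.ball z R := by
    have := interior_mono hsub
    rwa [hΩ.isOpen.interior_eq, interior_closedBall z hR.ne'] at this
  refine (Set.subset_inter hball hΩ.subset_upper).antisymm ?_
  refine ((convex_ball z R).inter convex_upper).isPreconnected.subset_of_disjoint_frontier
    hΩ.isOpen ?_ fun x hx hxf => ?_
  · obtain ⟨y, hy⟩ := hΩ.isConnected.nonempty
    exact ⟨y, ⟨hball hy, hΩ.subset_upper hy⟩, hy⟩
  · have h1 := hS x ⟨hxf, hx.2⟩
    have h2 := hx.1
    rw [Metric.mem_ball, dist_eq_norm] at h2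
    exact h2.ne h1

/-! ### Geometry of a ball cut by the hyperplane -/

section

variable {z : E n} {R : ℝ}

theorem mem_frontier_of_mem_sphere (hR : 0 < R) {x : E n} (hx : ‖x - z‖ = R) (hxu : x ∈ upper n) :
    x ∈ frontier (Metric.ball z R ∩ upper n) := by
  rw [(Metric.isOpen_ball.inter isOpen_upper).frontier_eq]
  refine ⟨mem_closure_of_tendsto (tendsto_add_smul x (z - x)) ?_, fun h => ?_⟩
  · filter_upwards [Ioo_mem_nhdsGT (zero_lt_one' ℝ),
      (tendsto_add_smul x (z - x)).eventually (isOpen_upper.eventually_mem hxu)] with t ht htu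
    refine ⟨?_, htu⟩
    have e : x + t • (z - x) - z = (1 - t) • (x - z) := by module
    rw [Metric.mem_ball, dist_eq_norm, e, norm_smul, hx, Real.norm_eq_abs,
      abs_of_pos (by linarith [ht.2])]
    nlinarith [ht.1]
  · have := h.1
    rw [Metric.mem_ball, dist_eq_norm, hx] at this
    exact lt_irrefl _ this

theorem frontier_inter_upper_eq (hR : 0 < R) :
    frontier (Metric.ball z R ∩ upper n) ∩ upper n = Metric.sphere z R ∩ upper n := by
  ext x
  refine ⟨fun h => ⟨?_, h.2⟩, fun h => ⟨mem_frontier_of_mem_sphere hR ?_ h.2, h.2⟩⟩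
  · have hx := h.1
    rw [(Metric.isOpen_ball.inter isOpen_upper).frontier_eq] at hx
    have h1 := Metric.closure_ball_subset_closedBall (closure_mono Set.inter_subset_left hx.1)
    exact le_antisymm h1 (not_lt.1 fun hlt => hx.2 ⟨hlt, h.2⟩)
  · simpa [dist_eq_norm] using h.1

theorem capPart_subset (hR : 0 < R) :
    capPart (Metric.ball z R ∩ upper n) ⊆ Metric.sphere z R ∩ {x | 0 ≤ x (Fin.last n)} := by
  rw [capPart, frontier_inter_upper_eq hR]
  refine closure_minimal (fun x hx => ⟨hx.1, ?_⟩) (isClosed_sphere_inter_halfSpace z R)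
  have : 0 < x (Fin.last n) := hx.2
  exact this.le

theorem sphere_inter_upper_subset_capPart (hR : 0 < R) :
    Metric.sphere z R ∩ upper n ⊆ capPart (Metric.ball z R ∩ upper n) := by
  rw [capPart, frontier_inter_upper_eq hR]
  exact subset_closure

theorem abs_sub_last_le (x : E n) : |x (Fin.last n) - z (Fin.last n)| ≤ ‖x - z‖ := by
  have := PiLp.norm_apply_le (x - z) (Fin.last n)
  simpa using this

/-- At a point where the sphere touches the hyperplane, the defining functions of `Σ` and `Γ`
have parallel gradients. -/
theorem last_ne_radius (hR : 0 < R)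
    (hΩ : IsAdmissible (Metric.ball z R ∩ upper n)) : z (Fin.last n) ≠ R := by
  intro hz
  obtain ⟨p, hp⟩ := hΩ.corner_nonempty
  have hp0 : p (Fin.last n) = 0 := hp.2.2
  have hpS : ‖p - z‖ = R := by simpa [dist_eq_norm] using (capPart_subset hR hp.1).1
  have hpe : p - z = -(R • e n) := by
    have h1 : ‖p - z + R • e n‖ ^ 2 = 0 := by
      rw [norm_add_sq_real, inner_smul_right, inner_e, PiLp.sub_apply, hp0, hz, hpS, norm_smul,
        norm_e, Real.norm_eq_abs, abs_of_pos hR]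
      ring
    have h2 : p - z + R • e n = 0 := by simpa using h1
    exact eq_neg_of_add_eq_zero_left h2
  obtain ⟨ρ, η, hρ, hη, hli, hnear⟩ := hΩ.smooth_boundary p hp
  obtain ⟨j, hj, hne⟩ := exists_pderiv_ne_zero_of_linearIndependent hli
  set v : E n := EuclideanSpace.single j (1 : ℝ) with hv
  have hvn : ‖v‖ = 1 := by simp [hv]
  have hve : inner ℝ v (e n) = 0 := by
    rw [inner_e, hv, PiLp.single_apply, if_neg (Ne.symm hj)]
  -- A great circle through the lowest point p with horizontal velocity R E_j. It stays in Σ, so ρ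
  -- is constant and η is minimal along it at p; hence ∂_jρ = ∂_jη = 0, against the choice of j.
  set γ : ℝ → E n := fun t => z + ((-(R * Real.cos t)) • e n + (R * Real.sin t) • v) with hγ
  have hγ0 : γ 0 = p := by
    rw [hγ]
    simp only [Real.cos_zero, mul_one, Real.sin_zero, mul_zero, zero_smul, add_zero, neg_smul]
    rw [← hpe]
    abel
  have hγd : HasDerivAt γ (R • v) 0 := by
    have h1 : HasDerivAt (fun t => (-(R * Real.cos t)) • e n) ((-(R * -Real.sin 0)) • e n) 0 :=
      ((Real.hasDerivAt_cos 0).const_mul R).neg.smul_const (e n)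
    have h2 : HasDerivAt (fun t => (R * Real.sin t) • v) ((R * Real.cos 0) • v) 0 :=
      ((Real.hasDerivAt_sin 0).const_mul R).smul_const v
    have h3 : HasDerivAt γ ((-(R * -Real.sin 0)) • e n + (R * Real.cos 0) • v) 0 :=
      (h1.fun_add h2).const_add z
    have e0 : (-(R * -Real.sin 0)) • e n + (R * Real.cos 0) • v = R • v := by simp
    rwa [e0] at h3
  have hγc : Tendsto γ (𝓝 0) (𝓝 p) := hγ0 ▸ hγd.continuousAt.tendsto
  have hγS : ∀ t, ‖γ t - z‖ = R := fun t => by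
    have e1 : γ t - z = (-(R * Real.cos t)) • e n + (R * Real.sin t) • v := by
      rw [hγ]; simp
    have h1 : ‖γ t - z‖ ^ 2 = R ^ 2 := by
      rw [e1, norm_add_sq_real, inner_smul_left, inner_smul_right, real_inner_comm, hve, norm_smul,
        norm_smul, hvn, norm_e, mul_one, mul_one, Real.norm_eq_abs, Real.norm_eq_abs, sq_abs,
        sq_abs]
      have := Real.sin_sq_add_cos_sq t
      simp only [conj_trivial, mul_zero, add_zero]
      linear_combination R ^ 2 * this
    exact (sq_eq_sq₀ (norm_nonneg _) hR.le).1 h1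
  have hγcap : ∀ t ∈ Set.Ioo (-1 : ℝ) 1, γ t ∈ capPart (Metric.ball z R ∩ upper n) := by
    intro t ht
    by_cases h0 : t = 0
    · rw [h0, hγ0]
      exact hp.1
    · refine sphere_inter_upper_subset_capPart hR ⟨by simpa [dist_eq_norm] using hγS t, ?_⟩
      change 0 < γ t (Fin.last n)
      have hvl : v (Fin.last n) = 0 := by rw [← inner_e, hve]
      have e1 : γ t (Fin.last n) = R * (1 - Real.cos t) := by
        rw [hγ]
        simp only [PiLp.add_apply, PiLp.smul_apply, e_last, hvl, hz, smul_eq_mul]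
        ring
      rw [e1]
      have hlt : Real.cos t < 1 := by
        rw [← Real.cos_abs]
        have habs : |t| < 1 := abs_lt.2 ht
        exact Real.cos_zero ▸ Real.cos_lt_cos_of_nonneg_of_le_pi le_rfl
          (by linarith [Real.pi_gt_three]) (abs_pos.2 h0)
      exact mul_pos hR (by linarith)
  have hev : ∀ᶠ t in 𝓝 (0 : ℝ), ρ (γ t) = 0 ∧ 0 ≤ η (γ t) := by
    filter_upwards [hγc.eventually hnear, Ioo_mem_nhds (show (-1 : ℝ) < 0 by norm_num)
      zero_lt_one] with t ht ht1 using ht.1.1 (hγcap t ht1)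
  have hη0 : η p = 0 := (hnear.self_of_nhds.2.1 hp).2
  have hcomp : ∀ {h : E n → ℝ}, ContDiff ℝ ∞ h → HasDerivAt (fun t => h (γ t)) (R * pderiv j h p) 0 :=
    fun {h} hh => by
      have h1 := (hγ0 ▸ (hh.diffAt p).hasFDerivAt : HasFDerivAt h (fderiv ℝ h p) (γ 0))
      have h2 := h1.comp_hasDerivAt 0 hγd
      rwa [map_smul, smul_eq_mul] at h2
  rcases hne with hne | hne
  · have h1 : (fun t => ρ (γ t)) =ᶠ[𝓝 0] fun _ => 0 := hev.mono fun t ht => ht.1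
    have h2 := (hcomp hρ).unique ((hasDerivAt_const (0 : ℝ) (0 : ℝ)).congr_of_eventuallyEq h1)
    exact hne ((mul_eq_zero.1 h2).resolve_left hR.ne')
  · have h1 : IsLocalMin (fun t => η (γ t)) 0 := by
      filter_upwards [hev] with t ht
      rw [hγ0, hη0]
      exact ht.2
    exact hne ((mul_eq_zero.1 (h1.hasDerivAt_eq_zero (hcomp hη))).resolve_left hR.ne')

/-- Nonemptiness gives z_{n+1} > -R, and a point of Γ gives z_{n+1} ≤ R; equality would be tangency.
-/
theorem abs_last_lt_radius (hR : 0 < R)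
    (hΩ : IsAdmissible (Metric.ball z R ∩ upper n)) : |z (Fin.last n)| < R := by
  rw [abs_lt]
  constructor
  · obtain ⟨x, hx, hxu⟩ := hΩ.isConnected.nonempty
    have h1 := abs_le.1 (abs_sub_last_le (z := z) x)
    rw [Metric.mem_ball, dist_eq_norm] at hx
    have : 0 < x (Fin.last n) := hxu
    linarith [h1.2]
  · obtain ⟨p, hp⟩ := hΩ.corner_nonempty
    have hp0 : p (Fin.last n) = 0 := hp.2.2
    have hpS : ‖p - z‖ = R := by simpa [dist_eq_norm] using (capPart_subset hR hp.1).1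
    have h1 := abs_le.1 (abs_sub_last_le (z := z) p)
    exact lt_of_le_of_ne (by linarith [h1.1]) (last_ne_radius hR hΩ)

/-- The point is that sphere points in the hyperplane are limits of sphere points above it. Since
|z_{n+1}| < R, the sphere crosses the hyperplane transversally there: e_{n+1} has a tangential part
with positive last coordinate. -/
theorem capPart_eq (hR : 0 < R) (hz : |z (Fin.last n)| < R) :
    capPart (Metric.ball z R ∩ upper n) = Metric.sphere z R ∩ {x | 0 ≤ x (Fin.last n)} := by
  refine (capPart_subset hR).antisymm ?_
  rintro x ⟨hxS, hx0⟩
  have hx0' : 0 ≤ x (Fin.last n) := hx0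
  have hxn : ‖x - z‖ = R := by simpa [dist_eq_norm] using hxS
  rcases hx0'.lt_or_eq with hpos | hzero
  · exact sphere_inter_upper_subset_capPart hR ⟨hxS, hpos⟩
  set a := x - z with ha
  set h := z (Fin.last n) with hh
  have hal : a (Fin.last n) = -h := by rw [ha, PiLp.sub_apply, ← hzero]; ring
  have hsq : h ^ 2 < R ^ 2 := sq_lt_sq' (abs_lt.1 hz).1 (abs_lt.1 hz).2
  -- reflections of `x` at hyperplanes through the centre, close to a tangential hyperplane
  set d : ℝ → E n := fun t => e n + ((h - t) / R ^ 2) • a with hd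
  have had : ∀ t, inner ℝ a (d t) = -t := fun t => by
    rw [hd]
    simp only [inner_add_right, inner_smul_right, inner_e, real_inner_self_eq_norm_sq, hxn, hal]
    field_simp
    ring
  have hdl : ∀ t, d t (Fin.last n) = 1 - (h - t) * h / R ^ 2 := fun t => by
    rw [hd]
    simp only [PiLp.add_apply, PiLp.smul_apply, e_last, hal, smul_eq_mul]
    ring
  have hdc : Continuous d := by rw [hd]; fun_prop
  have hdl0 : 0 < d 0 (Fin.last n) := by
    rw [hdl, sub_zero, sub_pos, div_lt_one (by positivity)]
    linarith [sq h]
  have hd0 : d 0 ≠ 0 := fun h0 => by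
    rw [h0] at hdl0
    exact lt_irrefl _ hdl0
  set y : ℝ → E n := fun t => x - (2 * inner ℝ a (d t) / ‖d t‖ ^ 2) • d t with hy
  have hcoef : ContinuousAt (fun t => 2 * inner ℝ a (d t) / ‖d t‖ ^ 2) 0 := by
    simp only [had]
    exact ContinuousAt.div (by fun_prop) (hdc.norm.pow 2).continuousAt
      (pow_ne_zero 2 (norm_ne_zero_iff.2 hd0))
  have hyc : ContinuousAt y 0 := continuousAt_const.sub (hcoef.smul hdc.continuousAt)
  have hy0 : y 0 = x := by
    rw [hy]
    simp [had]
  have hlim : Tendsto y (𝓝[>] 0) (𝓝 x) := hy0 ▸ hyc.tendsto.mono_left nhdsWithin_le_nhds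
  have hclosed : IsClosed (capPart (Metric.ball z R ∩ upper n)) := isClosed_closure
  refine hclosed.mem_of_tendsto hlim ?_
  have hdpos : ∀ᶠ t in 𝓝[>] (0 : ℝ), 0 < d t (Fin.last n) :=
    nhdsWithin_le_nhds ((((contDiff_coord (Fin.last n)).continuous.comp hdc).continuousAt
      (x := 0)).eventually_const_lt hdl0)
  filter_upwards [hdpos, self_mem_nhdsWithin] with t ht ht0
  have ht0' : 0 < t := ht0
  have hdn : 0 < ‖d t‖ := norm_pos_iff.2 fun h0 => by
    rw [h0] at ht
    exact lt_irrefl _ ht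
  refine sphere_inter_upper_subset_capPart hR ⟨?_, ?_⟩
  · rw [Metric.mem_sphere, dist_eq_norm]
    have e1 : y t - z = a - (2 * inner ℝ a (d t) / ‖d t‖ ^ 2) • d t := by
      rw [hy, ha]
      simp only
      abel
    refine (sq_eq_sq₀ (norm_nonneg _) hR.le).1 ?_
    rw [e1, norm_sub_sq_real, inner_smul_right, norm_smul, mul_pow, Real.norm_eq_abs, sq_abs, hxn]
    field_simp
    ring
  · change 0 < y t (Fin.last n)
    have e1 : y t (Fin.last n) = 2 * t / ‖d t‖ ^ 2 * d t (Fin.last n) := by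
      rw [hy]
      simp only [PiLp.sub_apply, PiLp.smul_apply, smul_eq_mul, had, ← hzero]
      ring
    rw [e1]
    positivity

theorem mem_flatPart_iff (hR : 0 < R) (hz : |z (Fin.last n)| < R) {y : E n}
    (hy : y (Fin.last n) = 0) :
    y ∈ flatPart (Metric.ball z R ∩ upper n) ↔ ‖y - z‖ ≤ R := by
  constructor
  · intro h
    have := Metric.closure_ball_subset_closedBall (closure_mono Set.inter_subset_left
      (frontier_subset_closure h.1))
    rwa [Metric.mem_closedBall, dist_eq_norm] at this
  · intro h
    refine ⟨?_, hy⟩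
    rcases h.lt_or_eq with hlt | heq
    · rw [(Metric.isOpen_ball.inter isOpen_upper).frontier_eq]
      refine ⟨mem_closure_of_tendsto (tendsto_add_smul y (e n)) ?_, fun h => ?_⟩
      · have hyb : y ∈ Metric.ball z R := by rwa [Metric.mem_ball, dist_eq_norm]
        filter_upwards [(tendsto_add_smul y (e n)).eventually
          (Metric.isOpen_ball.eventually_mem hyb), self_mem_nhdsWithin] with t ht ht0
        refine ⟨ht, ?_⟩
        change 0 < (y + t • e n) (Fin.last n)
        simp only [PiLp.add_apply, PiLp.smul_apply, e_last, hy, smul_eq_mul, mul_one, zero_add]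
        exact ht0
      · have : 0 < y (Fin.last n) := h.2
        exact this.ne' hy
    · have hcap : y ∈ capPart (Metric.ball z R ∩ upper n) := by
        rw [capPart_eq hR hz]
        exact ⟨by simpa [dist_eq_norm] using heq, hy.ge⟩
      exact isClosed_frontier.closure_subset_iff.2 Set.inter_subset_left hcap

theorem norm_sub_sq_of_last_eq_zero {y : E n} (hy : y (Fin.last n) = 0) :
    ‖y - (z - z (Fin.last n) • e n)‖ ^ 2 = ‖y - z‖ ^ 2 - z (Fin.last n) ^ 2 := by
  have e1 : y - (z - z (Fin.last n) • e n) = (y - z) + z (Fin.last n) • e n := by abel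
  rw [e1, norm_add_sq_real, inner_smul_right, inner_e, PiLp.sub_apply, hy, norm_smul, norm_e,
    mul_one, Real.norm_eq_abs, sq_abs]
  ring

/-- T is the closed ball of the hyperplane about the projection p of z, with radius R sin θ. At a
point x of Γ the radius x - z splits into the horizontal part x - p and the vertical part -z_{n+1}
e_{n+1} = R cos θ e_{n+1}. -/
theorem meetsAtAngle_of_eq_normal (hR : 0 < R) (hz : |z (Fin.last n)| < R) {ν : E n → E n}
    (hν : IsOuterNormalField (Metric.ball z R ∩ upper n) ν)
    (hνz : ∀ x ∈ frontier (Metric.ball z R ∩ upper n) ∩ upper n, x - z = R • ν x) {θ : ℝ}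
    (hθ : θ ∈ Set.Ioo 0 Real.pi) (hcos : R * Real.cos θ = -z (Fin.last n)) :
    MeetsAtAngle (Metric.ball z R ∩ upper n) ν θ := by
  set Ω := Metric.ball z R ∩ upper n with hΩ
  intro x hx
  have hx0 : x (Fin.last n) = 0 := hx.2.2
  have hxS : ‖x - z‖ = R := by simpa [dist_eq_norm] using (capPart_subset hR hx.1).1
  have hsin : 0 < Real.sin θ := Real.sin_pos_of_mem_Ioo hθ
  -- Known on Σ inside the half-space; it extends to Γ by continuity of ν.
  have hνx : ν x = R⁻¹ • (x - z) := by
    have hne : (𝓝[frontier Ω ∩ upper n] x).NeBot := mem_closure_iff_nhdsWithin_neBot.1 hx.1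
    have h1 : Tendsto ν (𝓝[frontier Ω ∩ upper n] x) (𝓝 (ν x)) :=
      (hν.continuousOn x hx.1).mono_left (nhdsWithin_mono _ subset_closure)
    have h2 : Tendsto (fun y : E n => R⁻¹ • (y - z)) (𝓝[frontier Ω ∩ upper n] x)
        (𝓝 (R⁻¹ • (x - z))) := by
      have : Continuous fun y : E n => R⁻¹ • (y - z) := by fun_prop
      exact (this.tendsto x).mono_left nhdsWithin_le_nhds
    refine tendsto_nhds_unique h1 (h2.congr' ?_)
    filter_upwards [self_mem_nhdsWithin] with y hy
    rw [hνz y hy, smul_smul, inv_mul_cancel₀ hR.ne', one_smul]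
  set p := z - z (Fin.last n) • e n with hp
  have hp0 : p (Fin.last n) = 0 := by
    rw [hp]
    simp [e_last]
  have hRs : 0 < R * Real.sin θ := mul_pos hR hsin
  have hxp2 : ‖x - p‖ ^ 2 = (R * Real.sin θ) ^ 2 := by
    rw [norm_sub_sq_of_last_eq_zero hx0, hxS, mul_pow, Real.sin_sq, ← neg_sq (z (Fin.last n)),
      ← hcos]
    ring
  have hxp : ‖x - p‖ = R * Real.sin θ := (sq_eq_sq₀ (norm_nonneg _) hRs.le).1 hxp2
  refine ⟨(R * Real.sin θ)⁻¹ • (x - p), ⟨?_, ?_, fun y =>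
    (∑ i, (y i - p i) * (y i - p i)) + -(R * Real.sin θ) ^ 2,
    (contDiff_sum_sub_mul_self p).add contDiff_const, ⟨2 * (R * Real.sin θ), by positivity, ?_⟩,
    .of_forall fun y hy => ?_⟩, ?_⟩
  · rw [norm_smul, hxp, norm_inv, Real.norm_eq_abs, abs_of_pos hRs, inv_mul_cancel₀ hRs.ne']
  · simp [hx0, hp0]
  · ext i
    rw [gradient_apply, pderiv_add (contDiff_sum_sub_mul_self p) contDiff_const,
      pderiv_sum_sub_mul_self, pderiv_const]
    simp only [PiLp.smul_apply, PiLp.sub_apply, smul_eq_mul]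
    field_simp
    ring
  · have hy0 : y (Fin.last n) = 0 := hy
    beta_reduce
    rw [mem_flatPart_iff hR hz hy0, sum_sub_mul_self, norm_sub_sq_of_last_eq_zero hy0,
      ← hxp2, norm_sub_sq_of_last_eq_zero hx0, hxS, ← sq_le_sq₀ (norm_nonneg _) hR.le]
    constructor <;> intro h <;> linarith
  · rw [hνx, Nbar, smul_neg, neg_neg, smul_smul, mul_inv, mul_comm R⁻¹, ← mul_assoc,
      mul_inv_cancel₀ hsin.ne', one_mul]
    have e1 : x - p = (x - z) + z (Fin.last n) • e n := by rw [hp]; abel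
    have e2 : Real.cos θ = -(R⁻¹ * z (Fin.last n)) := by
      rw [← mul_neg, ← hcos, ← mul_assoc, inv_mul_cancel₀ hR.ne', one_mul]
    rw [e1, e2]
    module

end

/-- At one point of T away from Σ, the condition w_{n+1} + c = 0 holds pointwise for the affine
function (x_{n+1} - z_{n+1})/K + c, where x_{n+1} = 0. -/
theorem IsSolution.last_center_eq {Ω : Set (E n)} {ν : E n → E n} {c c₀ : ℝ} {f : E n → ℝ}
    {w : Fin (n + 1) → E n → ℝ} {D : Fin (n + 1) → Fin (n + 1) → E n → ℝ}
    (h : IsSolution Ω ν c c₀ f w D) (hΩ : IsAdmissible Ω) {z : E n}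
    (hw : ∀ i, ∀ᵐ x ∂(volume.restrict Ω), w i x = (x i - z i) / ((n : ℝ) + 1))
    (hT : (flatPart Ω \ capPart Ω).Nonempty) : z (Fin.last n) = ((n : ℝ) + 1) * c := by
  have hb := hΩ.isBounded
  set K : ℝ := (n : ℝ) + 1 with hK
  have hK0 : K ≠ 0 := by positivity
  obtain ⟨x, hx, hx'⟩ := hT
  obtain ⟨U, N, hxU, hU⟩ := hΩ.exists_isFlatChart hx hx'
  set l := Fin.last n with hl
  have hs := contDiff_coord_sub z l
  have hF : ContDiff ℝ ∞ fun y : E n => K⁻¹ * (y l - z l) + c :=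
    (contDiff_const.mul hs).add contDiff_const
  have hval : (fun y => w l y + c) =ᵐ[volume.restrict Ω] fun y => K⁻¹ * (y l - z l) + c := by
    filter_upwards [hw l] with y hy
    rw [hy]
    ring
  have hzero := hU.eq_zero_of_extPartial hΩ.isOpen hb hF (fun k => by
    refine (h.extPartial_w_last hb hU k).congr_ae hval ?_
    have h2 := (((h.isMultiplier_w hb l).add hb (isMultiplier_const hb c)).extPartial
      (extPartial_one_interior hb k)).congr_ae hval .rfl
    have h3 := h2.ae_unique hb hΩ.isOpen ((isMultiplier_of_contDiff hb hF).extPartial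
      (extPartial_one_interior hb k))
    filter_upwards [h3] with y hy
    rw [← hy, add_zero]) hxU hx.1
  have hx0 : x l = 0 := hx.2
  simp only [hx0] at hzero
  field_simp at hzero
  linarith

end HalfSpace

end

/-! ### Assembly of the theorem -/

open HalfSpace in
theorem theorem1p1 (n : ℕ) (hn : 1 ≤ n) (Ω : Set (E n)) (hΩ : IsAdmissible Ω)
    (ν : E n → E n) (hν : IsOuterNormalField Ω ν) (c c₀ : ℝ) (f : E n → ℝ)
    (hf : IsMixedSolution Ω c f)
    (hover : NormalDerivEq Ω (capPart Ω) ν f c₀)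
    (hneg : ∀ᵐ x ∂(volume.restrict Ω), f x ≤ 0) :
    0 < c₀ ∧
    (∃ z : E n, z (Fin.last n) = (n + 1 : ℝ) * c ∧
      Ω = Metric.ball z ((n + 1 : ℝ) * c₀) ∩ upper n ∧
      (∀ᵐ x ∂(volume.restrict Ω),
        f x = (‖x - z‖ ^ 2 - (n + 1 : ℝ) ^ 2 * c₀ ^ 2) / (2 * (n + 1 : ℝ))) ∧
      capPart Ω = Metric.sphere z ((n + 1 : ℝ) * c₀) ∩ {x | 0 ≤ x (Fin.last n)}) ∧
    ∃ θ ∈ Set.Ioo 0 Real.pi, Real.cos θ = -c / c₀ ∧ MeetsAtAngle Ω ν θ := by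
  obtain ⟨w, D, h⟩ := exists_isSolution hΩ.isOpen hf hover
  obtain ⟨z, hc₀, hfz, hw, hsub, hνz⟩ := h.exists_center hΩ hν hneg
  have hK : (0 : ℝ) < n + 1 := by positivity
  have hR : 0 < ((n : ℝ) + 1) * c₀ := mul_pos hK hc₀
  have hball := hΩ.eq_ball_inter_upper hR hsub fun x hx => by
    rw [hνz x hx, norm_smul, (hν.isNormal x hx).1, mul_one, Real.norm_eq_abs, abs_of_pos hR]
  have hz : |z (Fin.last n)| < ((n : ℝ) + 1) * c₀ := abs_last_lt_radius hR (hball ▸ hΩ)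
  have hcap : capPart Ω = Metric.sphere z (((n : ℝ) + 1) * c₀) ∩ {x | 0 ≤ x (Fin.last n)} := by
    rw [hball]
    exact capPart_eq hR hz
  have hzc : z (Fin.last n) = ((n : ℝ) + 1) * c := by
    -- The projection of the centre to the hyperplane has distance |z_{n+1}| < R from z, so it lies
    -- in T but not on Σ.
    refine h.last_center_eq hΩ hw ⟨z - z (Fin.last n) • e n, ?_, fun hp => ?_⟩
    · rw [hball, mem_flatPart_iff hR hz (by simp [e_last])]
      simpa [norm_smul, norm_e] using hz.le
    · rw [hcap] at hp
      have := hp.1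
      rw [Metric.mem_sphere, dist_eq_norm] at this
      simp only [sub_sub_cancel_left, norm_neg, norm_smul, norm_e, mul_one, Real.norm_eq_abs]
        at this
      exact hz.ne this
  refine ⟨hc₀, ⟨z, hzc, hball, hfz, hcap⟩, ?_⟩
  -- With z_{n+1} = K c, transversality |z_{n+1}| < K c₀ is exactly what makes arccos(-c/c₀) lie in
  -- the open interval (0, π).
  have habs : |c| < c₀ := by
    rw [hzc, abs_mul, abs_of_pos hK] at hz
    exact lt_of_mul_lt_mul_left hz hK.le
  have h1 : -1 < -c / c₀ := by
    rw [lt_div_iff₀ hc₀]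
    linarith [(abs_lt.1 habs).2]
  have h2 : -c / c₀ < 1 := by
    rw [div_lt_one hc₀]
    linarith [(abs_lt.1 habs).1]
  have hcos : Real.cos (Real.arccos (-c / c₀)) = -c / c₀ := Real.cos_arccos h1.le h2.le
  have hθ : Real.arccos (-c / c₀) ∈ Set.Ioo 0 Real.pi :=
    ⟨Real.arccos_pos.2 h2, Real.arccos_lt_pi.2 h1⟩
  refine ⟨_, hθ, hcos, ?_⟩
  rw [hball] at hν hνz ⊢
  refine meetsAtAngle_of_eq_normal hR hz hν hνz hθ ?_
  rw [hcos, hzc]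
  field_simp
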